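/- **Setting.** A generic individual has outcomes $Y_{t-1},Y_t\in\mathbb R$, a treatment intensity $D\in\mathbb R$, covariates $X$ in a measurable space, and potential outcomes $Y_{t-1}(0)$, $Y_t(s)$; put $Z=(Y_{t-1},Y_t,D,X)$ and $\Delta Y=Y_t-Y_{t-1}$. The observations $Z_1,Z_2,\dots$ are i.i.d. copies of $Z$. Let $0<d_L<d_H<\infty$, $\mathcal D=(d_L,d_H)$ and $0<\kappa<\tfrac12$, and assume the following. *Support.* $D$ has support $\{0\}\cup[d_L,d_H]$; off the atom $0$, the law of $D$ has a density $f_D$, the conditional law of $D$ given $X=x$ a density $f_{D|X}(\cdot\mid x)$, and the law of $(\Delta Y,D)$ on $\{D\neq0\}$ a joint density $f_{\Delta Y,D}$. Almost surely $\kappa<g_0(X)<1-\kappa$, where $g_0(X)=P(D=0\mid X)$, and $f_{D|X}(s\mid X)>\kappa$ for all $s\in[d_L,d_H]$. *No anticipation.* $Y_t=Y_t(D)$ and $Y_{t-1}=Y_{t-1}(0)$ almost surely. *Conditional parallel trends.* $Y_t(0)$ is integrable, and $E[Y_t(0)-Y_{t-1}(0)\mid X,D=s]=E[Y_t(0)-Y_{t-1}(0)\mid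 X,D=0]$ for $s\in[d_L,d_H]$ (almost everywhere with respect to the law of $(X,D)$). *Kernel.* $K:\mathbb R\to\mathbb R$ is bounded and differentiable, $K(u)$, $uK(u)$ and $u^2K(u)$ are integrable, $\int K=1$, $\int uK(u)\,du=0$, $0<\int u^2K(u)\,du$, and $K(u)=O(|u|^{-3})$ as $|u|\to\infty$. Put $K_h(u)=h^{-1}K(u/h)$. *Target, nuisance parameters, score.* Let $ATT(d)=E[Y_t(d)-Y_t(0)\mid D=d]$, understood as $\lim_{r\downarrow0}E[Y_t(D)-Y_t(0)\mid |D-d|\le r]$. Let $f_h^0(d\mid X)=E[K_h(D-d)\mid X]$, $\mathcal E^0_{\Delta Y}(X)=E[\Delta Y\mid X,D=0]$, $\eta_0=(f_h^0(d\mid\cdot),g_0,\mathcal E^0_{\Delta Y})$, and for $\eta=(f_h,g,\mathcal E)$ $$w_h(Z;f,\eta)=\frac{K_h(D-d)g(X)-\mathbf 1\{D=0\}f_h(X)}{f\,g(X)},\qquad \psi_h(Z,\theta,f,\eta)=w_h(Z;f,\eta)\,(\Delta Y-\mathcal E(X))-\theta,$$ $\theta_{0h}(d)=ATT_h(d)=E[\Delta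 Y\,w_h(Z;f_D(d),\eta_0)]$ and $$\sigma_N^2(d)=E\Big[\Big(\psi_h(Z,\theta_{0h}(d),f_D(d),\eta_0)-\frac{\theta_{0h}(d)}{f_D(d)}\big(K_h(D-d)-E[K_h(D-d)]\big)\Big)^2\Big]\quad\text{with } h=h_N.$$ *Bounds and smoothness.* There are $c>0$ and $C<\infty$ such that $\sup_{s\in\mathcal D}f_D(s)>c$, $|Y_{t-1}|<C$, $|Y_t|<C$ and $|\mathcal E^0_{\Delta Y}(X)|<C$ almost surely and, for all large $N$, almost surely $c<f^0_{h_N}(s\mid X)<C$ for all $s\in\mathcal D$. The functions $f_D$, $f_{D|X}(\cdot\mid x)$ and $s\mapsto f_{\Delta Y,D}(t,s)$ are $C^2$ on $\mathcal D$ with second derivatives in $s$ bounded on $\mathcal D$, uniformly in $x$ and $t$ respectively (for almost every $x$ under the law of $X$ and almost every $t$ under the law of $\Delta Y$). *Cross-fitting.* Fix $K_0\ge2$ folds; $N$ runs through the multiples of $K_0$, and $\{1,\dots,N\}$ is partitioned into $I_1,\dots,I_{K_0}$ of size $n=N/K_0$. For each $k$, $\hat\eta_k=(\hat f_{h,k}(d\mid\cdot),\hat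 g_k,\hat{\mathcal E}_k)$ is a measurable function of $(Z_i)_{i\notin I_k}$ and possibly of a random seed independent of the sample, and $\hat f_k(d)=(N-n)^{-1}\sum_{i\notin I_k}K_h(D_i-d)$. The estimator is $$\widehat{ATT}(d)=\frac1{K_0}\sum_{k=1}^{K_0}\frac1n\sum_{i\in I_k}w_h(Z_i;\hat f_k(d),\hat\eta_k)\,\big(\Delta Y_i-\hat{\mathcal E}_k(X_i)\big).$$ *Rates.* As $N\to\infty$: $h=h_N>0$, $h\to0$, $Nh\to\infty$, $\sqrt{Nh^5}\to0$; $\varepsilon_N\to0$, $h^{-1}\varepsilon_N^2\to0$. For each $k$, with probability tending to $1$ (norms over an independent $X$, the estimates held fixed): $\|\hat f_{h,k}(d\mid X)-f_h^0(d\mid X)\|_{P,2}\le h^{-1/2}\varepsilon_N$, $\|\hat g_k(X)-g_0(X)\|_{P,2}\le\varepsilon_N$, $\|\hat{\mathcal E}_k(X)-\mathcal E^0_{\Delta Y}(X)\|_{P,2}\le\varepsilon_N$, $\kappa<\hat g_k(X)<1-\kappa$ and $c<\hat f_{h,k}(d\mid X)<C$ almost surely, and $\|\hat{\mathcal E}_k(X)\|_{P,\infty}<C$.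 **Theorem (asymptotic normality, panel).** Let $d\in\mathcal D$ and assume all of the above, $\varepsilon_N=o(N^{-1/4})$, and that the variance is non-degenerate, $\liminf_{N\to\infty}h_N\,\sigma_N^2(d)>0$. Then the limit defining $ATT(d)$ exists and $$\frac{\widehat{ATT}(d)-ATT(d)}{\sigma_N(d)/\sqrt N}\ \xrightarrow{\;d\;}\ N(0,1).$$ -/

import Mathlib

open MeasureTheory ProbabilityTheory Filter Set
open scoped Topology ENNReal

namespace ContDID

noncomputable section

/-! ### Data and population -/

/-- The space of observed vectors `Z = (Y_{t-1}, Y_t, D, X)`. -/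
abbrev Obs (𝒳 : Type*) : Type _ := ℝ × ℝ × ℝ × 𝒳

/-- `ΔY = Y_t - Y_{t-1}` of an observed vector. -/
def Obs.dY {𝒳 : Type*} (z : Obs 𝒳) : ℝ := z.2.1 - z.1

/-- The treatment intensity `D` of an observed vector. -/
def Obs.trt {𝒳 : Type*} (z : Obs 𝒳) : ℝ := z.2.2.1

/-- The covariates `X` of an observed vector. -/
def Obs.cov {𝒳 : Type*} (z : Obs 𝒳) : 𝒳 := z.2.2.2

/-- The random variables of a generic individual: observed outcomes in the two periods, treatment
intensity, covariates, and the potential outcomes `Y_{t-1}(0)` and `Y_t(d)`. -/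
structure Population (Ω 𝒳 : Type*) [MeasurableSpace Ω] [MeasurableSpace 𝒳] where
  /-- observed outcome `Y_{t-1}` -/
  Ypre : Ω → ℝ
  /-- observed outcome `Y_t` -/
  Ypost : Ω → ℝ
  /-- treatment intensity -/
  D : Ω → ℝ
  /-- covariates -/
  X : Ω → 𝒳
  /-- potential outcome `Y_{t-1}(0)` -/
  potPre : Ω → ℝ
  /-- potential outcomes `Y_t(d)` -/
  potPost : ℝ → Ω → ℝ
  measurable_Ypre : Measurable Ypre
  measurable_Ypost : Measurable Ypost
  measurable_D : Measurable D
  measurable_X : Measurable X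

section Population

variable {Ω 𝒳 : Type*} [MeasurableSpace Ω] [MeasurableSpace 𝒳]

/-- The observed vector of the generic individual. -/
def Population.obs (M : Population Ω 𝒳) (ω : Ω) : Obs 𝒳 := (M.Ypre ω, M.Ypost ω, M.D ω, M.X ω)

/-- `ΔY = Y_t - Y_{t-1}`. -/
def Population.dY (M : Population Ω 𝒳) (ω : Ω) : ℝ := M.Ypost ω - M.Ypre ω

/-- `E[W | V = v]`, as the mean of the regular conditional distribution of `W` given `V`. -/
def condMean {β : Type*} [MeasurableSpace β] (P : Measure Ω) [IsFiniteMeasure P]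
    (W : Ω → ℝ) (V : Ω → β) (v : β) : ℝ :=
  ∫ w, w ∂(condDistrib W V P v)

/-- The mean of the individual effect `Y_t(D) - Y_t(0)` over the individuals whose treatment
intensity is within `r` of `d`. -/
def localEffect (P : Measure Ω) (M : Population Ω 𝒳) (d r : ℝ) : ℝ :=
  ∫ ω, (M.potPost (M.D ω) ω - M.potPost 0 ω) ∂(P[|M.D ⁻¹' Metric.closedBall d r])

/-- `ATT(d) = E[Y_t(d) - Y_t(0) | D = d]`. The event `D = d` is null for `d > 0`; conditioning on it
is the limit of conditioning on `|D - d| ≤ r` as `r ↓ 0`, i.e. the value at `d` of the continuous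
version of `s ↦ E[Y_t(D) - Y_t(0) | D = s]`, where `Y_t(D) = Y_t(s)` on `D = s`. -/
def ATT (P : Measure Ω) (M : Population Ω 𝒳) (d : ℝ) : ℝ :=
  limUnder (𝓝[>] (0 : ℝ)) (localEffect P M d)

/-! ### Identifying assumptions -/

/-- `f` is the density of the continuous part of the law of `D` (the law off the atom `0`). -/
structure IsTreatedDensity (P : Measure Ω) (M : Population Ω 𝒳) (f : ℝ → ℝ) : Prop where
  measurable : Measurable f
  nonneg : ∀ s, 0 ≤ f s
  law : (P.map M.D).restrict {0}ᶜ = volume.withDensity (fun s => ENNReal.ofReal (f s))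

/-- `f x` is the density of the continuous part of the conditional law of `D` given `X = x`. -/
structure IsTreatedCondDensity (P : Measure Ω) [IsFiniteMeasure P] (M : Population Ω 𝒳)
    (f : 𝒳 → ℝ → ℝ) : Prop where
  measurable : Measurable (Function.uncurry f)
  nonneg : ∀ x s, 0 ≤ f x s
  law : ∀ᵐ x ∂(P.map M.X), (condDistrib M.D M.X P x).restrict {0}ᶜ =
    volume.withDensity (fun s => ENNReal.ofReal (f x s))

/-- `f` is the joint density of `(ΔY, D)` on the treated individuals `D ≠ 0`. -/
structure IsTreatedJointDensity (P : Measure Ω) (M : Population Ω 𝒳) (f : ℝ → ℝ → ℝ) : Prop where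
  measurable : Measurable (Function.uncurry f)
  nonneg : ∀ t s, 0 ≤ f t s
  law : (P.map (fun ω => (M.dY ω, M.D ω))).restrict {p | p.2 ≠ 0} =
    (volume : Measure (ℝ × ℝ)).withDensity (fun p => ENNReal.ofReal (f p.1 p.2))

/-- `g₀(x) = P(D = 0 | X = x)`. -/
def propensity (P : Measure Ω) [IsFiniteMeasure P] (M : Population Ω 𝒳) (x : 𝒳) : ℝ :=
  (condDistrib M.D M.X P x).real {0}

/-- Support of the treatment and overlap. -/
structure SupportAssumption (P : Measure Ω) [IsFiniteMeasure P] (M : Population Ω 𝒳)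
    (fDX : 𝒳 → ℝ → ℝ) (dL dH κ : ℝ) : Prop where
  dL_pos : 0 < dL
  dL_lt_dH : dL < dH
  support_eq : (P.map M.D).support = {0} ∪ Icc dL dH
  κ_pos : 0 < κ
  κ_lt : κ < 1 / 2
  overlap : ∀ᵐ x ∂(P.map M.X), κ < propensity P M x ∧ propensity P M x < 1 - κ
  density_gt : ∀ᵐ x ∂(P.map M.X), ∀ s ∈ Icc dL dH, κ < fDX x s

/-- No anticipation: `Y_t = Y_t(D)` and `Y_{t-1} = Y_{t-1}(0)`. -/
structure NoAnticipation (P : Measure Ω) (M : Population Ω 𝒳) : Prop where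
  post : M.Ypost =ᵐ[P] fun ω => M.potPost (M.D ω) ω
  pre : M.Ypre =ᵐ[P] M.potPre

/-- Conditional parallel trends:
`E[Y_t(0) - Y_{t-1}(0) | X, D = s] = E[Y_t(0) - Y_{t-1}(0) | X, D = 0]` for `s ∈ [dL, dH]`. -/
structure ParallelTrends (P : Measure Ω) [IsFiniteMeasure P] (M : Population Ω 𝒳)
    (dL dH : ℝ) : Prop where
  integrable : Integrable (M.potPost 0) P
  trend : ∀ᵐ p ∂(P.map (fun ω => (M.X ω, M.D ω))), p.2 ∈ Icc dL dH →
    condMean P (fun ω => M.potPost 0 ω - M.potPre ω) (fun ω => (M.X ω, M.D ω)) p =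
      condMean P (fun ω => M.potPost 0 ω - M.potPre ω) (fun ω => (M.X ω, M.D ω)) (p.1, 0)

/-! ### Kernel, nuisance parameters, score -/

/-- `K_h(u) = h⁻¹ K(u / h)`. -/
def scaledKernel (Ker : ℝ → ℝ) (h u : ℝ) : ℝ := h⁻¹ * Ker (u / h)

/-- Conditions on the kernel. The tail condition makes the smoothed point mass of `D` at `0`,
`K_h(0 - d) P(D = 0)`, of the order `h²` of the smoothing bias. -/
structure KernelAssumption (Ker : ℝ → ℝ) : Prop where
  bounded : ∃ B, ∀ u, |Ker u| ≤ B
  differentiable : Differentiable ℝ Ker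
  integrable : Integrable Ker
  integral_eq_one : ∫ u, Ker u = 1
  integrable_first : Integrable (fun u => u * Ker u)
  integral_first : ∫ u, u * Ker u = 0
  integrable_second : Integrable (fun u => u ^ 2 * Ker u)
  integral_second_pos : 0 < ∫ u, u ^ 2 * Ker u
  tail : Ker =O[cocompact ℝ] (fun u => (|u| ^ 3)⁻¹)

/-- The infinite-dimensional nuisance parameters `(f_h(d | ·), g, ℰ_ΔY)`. -/
structure Nuisance (𝒳 : Type*) where
  /-- `f_h(d | x)` -/
  fh : 𝒳 → ℝ
  /-- `g(x)` -/
  g : 𝒳 → ℝ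
  /-- `ℰ_ΔY(x)` -/
  m : 𝒳 → ℝ

/-- `f_h⁰(d | x) = E[K_h(D - d) | X = x]`. -/
def smoothedCondDensity (P : Measure Ω) [IsFiniteMeasure P] (M : Population Ω 𝒳)
    (Ker : ℝ → ℝ) (h d : ℝ) (x : 𝒳) : ℝ :=
  ∫ s, scaledKernel Ker h (s - d) ∂(condDistrib M.D M.X P x)

/-- `ℰ⁰_ΔY(x) = E[ΔY | X = x, D = 0]`. -/
def controlTrend (P : Measure Ω) [IsFiniteMeasure P] (M : Population Ω 𝒳) (x : 𝒳) : ℝ :=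
  condMean P M.dY (fun ω => (M.X ω, M.D ω)) (x, 0)

/-- The true nuisance parameters `η₀(d)`. -/
def trueNuisance (P : Measure Ω) [IsFiniteMeasure P] (M : Population Ω 𝒳)
    (Ker : ℝ → ℝ) (h d : ℝ) : Nuisance 𝒳 where
  fh := smoothedCondDensity P M Ker h d
  g := propensity P M
  m := controlTrend P M

/-- The weight `(K_h(D - d) g(X) - 1{D = 0} f_h(d | X)) / (f g(X))`. -/
def weight (Ker : ℝ → ℝ) (h d f : ℝ) (η : Nuisance 𝒳) (z : Obs 𝒳) : ℝ :=
  (scaledKernel Ker h (z.trt - d) * η.g z.cov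
      - ({0} : Set ℝ).indicator (fun _ => (1 : ℝ)) z.trt * η.fh z.cov) / (f * η.g z.cov)

/-- The orthogonal score `ψ_h(Z, θ, f, η)`. -/
def score (Ker : ℝ → ℝ) (h d θ f : ℝ) (η : Nuisance 𝒳) (z : Obs 𝒳) : ℝ :=
  weight Ker h d f η z * (z.dY - η.m z.cov) - θ

/-- The smoothed parameter `ATT_h(d)`; `f` is the value `f_D(d)`. -/
def ATTh (P : Measure Ω) [IsFiniteMeasure P] (M : Population Ω 𝒳)
    (Ker : ℝ → ℝ) (h d f : ℝ) : ℝ :=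
  ∫ ω, M.dY ω * weight Ker h d f (trueNuisance P M Ker h d) (M.obs ω) ∂P

/-- The variance `σ_N²(d)` at bandwidth `h`; `f` is the value `f_D(d)`. -/
def asympVar (P : Measure Ω) [IsFiniteMeasure P] (M : Population Ω 𝒳)
    (Ker : ℝ → ℝ) (h d f : ℝ) : ℝ :=
  ∫ ω, (score Ker h d (ATTh P M Ker h d f) f (trueNuisance P M Ker h d) (M.obs ω)
      - ATTh P M Ker h d f / f *
        (scaledKernel Ker h (M.D ω - d) - ∫ ω', scaledKernel Ker h (M.D ω' - d) ∂P)) ^ 2 ∂P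

/-! ### Cross-fitting -/

/-- A partition of the `N = K n` sample indices into `K` folds of size `n`, for every `n`. -/
structure Folds (K : ℕ) where
  /-- the fold that contains an index -/
  fold : (n : ℕ) → Fin (K * n) → Fin K
  card_eq : ∀ n k, (Finset.univ.filter (fun i => fold n i = k)).card = n

/-- The indices outside fold `k`. -/
abbrev Folds.Aux {K : ℕ} (I : Folds K) (n : ℕ) (k : Fin K) : Type :=
  {i : Fin (K * n) // I.fold n i ≠ k}

/-- Learners of the nuisance parameters: for each fold a (jointly measurable) function of the data
outside that fold and of a random seed with values in `S`. -/
structure Learner {K : ℕ} (I : Folds K) (𝒳 S : Type*) [MeasurableSpace 𝒳] [MeasurableSpace S] where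
  /-- the estimated nuisance functions for fold `k` -/
  fit : (n : ℕ) → (k : Fin K) → (I.Aux n k → Obs 𝒳) → S → Nuisance 𝒳
  measurable_fh : ∀ n k, Measurable
    (fun p : ((I.Aux n k → Obs 𝒳) × S) × 𝒳 => (fit n k p.1.1 p.1.2).fh p.2)
  measurable_g : ∀ n k, Measurable
    (fun p : ((I.Aux n k → Obs 𝒳) × S) × 𝒳 => (fit n k p.1.1 p.1.2).g p.2)
  measurable_m : ∀ n k, Measurable
    (fun p : ((I.Aux n k → Obs 𝒳) × S) × 𝒳 => (fit n k p.1.1 p.1.2).m p.2)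

/-- The sample is i.i.d. with the law of the generic individual, and the seed of the learners is
independent of the sample. -/
structure PanelSample {Ω' S : Type*} [MeasurableSpace Ω'] [MeasurableSpace S]
    (P : Measure Ω) (M : Population Ω 𝒳) (Q : Measure Ω') (Z : ℕ → Ω' → Obs 𝒳)
    (ξ : Ω' → S) : Prop where
  indep : iIndepFun Z Q
  ident : ∀ i, IdentDistrib (Z i) M.obs Q P
  measurable_seed : Measurable ξ
  indep_seed : IndepFun ξ (fun ω i => Z i ω) Q

/-- The nuisance estimate `η̂_k` used on fold `k`. -/
def fittedNuisance {Ω' S : Type*} [MeasurableSpace S] {K : ℕ} {I : Folds K} (L : Learner I 𝒳 S)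
    (Z : ℕ → Ω' → Obs 𝒳) (ξ : Ω' → S) (n : ℕ) (k : Fin K) (ω : Ω') : Nuisance 𝒳 :=
  L.fit n k (fun i => Z i.1 ω) (ξ ω)

/-- The kernel density estimate `f̂_k(d)` from the data outside fold `k`. -/
def fittedDensity {Ω' : Type*} {K : ℕ} (I : Folds K) (Ker : ℝ → ℝ) (h d : ℝ)
    (Z : ℕ → Ω' → Obs 𝒳) (n : ℕ) (k : Fin K) (ω : Ω') : ℝ :=
  (∑ i : Fin (K * n) with I.fold n i ≠ k, scaledKernel Ker h ((Z i ω).trt - d))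
    / ((K : ℝ) * n - n)

/-- The estimate of `ATT(d)` on fold `k`. -/
def foldEstimator {Ω' S : Type*} [MeasurableSpace S] {K : ℕ} {I : Folds K} (L : Learner I 𝒳 S)
    (Ker : ℝ → ℝ) (h d : ℝ) (Z : ℕ → Ω' → Obs 𝒳) (ξ : Ω' → S) (n : ℕ) (k : Fin K) (ω : Ω') : ℝ :=
  (∑ i : Fin (K * n) with I.fold n i = k,
      weight Ker h d (fittedDensity I Ker h d Z n k ω) (fittedNuisance L Z ξ n k ω) (Z i ω) *
        ((Z i ω).dY - (fittedNuisance L Z ξ n k ω).m (Z i ω).cov)) / n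

/-- The cross-fitted estimator of `ATT(d)`. -/
def estimator {Ω' S : Type*} [MeasurableSpace S] {K : ℕ} {I : Folds K} (L : Learner I 𝒳 S)
    (Ker : ℝ → ℝ) (h d : ℝ) (Z : ℕ → Ω' → Obs 𝒳) (ξ : Ω' → S) (n : ℕ) (ω : Ω') : ℝ :=
  (∑ k : Fin K, foldEstimator L Ker h d Z ξ n k ω) / K

/-! ### Regularity and rates -/

/-- Bounds and smoothness; `h n` is the bandwidth at fold size `n`, and `𝒟 = (dL, dH)`. -/
structure BoundsSmoothness (P : Measure Ω) [IsFiniteMeasure P] (M : Population Ω 𝒳)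
    (Ker : ℝ → ℝ) (h : ℕ → ℝ) (fD : ℝ → ℝ) (fDX : 𝒳 → ℝ → ℝ) (fYD : ℝ → ℝ → ℝ)
    (dL dH c C : ℝ) : Prop where
  c_pos : 0 < c
  C_pos : 0 < C
  sup_density : ∃ s ∈ Ioo dL dH, c < fD s
  Ypre_lt : ∀ᵐ ω ∂P, |M.Ypre ω| < C
  Ypost_lt : ∀ᵐ ω ∂P, |M.Ypost ω| < C
  smoothed_bounds : ∀ᶠ n in atTop, ∀ᵐ x ∂(P.map M.X), ∀ s ∈ Ioo dL dH,
    c < smoothedCondDensity P M Ker (h n) s x ∧ smoothedCondDensity P M Ker (h n) s x < C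
  trend_lt : ∀ᵐ x ∂(P.map M.X), |controlTrend P M x| < C
  fD_smooth : ContDiffOn ℝ 2 fD (Ioo dL dH)
  fD_second : ∃ B, ∀ s ∈ Ioo dL dH, |iteratedDeriv 2 fD s| ≤ B
  fDX_smooth : ∀ᵐ x ∂(P.map M.X), ContDiffOn ℝ 2 (fDX x) (Ioo dL dH)
  fDX_second : ∃ B, ∀ᵐ x ∂(P.map M.X), ∀ s ∈ Ioo dL dH, |iteratedDeriv 2 (fDX x) s| ≤ B
  fYD_smooth : ∀ᵐ t ∂(P.map M.dY), ContDiffOn ℝ 2 (fYD t) (Ioo dL dH)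
  fYD_second : ∃ B, ∀ᵐ t ∂(P.map M.dY), ∀ s ∈ Ioo dL dH, |iteratedDeriv 2 (fYD t) s| ≤ B

/-- The rates and bounds required of a nuisance estimate `η`; norms are over `X ∼ P`. -/
structure GoodNuisance (P : Measure Ω) [IsFiniteMeasure P] (M : Population Ω 𝒳)
    (Ker : ℝ → ℝ) (h d ε κ c C : ℝ) (η : Nuisance 𝒳) : Prop where
  fh_rate : eLpNorm (fun x => η.fh x - smoothedCondDensity P M Ker h d x) 2 (P.map M.X)
    ≤ ENNReal.ofReal ((√h)⁻¹ * ε)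
  g_rate : eLpNorm (fun x => η.g x - propensity P M x) 2 (P.map M.X) ≤ ENNReal.ofReal ε
  m_rate : eLpNorm (fun x => η.m x - controlTrend P M x) 2 (P.map M.X) ≤ ENNReal.ofReal ε
  g_bounds : ∀ᵐ x ∂(P.map M.X), κ < η.g x ∧ η.g x < 1 - κ
  fh_bounds : ∀ᵐ x ∂(P.map M.X), c < η.fh x ∧ η.fh x < C
  m_bound : eLpNorm η.m ∞ (P.map M.X) < ENNReal.ofReal C

/-- Conditions on the bandwidth `h` and the nuisance rate `ε`; the sample size is `N = K n`. -/
structure BandwidthRates (K : ℕ) (h ε : ℕ → ℝ) : Prop where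
  h_pos : ∀ n, 0 < h n
  h_tendsto : Tendsto h atTop (𝓝 0)
  Nh_tendsto : Tendsto (fun n => ((K * n : ℕ) : ℝ) * h n) atTop atTop
  undersmooth : Tendsto (fun n => √(((K * n : ℕ) : ℝ) * h n ^ 5)) atTop (𝓝 0)
  ε_tendsto : Tendsto ε atTop (𝓝 0)
  ε_sq : Tendsto (fun n => (h n)⁻¹ * ε n ^ 2) atTop (𝓝 0)

end Population

end

end ContDID

open ContDID

namespace ContDID

/-! ### A central limit theorem for bounded triangular arrays -/

section CLT

/-! On each fold the estimator is a ratio $T_k/F_k$: $T_k$ is the fold mean of residual scores at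
the estimated nuisances, and $F_k$ is the kernel density estimate from the other folds. Let
$T_{0,k}$ be the same mean at the true nuisances, $f=f_D(d)$ and $\theta=ATT_h(d)$; then
$E[T_{0,k}]=\theta f$.

*Nuisance error.* The score is orthogonal. Given the data outside the fold, replacing the truth by
$\eta=(f_h,g,\mathcal E)$ changes its mean only by $E[(\mathcal E^0-\mathcal E)(f_h^0-f_hg_0/g)]$.
This is a sum of products of errors, of size $\varepsilon^2/\sqrt h$ (`RegularAt.abs_mean_sub`), and
the second moment of the change is $O(\varepsilon^2/h)$ (`RegularAt.second_moment_sub`). A Chebyshev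
bound conditional on the auxiliary data then makes $\sqrt{Nh}\,(T_k-T_{0,k})$ negligible, since
$\sqrt N\varepsilon^2\to0$ and $\varepsilon\to0$ (`PanelSample.nuisance_toZero`).

*Ratio.* Both $T_{0,k}-\theta f$ and $F_k-f$ are $o_P((Nh)^{-1/4})$, so the quadratic remainder of
the linearized quotient is $o_P((Nh)^{-1/2})$ (`abs_ratio_linearization_le`). Averaged over the
folds, the linear part is exactly the full-sample mean of the influence function
(`sum_influence_eq`), because every observation enters $K-1$ of the density estimates.

*Central limit theorem.* The influence function is $O(1/h)$ and its variance is at least $v/h$.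
Standardized, it is $O(h^{-1/2})=o(\sqrt N)$, which is all that a characteristic function argument
needs (`tendstoInDistribution_triangular`).

*Bias.* Integrated against the vanishing first moment of the kernel, the signed densities of $1$ and
$\Delta Y-\mathcal E^0(X)$ near $d$ have smoothing error $O(h^2)$ (`HasSmoothMoment.bias`), and
$\sqrt{Nh}\,h^2=\sqrt{Nh^5}\to0$. The atom $D=0$ adds $O(h^2)$ to $E[K_h(D-d)]$ by the kernel tail
and nothing to the mean score, because control residuals have conditional mean zero.

*Identification.* By parallel trends the local effect is the ratio of the averages of those two
signed densities over a shrinking ball. Overlap keeps the denominator positive, so the limit is the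
ratio of their values at $d$, which is also the limit of $ATT_h(d)$ (`tendsto_localEffect`). -/

open Complex in
-- Third-order Taylor expansion of the exponential. The almost sure bound turns the third absolute
-- moment into `b` times the second, so no separate Lyapunov condition is needed.
theorem norm_integral_cexp_sub_le {E : Type*} [MeasurableSpace E] {μ : Measure E}
    [IsProbabilityMeasure μ] {q : E → ℝ} (hq : Measurable q) {b : ℝ}
    (hb : ∀ᵐ z ∂μ, |q z| ≤ b) (h0 : ∫ z, q z ∂μ = 0) (h1 : ∫ z, q z ^ 2 ∂μ = 1) {s : ℝ}
    (hs : |s| * b ≤ 1) :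
    ‖∫ z, cexp ((s * q z : ℝ) * I) ∂μ - (1 - (s : ℂ) ^ 2 / 2)‖ ≤ |s| ^ 3 * b := by
  have hqi : Integrable q μ := Integrable.of_bound hq.aestronglyMeasurable b (by simpa using hb)
  have hq2 : Integrable (fun z => q z ^ 2) μ := by
    -- A non-integrable function has integral `0`, so the value `1` forces integrability.
    by_contra hc
    rw [integral_undef hc] at h1
    norm_num at h1
  have hei : Integrable (fun z => cexp ((s * q z : ℝ) * I)) μ := by
    refine Integrable.of_bound (by fun_prop) 1 (ae_of_all _ fun z => ?_)
    rw [norm_exp_ofReal_mul_I]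
  have e2 : Integrable (fun z => ((s * q z : ℝ) : ℂ) * I) μ :=
    ((hqi.const_mul s).ofReal (𝕜 := ℂ)).mul_const I
  have e3 : Integrable (fun z => ((s ^ 2 / 2 * q z ^ 2 : ℝ) : ℂ)) μ :=
    (hq2.const_mul _).ofReal
  have e12 : Integrable (fun z => (1 : ℂ) + ((s * q z : ℝ) : ℂ) * I) μ := (integrable_const _).add e2
  have e123 : Integrable (fun z => (1 : ℂ) + ((s * q z : ℝ) : ℂ) * I
      - ((s ^ 2 / 2 * q z ^ 2 : ℝ) : ℂ)) μ := e12.sub e3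
  have hpoly : ∫ z, (1 + ((s * q z : ℝ) : ℂ) * I - ((s ^ 2 / 2 * q z ^ 2 : ℝ) : ℂ)) ∂μ
      = 1 - (s : ℂ) ^ 2 / 2 := by
    rw [integral_sub e12 e3, integral_add (integrable_const _) e2,
      integral_mul_const, integral_complex_ofReal, integral_complex_ofReal, integral_const_mul,
      integral_const_mul, h0, h1]
    simp
  rw [← hpoly, ← integral_sub hei e123]
  have hpt : ∀ᵐ z ∂μ, ‖cexp ((s * q z : ℝ) * I) -
      (1 + ((s * q z : ℝ) : ℂ) * I - ((s ^ 2 / 2 * q z ^ 2 : ℝ) : ℂ))‖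
        ≤ |s| ^ 3 * b * q z ^ 2 := by
    filter_upwards [hb] with z hz
    have hn : ‖((s * q z : ℝ) : ℂ) * I‖ = |s| * |q z| := by
      rw [norm_mul, norm_I, mul_one, norm_real, Real.norm_eq_abs, abs_mul]
    have hle : |s| * |q z| ≤ 1 := (mul_le_mul_of_nonneg_left hz (abs_nonneg s)).trans hs
    -- At order three the constant of this bound is $4/18$, which is absorbed into `1` below.
    have := Complex.exp_bound (x := ((s * q z : ℝ) : ℂ) * I) (hn ▸ hle) (n := 3) (by norm_num)
    rw [hn] at this
    have e : ∑ m ∈ Finset.range 3, (((s * q z : ℝ) : ℂ) * I) ^ m / (m.factorial : ℂ)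
        = 1 + ((s * q z : ℝ) : ℂ) * I - ((s ^ 2 / 2 * q z ^ 2 : ℝ) : ℂ) := by
      simp only [Finset.sum_range_succ, Finset.sum_range_zero, mul_pow, I_sq]
      norm_num [Nat.factorial]
      ring
    rw [e] at this
    refine this.trans ?_
    have hq2 : |q z| ^ 2 = q z ^ 2 := sq_abs _
    have h3 : (|s| * |q z|) ^ 3 ≤ |s| ^ 3 * b * q z ^ 2 := by
      calc (|s| * |q z|) ^ 3 = |s| ^ 3 * |q z| * |q z| ^ 2 := by ring
        _ ≤ |s| ^ 3 * b * |q z| ^ 2 := by gcongr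
        _ = _ := by rw [hq2]
    have h4 : (0 : ℝ) ≤ (|s| * |q z|) ^ 3 := by positivity
    norm_num [Nat.factorial]
    nlinarith
  refine (norm_integral_le_of_norm_le (hq2.const_mul _) hpt).trans ?_
  rw [integral_const_mul, h1, mul_one]

/-- By independence the characteristic function is a power of a single one, equal to $1-t^2/(2Kn)$
up to $|t|^3b_n/(Kn)^{3/2}$. This error is $o(1/n)$ exactly when $b_n/\sqrt n\to0$, for $t\ne0$. -/
theorem tendstoInDistribution_triangular {Ω' E : Type*} [MeasurableSpace Ω'] [MeasurableSpace E]
    {Q : Measure Ω'} [IsProbabilityMeasure Q] {μ : Measure E} [IsProbabilityMeasure μ]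
    {Z : ℕ → Ω' → E} (hZ : ∀ i, AEMeasurable (Z i) Q) (hlaw : ∀ i, Q.map (Z i) = μ)
    (hind : iIndepFun Z Q) {K : ℕ} (hK : 0 < K) {q : ℕ → E → ℝ} (hq : ∀ n, Measurable (q n))
    {b : ℕ → ℝ} (hb : ∀ᶠ n in atTop, ∀ᵐ z ∂μ, |q n z| ≤ b n)
    (h0 : ∀ᶠ n in atTop, ∫ z, q n z ∂μ = 0) (h1 : ∀ᶠ n in atTop, ∫ z, q n z ^ 2 ∂μ = 1)
    (hbn : Tendsto (fun n => b n / √(n : ℝ)) atTop (𝓝 0)) :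
    TendstoInDistribution
      (fun (n : ℕ) ω => (√((K * n : ℕ) : ℝ))⁻¹ * ∑ i : Fin (K * n), q n (Z i ω))
      atTop (id : ℝ → ℝ) (fun _ => Q) (gaussianReal 0 1) where
  forall_aemeasurable n := by
    refine (Finset.aemeasurable_fun_sum _ fun i _ => ?_).const_mul _
    exact (hq n).comp_aemeasurable (hZ i)
  aemeasurable_limit := aemeasurable_id
  tendsto := by
    refine ProbabilityMeasure.tendsto_iff_tendsto_charFun.2 fun t => ?_
    have hcf : ∀ n : ℕ, charFun (Q.map fun ω => (√((K * n : ℕ) : ℝ))⁻¹ *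
        ∑ i : Fin (K * n), q n (Z i ω)) t
        = ((∫ z, Complex.exp (((√((K * n : ℕ) : ℝ))⁻¹ * t * q n z : ℝ) * Complex.I) ∂μ) ^ n) ^ K := by
      intro n
      have hm : ∀ i : Fin (K * n), AEMeasurable (fun ω => q n (Z i ω)) Q := fun i =>
        (hq n).comp_aemeasurable (hZ i)
      have hind' : iIndepFun (fun (i : Fin (K * n)) ω => q n (Z i ω)) Q :=
        (hind.precomp Fin.val_injective).comp (fun _ => q n) (fun _ => hq n)
      rw [charFun_map_mul_comp (Finset.aemeasurable_fun_sum _ fun i _ => hm i),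
        hind'.charFun_map_fun_sum_eq_prod hm]
      have : ∀ i : Fin (K * n), charFun (Q.map fun ω => q n (Z i ω)) ((√((K * n : ℕ) : ℝ))⁻¹ * t)
          = ∫ z, Complex.exp (((√((K * n : ℕ) : ℝ))⁻¹ * t * q n z : ℝ) * Complex.I) ∂μ := by
        intro i
        have e : Q.map (fun ω => q n (Z i ω)) = μ.map (q n) := by
          rw [← hlaw i, AEMeasurable.map_map_of_aemeasurable (hq n).aemeasurable (hZ i)]
          rfl
        rw [e, charFun_apply_real, integral_map (hq n).aemeasurable (by fun_prop)]
        refine integral_congr_ae (ae_of_all _ fun z => ?_)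
        push_cast
        rfl
      simp only [Finset.prod_apply, this, Finset.prod_const, Finset.card_univ, Fintype.card_fin]
      rw [pow_mul, pow_right_comm]
    have hKr : (0 : ℝ) < K := by exact_mod_cast hK
    -- The exponent $Kn$ is split as $n$ times the fixed $K$: the exponential limit is taken along
    -- $n$, with $t^2/(2K)$, and the $K$-th power restores $t^2/2$.
    have key : Tendsto (fun n : ℕ => (∫ z, Complex.exp (((√((K * n : ℕ) : ℝ))⁻¹ * t * q n z : ℝ)
        * Complex.I) ∂μ) ^ n) atTop (𝓝 (Complex.exp (-(t : ℂ) ^ 2 / (2 * K)))) := by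
      apply Complex.tendsto_pow_exp_of_isLittleO_sub_add_div
      have hsmall : Tendsto (fun n : ℕ => |t| ^ 3 / (√K) ^ 3 * (b n / √(n : ℝ))) atTop (𝓝 0) := by
        simpa using hbn.const_mul (|t| ^ 3 / (√K) ^ 3)
      have hsmall1 : Tendsto (fun n : ℕ => |t| / √K * (b n / √(n : ℝ))) atTop (𝓝 0) := by
        simpa using hbn.const_mul (|t| / √K)
      rw [Asymptotics.isLittleO_iff]
      intro e he
      filter_upwards [hb, h0, h1, hsmall.eventually_lt_const he,
        hsmall1.eventually_lt_const one_pos, eventually_gt_atTop 0] with n hbn h0n h1n hsn hs1 hn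
      have hnr : (0 : ℝ) < n := by exact_mod_cast hn
      have hsq : √((K * n : ℕ) : ℝ) = √K * √n := by
        push_cast; exact Real.sqrt_mul hKr.le _
      have hsK : 0 < √(K : ℝ) := Real.sqrt_pos.2 hKr
      have hsn0 : 0 < √(n : ℝ) := Real.sqrt_pos.2 hnr
      have habs : |(√((K * n : ℕ) : ℝ))⁻¹ * t| = |t| / (√K * √n) := by
        rw [hsq, abs_mul, abs_of_pos (by positivity : 0 < (√(K : ℝ) * √(n : ℝ))⁻¹)]; field_simp
      have := norm_integral_cexp_sub_le (hq n) hbn h0n h1n (s := (√((K * n : ℕ) : ℝ))⁻¹ * t) (by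
        rw [habs]; refine le_trans (le_of_eq ?_) hs1.le; field_simp)
      have e1 : (1 : ℂ) + -(t : ℂ) ^ 2 / (2 * K) / n
          = 1 - (((√((K * n : ℕ) : ℝ))⁻¹ * t : ℝ) : ℂ) ^ 2 / 2 := by
        have : ((√((K * n : ℕ) : ℝ))⁻¹ * t) ^ 2 = t ^ 2 / (K * n) := by
          rw [mul_pow, inv_pow, Real.sq_sqrt (by positivity)]; push_cast; field_simp
        rw [← Complex.ofReal_pow ((√((K * n : ℕ) : ℝ))⁻¹ * t), this]
        push_cast
        field_simp
        ring
      rw [e1]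
      refine this.trans ?_
      rw [habs]
      have e2 : ‖(1 : ℂ) / n‖ = 1 / n := by simp
      rw [e2]
      have e3 : (|t| / (√K * √n)) ^ 3 * b n = |t| ^ 3 / (√K) ^ 3 * (b n / √(n : ℝ)) * (1 / n) := by
        have : (n : ℝ) = √n ^ 2 := (Real.sq_sqrt hnr.le).symm
        conv_rhs => rw [this]
        rw [Real.sqrt_sq hsn0.le]
        field_simp
      rw [e3]
      gcongr
    have := key.pow K
    rw [← Complex.exp_nat_mul] at this
    have e : charFun ((gaussianReal 0 1).map (id : ℝ → ℝ)) t
        = Complex.exp (K * (-(t : ℂ) ^ 2 / (2 * K))) := by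
      rw [Measure.map_id, charFun_gaussianReal]
      congr 1
      have : (K : ℂ) ≠ 0 := by exact_mod_cast hK.ne'
      field_simp
      simp [sq]
    simp only [ProbabilityMeasure.coe_mk]
    rw [e]
    simpa only [hcf] using this

end CLT

/-! ### Second-order expansions and kernel smoothing -/

/-- `G` agrees near `d` with an affine function of value `a` at `d`, up to a quadratic error. -/
def QuadAt (G : ℝ → ℝ) (d a : ℝ) : Prop :=
  ∃ b C δ : ℝ, 0 < δ ∧ 0 ≤ C ∧ ∀ s, |s - d| < δ → |G s - a - b * (s - d)| ≤ C * (s - d) ^ 2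

theorem QuadAt.sub {G₁ G₂ : ℝ → ℝ} {d a₁ a₂ : ℝ} (h₁ : QuadAt G₁ d a₁) (h₂ : QuadAt G₂ d a₂) :
    QuadAt (fun s => G₁ s - G₂ s) d (a₁ - a₂) := by
  obtain ⟨b₁, C₁, δ₁, hδ₁, hC₁, H₁⟩ := h₁
  obtain ⟨b₂, C₂, δ₂, hδ₂, hC₂, H₂⟩ := h₂
  refine ⟨b₁ - b₂, C₁ + C₂, min δ₁ δ₂, lt_min hδ₁ hδ₂, add_nonneg hC₁ hC₂, fun s hs => ?_⟩
  have e1 := H₁ s (hs.trans_le (min_le_left _ _))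
  have e2 := H₂ s (hs.trans_le (min_le_right _ _))
  calc |G₁ s - G₂ s - (a₁ - a₂) - (b₁ - b₂) * (s - d)|
      = |(G₁ s - a₁ - b₁ * (s - d)) - (G₂ s - a₂ - b₂ * (s - d))| := by ring_nf
    _ ≤ _ := (abs_sub _ _).trans (by rw [add_mul]; gcongr)

/-- The mean value inequality is applied to `deriv f` and then to `f` minus its linear part; this
costs the factor $1/2$ of the sharp remainder, which plays no role later. -/
theorem taylor_two_bound {f : ℝ → ℝ} {l u B : ℝ} (hf : ContDiffOn ℝ 2 f (Ioo l u))
    (hB : ∀ s ∈ Ioo l u, |iteratedDeriv 2 f s| ≤ B) {x y : ℝ} (hx : x ∈ Ioo l u)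
    (hy : y ∈ Ioo l u) : |f y - f x - deriv f x * (y - x)| ≤ B * (y - x) ^ 2 := by
  have h2 : ContDiffOn ℝ (1 + 1) f (Ioo l u) := by norm_num; exact hf
  rw [contDiffOn_succ_iff_deriv_of_isOpen isOpen_Ioo] at h2
  obtain ⟨hd, -, hd'⟩ := h2
  have hd2 : ∀ s ∈ Ioo l u, DifferentiableAt ℝ (deriv f) s := fun s hs =>
    (hd'.differentiableOn (by norm_num)).differentiableAt (isOpen_Ioo.mem_nhds hs)
  have hd1 : ∀ s ∈ Ioo l u, DifferentiableAt ℝ f s := fun s hs =>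
    hd.differentiableAt (isOpen_Ioo.mem_nhds hs)
  have hB0 : 0 ≤ B := (abs_nonneg _).trans (hB x hx)
  have hlip : ∀ s ∈ Ioo l u, |deriv f s - deriv f x| ≤ B * |s - x| := fun s hs => by
    have := Convex.norm_image_sub_le_of_norm_deriv_le (f := deriv f) (C := B) hd2 (fun s hs => by
      have := hB s hs
      rwa [iteratedDeriv_succ, iteratedDeriv_one] at this) (convex_Ioo l u) hx hs
    simpa [Real.norm_eq_abs] using this
  have hsub : uIcc x y ⊆ Ioo l u := by
    intro s hs
    rw [mem_uIcc] at hs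
    rcases hs with h | h
    · exact ⟨hx.1.trans_le h.1, h.2.trans_lt hy.2⟩
    · exact ⟨hy.1.trans_le h.1, h.2.trans_lt hx.2⟩
  have := Convex.norm_image_sub_le_of_norm_hasDerivWithin_le
    (f := fun s => f s - deriv f x * s) (f' := fun s => deriv f s - deriv f x)
    (s := uIcc x y) (C := B * |y - x|) (fun s hs => by
      have h1 := (hd1 s (hsub hs)).hasDerivAt.sub ((hasDerivAt_id s).const_mul (deriv f x))
      rw [mul_one] at h1
      exact h1.hasDerivWithinAt) (fun s hs => by
      rw [Real.norm_eq_abs]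
      refine (hlip s (hsub hs)).trans ?_
      gcongr ?_ * ?_
      exact abs_sub_left_of_mem_uIcc hs) (convex_uIcc x y) left_mem_uIcc right_mem_uIcc
  rw [Real.norm_eq_abs, Real.norm_eq_abs, mul_assoc, ← sq, sq_abs] at this
  calc _ = |f y - deriv f x * y - (f x - deriv f x * x)| := by ring_nf
    _ ≤ _ := this

/-- Averaging the lower Taylor bound over a window symmetric about `x` cancels the linear term. A
bound on the second derivative alone thus controls a nonnegative function pointwise by its mass. -/
theorem le_integral_of_second_deriv {f : ℝ → ℝ} {l u B δ : ℝ} (hf : ContDiffOn ℝ 2 f (Ioo l u))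
    (hB : ∀ s ∈ Ioo l u, |iteratedDeriv 2 f s| ≤ B) (h0 : ∀ s, 0 ≤ f s) (hi : Integrable f)
    {x : ℝ} (hδ : 0 < δ) (hl : l < x - δ) (hu : x + δ < u) :
    f x ≤ (2 * δ)⁻¹ * (∫ s, f s) + B * δ ^ 2 := by
  have hx : x ∈ Ioo l u := ⟨by linarith, by linarith⟩
  have hB0 : 0 ≤ B := (abs_nonneg _).trans (hB x hx)
  have hpt : ∀ s ∈ Icc (x - δ) (x + δ), f x - B * δ ^ 2 + deriv f x * (s - x) ≤ f s := by
    intro s hs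
    have h1 := taylor_two_bound hf hB hx (y := s) ⟨by linarith [hs.1], by linarith [hs.2]⟩
    have h2 : (s - x) ^ 2 ≤ δ ^ 2 := by
      apply sq_le_sq'
      · linarith [hs.1]
      · linarith [hs.2]
    have h3 := mul_le_mul_of_nonneg_left h2 hB0
    linarith [(abs_le.1 h1).1]
  have h1 : ∫ s in (x - δ)..(x + δ), (f x - B * δ ^ 2 + deriv f x * (s - x)) ≤
      ∫ s in (x - δ)..(x + δ), f s := by
    apply intervalIntegral.integral_mono_on (by linarith) _ hi.intervalIntegrable hpt
    exact Continuous.intervalIntegrable (by fun_prop) _ _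
  have h2 : ∫ s in (x - δ)..(x + δ), (f x - B * δ ^ 2 + deriv f x * (s - x))
      = 2 * δ * (f x - B * δ ^ 2) := by
    rw [intervalIntegral.integral_add (by simp)
      (Continuous.intervalIntegrable (by fun_prop) _ _), intervalIntegral.integral_const_mul,
      intervalIntegral.integral_comp_sub_right (fun s => s)]
    simp
    ring
  have h3 : ∫ s in (x - δ)..(x + δ), f s ≤ ∫ s, f s := by
    rw [intervalIntegral.integral_of_le (by linarith)]
    exact setIntegral_le_integral hi (ae_of_all _ h0)
  rw [h2] at h1
  have h4 : f x - B * δ ^ 2 ≤ (2 * δ)⁻¹ * ∫ s, f s := by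
    rw [inv_mul_eq_div, le_div_iff₀ (by positivity)]
    linarith
  linarith

/-- A steep slope would force `f` below zero at `x + δ` or at `x - δ`. -/
theorem abs_deriv_le_of_second_deriv {f : ℝ → ℝ} {l u B δ : ℝ} (hf : ContDiffOn ℝ 2 f (Ioo l u))
    (hB : ∀ s ∈ Ioo l u, |iteratedDeriv 2 f s| ≤ B) (h0 : ∀ s, 0 ≤ f s)
    {x : ℝ} (hδ : 0 < δ) (hl : l < x - δ) (hu : x + δ < u) :
    |deriv f x| ≤ f x / δ + B * δ := by
  have hx : x ∈ Ioo l u := ⟨by linarith, by linarith⟩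
  have h1 := taylor_two_bound hf hB hx (y := x + δ) ⟨by linarith, by linarith⟩
  have h2 := taylor_two_bound hf hB hx (y := x - δ) ⟨by linarith, by linarith⟩
  have e1 := h0 (x + δ)
  have e2 := h0 (x - δ)
  have h1' := (abs_le.1 h1).2
  have h2' := (abs_le.1 h2).2
  have e : f x / δ + B * δ = (f x + B * δ ^ 2) / δ := by field_simp
  rw [e, abs_le, ← neg_div, div_le_iff₀ hδ, le_div_iff₀ hδ]
  constructor <;> nlinarith

theorem quadAt_of_contDiffOn {f : ℝ → ℝ} {l u B d : ℝ} (hf : ContDiffOn ℝ 2 f (Ioo l u))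
    (hB : ∀ s ∈ Ioo l u, |iteratedDeriv 2 f s| ≤ B) (hd : d ∈ Ioo l u) : QuadAt f d (f d) := by
  refine ⟨deriv f d, B, min (d - l) (u - d), lt_min (by linarith [hd.1]) (by linarith [hd.2]),
    (abs_nonneg _).trans (hB d hd), fun s hs => taylor_two_bound hf hB hd ?_⟩
  have h1 := (abs_lt.1 (hs.trans_le (min_le_left _ _))).1
  have h2 := (abs_lt.1 (hs.trans_le (min_le_right _ _))).2
  exact ⟨by linarith, by linarith⟩

/-- This yields the limit that defines `ATT`, applied through `HasSmoothMoment.tendsto_average`. -/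
theorem QuadAt.tendsto_average {G : ℝ → ℝ} {d a : ℝ} (hG : QuadAt G d a) (hi : Integrable G) :
    Tendsto (fun r => (2 * r)⁻¹ * ∫ s in Metric.closedBall d r, G s) (𝓝[>] 0) (𝓝 a) := by
  obtain ⟨b, C, δ, hδ, hC, H⟩ := hG
  have hlim : Tendsto (fun r : ℝ => (|b| + C * δ) * r) (𝓝[>] 0) (𝓝 0) := by
    have : Tendsto (fun r : ℝ => (|b| + C * δ) * r) (𝓝 0) (𝓝 ((|b| + C * δ) * 0)) :=
      tendsto_id.const_mul _
    rw [mul_zero] at this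
    exact this.mono_left nhdsWithin_le_nhds
  rw [tendsto_iff_norm_sub_tendsto_zero]
  refine squeeze_zero' (Eventually.of_forall fun r => norm_nonneg _) ?_ hlim
  have hlt : ∀ᶠ r : ℝ in 𝓝[>] 0, r < δ := nhdsWithin_le_nhds (eventually_lt_nhds hδ)
  filter_upwards [self_mem_nhdsWithin, hlt] with r hr hrδ
  have hr : 0 < r := hr
  have hvol : volume.real (Metric.closedBall d r) = 2 * r := by
    rw [Real.closedBall_eq_Icc, Real.volume_real_Icc_of_le (by linarith)]; ring
  have hfin : volume (Metric.closedBall d r) < ∞ := measure_closedBall_lt_top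
  have hbd : ‖∫ s in Metric.closedBall d r, (G s - a)‖ ≤ ((|b| + C * δ) * r) * (2 * r) := by
    rw [← hvol]
    refine norm_setIntegral_le_of_norm_le_const hfin fun s hs => ?_
    rw [Metric.mem_closedBall, Real.dist_eq] at hs
    have h1 := H s (hs.trans_lt hrδ)
    rw [Real.norm_eq_abs]
    have h2 : |G s - a| ≤ |G s - a - b * (s - d)| + |b * (s - d)| := by
      have := abs_add_le (G s - a - b * (s - d)) (b * (s - d))
      rwa [sub_add_cancel] at this
    have h3 : |b * (s - d)| ≤ |b| * r := by rw [abs_mul]; gcongr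
    have h4 : C * (s - d) ^ 2 ≤ C * δ * r := by
      rw [← sq_abs, sq, ← mul_assoc]
      have := hs.trans hrδ.le
      gcongr
    linarith
  have e : (2 * r)⁻¹ * ∫ s in Metric.closedBall d r, G s
      = a + (2 * r)⁻¹ * ∫ s in Metric.closedBall d r, (G s - a) := by
    rw [integral_sub hi.integrableOn (by
      rw [integrable_const_iff]; right
      exact ⟨by rwa [Measure.restrict_apply_univ]⟩)]
    rw [setIntegral_const, hvol, smul_eq_mul]
    field_simp
    ring
  rw [e, add_sub_cancel_left, norm_mul, Real.norm_eq_abs, abs_of_pos (by positivity),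
    inv_mul_le_iff₀ (by positivity)]
  linarith

/-! ### Moments, tails and smoothing bias of the scaled kernel. -/

section Kernel

variable {Ker : ℝ → ℝ}

theorem KernelAssumption.continuous (hK : KernelAssumption Ker) : Continuous Ker :=
  hK.differentiable.continuous

theorem KernelAssumption.measurable_scaled (hK : KernelAssumption Ker) (h : ℝ) :
    Measurable (scaledKernel Ker h) := by
  have := hK.continuous.measurable
  unfold scaledKernel
  fun_prop

theorem KernelAssumption.exists_bound (hK : KernelAssumption Ker) :
    ∃ B, 0 < B ∧ ∀ h, 0 < h → ∀ u, |scaledKernel Ker h u| ≤ B / h := by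
  obtain ⟨B, hB⟩ := hK.bounded
  refine ⟨|B| + 1, by positivity, fun h hh u => ?_⟩
  rw [scaledKernel, abs_mul, abs_of_pos (inv_pos.2 hh), inv_mul_eq_div]
  gcongr
  exact (hB _).trans ((le_abs_self B).trans (by linarith))

/-- Cubic decay after rescaling: $h^{-1}(h/|u|)^3=h^2/|u|^3$. Everything at a fixed distance from
`d`, the atom at `0` included, is therefore of the order of the bias. -/
theorem KernelAssumption.exists_tail (hK : KernelAssumption Ker) {δ : ℝ} (hδ : 0 < δ) :
    ∃ c h₀, 0 < h₀ ∧ 0 ≤ c ∧ ∀ h, 0 < h → h < h₀ → ∀ u, δ ≤ |u| →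
      |scaledKernel Ker h u| ≤ c * h ^ 2 := by
  obtain ⟨c, hc, hO⟩ := hK.tail.exists_pos
  rw [Asymptotics.IsBigOWith, ← Metric.cobounded_eq_cocompact] at hO
  obtain ⟨R, -, hR⟩ := (hasBasis_cobounded_norm.eventually_iff).1 hO
  refine ⟨c / δ ^ 3, δ / (|R| + 1), by positivity, by positivity, fun h hh hlt u hu => ?_⟩
  have hu0 : 0 < |u| := hδ.trans_le hu
  have habs : |u / h| = |u| / h := by rw [abs_div, abs_of_pos hh]
  have hR' : R ≤ ‖u / h‖ := by
    rw [Real.norm_eq_abs, habs, le_div_iff₀ hh]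
    rw [lt_div_iff₀ (by positivity)] at hlt
    nlinarith [le_abs_self R, abs_nonneg R]
  have h1 := hR hR'
  rw [Real.norm_eq_abs, Real.norm_eq_abs, habs,
    abs_of_nonneg (by positivity : 0 ≤ ((|u| / h) ^ 3)⁻¹)] at h1
  rw [scaledKernel, abs_mul, abs_of_pos (inv_pos.2 hh)]
  calc h⁻¹ * |Ker (u / h)| ≤ h⁻¹ * (c * ((|u| / h) ^ 3)⁻¹) := by gcongr
    _ = c / |u| ^ 3 * h ^ 2 := by field_simp
    _ ≤ c / δ ^ 3 * h ^ 2 := by gcongr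

theorem KernelAssumption.integrable_scaled (hK : KernelAssumption Ker) {h : ℝ} (hh : 0 < h)
    (d : ℝ) : Integrable (fun s => scaledKernel Ker h (s - d)) :=
  ((hK.integrable.comp_div hh.ne').const_mul h⁻¹).comp_sub_right d

theorem KernelAssumption.integral_scaled (hK : KernelAssumption Ker) {h : ℝ} (hh : 0 < h)
    (d : ℝ) : ∫ s, scaledKernel Ker h (s - d) = 1 := by
  rw [integral_sub_right_eq_self (fun s => scaledKernel Ker h s) d]
  simp only [scaledKernel]
  rw [integral_const_mul, Measure.integral_comp_div (fun s => Ker s), hK.integral_eq_one,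
    abs_of_pos hh]
  simp [hh.ne']

theorem KernelAssumption.integrable_scaled_first (hK : KernelAssumption Ker) {h : ℝ} (hh : 0 < h)
    (d : ℝ) : Integrable (fun s => scaledKernel Ker h (s - d) * (s - d)) := by
  have := (hK.integrable_first.comp_div hh.ne').comp_sub_right d
  refine this.congr (ae_of_all _ fun s => ?_)
  simp only [scaledKernel]
  field_simp

theorem KernelAssumption.integral_scaled_first (hK : KernelAssumption Ker) {h : ℝ} (hh : 0 < h)
    (d : ℝ) : ∫ s, scaledKernel Ker h (s - d) * (s - d) = 0 := by
  rw [integral_sub_right_eq_self (fun s => scaledKernel Ker h s * s) d]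
  have : ∀ s, scaledKernel Ker h s * s = (fun u => u * Ker u) (s / h) := fun s => by
    simp only [scaledKernel]; field_simp
  simp only [this]
  rw [Measure.integral_comp_div (fun u => u * Ker u), hK.integral_first, smul_zero]

theorem KernelAssumption.integrable_scaled_second (hK : KernelAssumption Ker) {h : ℝ} (hh : 0 < h)
    (d : ℝ) : Integrable (fun s => |scaledKernel Ker h (s - d)| * (s - d) ^ 2) := by
  have := (((hK.integrable_second.norm.comp_div hh.ne').const_mul h).comp_sub_right d)
  refine this.congr (ae_of_all _ fun s => ?_)
  simp only [scaledKernel, Real.norm_eq_abs, abs_mul, abs_of_pos (inv_pos.2 hh), abs_pow, abs_div,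
    abs_of_pos hh]
  rw [div_pow, sq_abs]
  field_simp

theorem integral_scaledKernel_second {h : ℝ} (hh : 0 < h)
    (d : ℝ) : ∫ s, |scaledKernel Ker h (s - d)| * (s - d) ^ 2
      = h ^ 2 * ∫ u, |u ^ 2 * Ker u| := by
  rw [integral_sub_right_eq_self (fun s => |scaledKernel Ker h s| * s ^ 2) d]
  have : ∀ s, |scaledKernel Ker h s| * s ^ 2 = h * (fun u => |u ^ 2 * Ker u|) (s / h) := fun s => by
    simp only [scaledKernel, abs_mul, abs_of_pos (inv_pos.2 hh), abs_pow, abs_div, abs_of_pos hh]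
    rw [div_pow, sq_abs]; field_simp
  simp only [this]
  rw [integral_const_mul, Measure.integral_comp_div (fun u => |u ^ 2 * Ker u|), abs_of_pos hh,
    smul_eq_mul]
  ring

/-- One factor of the square is bounded by `B / h`; the integral of the other does not depend on
`h`. -/
theorem KernelAssumption.exists_integral_sq_le (hK : KernelAssumption Ker) :
    ∃ A, 0 < A ∧ ∀ h, 0 < h → ∀ d, Integrable (fun s => scaledKernel Ker h (s - d) ^ 2) ∧
      ∫ s, scaledKernel Ker h (s - d) ^ 2 ≤ A / h := by
  obtain ⟨B, hB0, hB⟩ := hK.exists_bound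
  refine ⟨B * ((∫ u, |Ker u|) + 1), ?_, fun h hh d => ?_⟩
  · have : 0 ≤ ∫ u, |Ker u| := integral_nonneg fun _ => abs_nonneg _
    positivity
  have hpt : ∀ s, ‖scaledKernel Ker h (s - d) ^ 2‖ ≤ B / h * |scaledKernel Ker h (s - d)| := by
    intro s
    rw [norm_pow, Real.norm_eq_abs, sq]
    exact mul_le_mul_of_nonneg_right (hB h hh _) (abs_nonneg _)
  have hi := (hK.integrable_scaled hh d).abs.const_mul (B / h)
  have hm : Measurable fun s => scaledKernel Ker h (s - d) :=
    (hK.measurable_scaled h).comp (by fun_prop)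
  refine ⟨hi.mono' (hm.pow_const 2).aestronglyMeasurable (ae_of_all _ hpt), ?_⟩
  refine (le_abs_self _).trans ((norm_integral_le_of_norm_le hi (ae_of_all _ hpt)).trans ?_)
  rw [integral_const_mul, integral_sub_right_eq_self (fun s => |scaledKernel Ker h s|) d]
  have e : ∫ s, |scaledKernel Ker h s| = ∫ u, |Ker u| := by
    simp only [scaledKernel, abs_mul, abs_of_pos (inv_pos.2 hh)]
    rw [integral_const_mul, Measure.integral_comp_div (fun u => |Ker u|), abs_of_pos hh]
    simp [hh.ne']
  rw [e, div_mul_eq_mul_div]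
  gcongr
  linarith

/-- The zeroth and first kernel moments remove the affine part of `G`, leaving a quadratic error
near `d`. Away from `d` no expansion of `G` is available, and the kernel tail is used instead. -/
theorem KernelAssumption.bias (hK : KernelAssumption Ker) {G : ℝ → ℝ} {d a : ℝ}
    (hG : QuadAt G d a) (hi : Integrable G) :
    ∃ A h₀, 0 < h₀ ∧ 0 ≤ A ∧ ∀ h, 0 < h → h < h₀ →
      |(∫ s, scaledKernel Ker h (s - d) * G s) - a| ≤ A * h ^ 2 := by
  obtain ⟨b, C, δ, hδ, hC, H⟩ := hG
  obtain ⟨c, h₀, hh₀, hc, hT⟩ := hK.exists_tail hδ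
  -- Where $|s-d|\ge\delta$, the affine part is dominated by this multiple of $(s-d)^2$, so a single
  -- second-moment integral serves both regions.
  set C' := C + (|a| / δ ^ 2 + |b| / δ) with hC'
  have hC0 : 0 ≤ C' := by positivity
  refine ⟨C' * (∫ u, |u ^ 2 * Ker u|) + c * ∫ s, |G s|, h₀, hh₀, ?_, fun h hh hlt => ?_⟩
  · have h1 : 0 ≤ ∫ u, |u ^ 2 * Ker u| := integral_nonneg fun _ => abs_nonneg _
    have h2 : 0 ≤ ∫ s, |G s| := integral_nonneg fun _ => abs_nonneg _
    positivity
  obtain ⟨B, hB0, hB⟩ := hK.exists_bound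
  have hm : Measurable fun s => scaledKernel Ker h (s - d) :=
    (hK.measurable_scaled h).comp (by fun_prop)
  have hKG : Integrable (fun s => scaledKernel Ker h (s - d) * G s) :=
    hi.bdd_mul hm.aestronglyMeasurable (c := B / h) (ae_of_all _ fun s => hB h hh _)
  have e : (∫ s, scaledKernel Ker h (s - d) * G s) - a
      = ∫ s, scaledKernel Ker h (s - d) * (G s - a - b * (s - d)) := by
    have : ∀ s, scaledKernel Ker h (s - d) * (G s - a - b * (s - d))
        = scaledKernel Ker h (s - d) * G s - a * scaledKernel Ker h (s - d)
          - b * (scaledKernel Ker h (s - d) * (s - d)) := fun s => by ring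
    simp only [this]
    have i1 := (hK.integrable_scaled hh d).const_mul a
    have i2 := (hK.integrable_scaled_first hh d).const_mul b
    have i3 : Integrable (fun s => scaledKernel Ker h (s - d) * G s
      - a * scaledKernel Ker h (s - d)) := hKG.sub i1
    rw [integral_sub i3 i2, integral_sub hKG i1, integral_const_mul, integral_const_mul,
      hK.integral_scaled hh, hK.integral_scaled_first hh]
    ring
  rw [e, ← Real.norm_eq_abs]
  have hpt : ∀ s, ‖scaledKernel Ker h (s - d) * (G s - a - b * (s - d))‖ ≤
      C' * (|scaledKernel Ker h (s - d)| * (s - d) ^ 2) + c * h ^ 2 * |G s| := by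
    intro s
    rw [Real.norm_eq_abs, abs_mul]
    set k := |scaledKernel Ker h (s - d)| with hk
    have hk0 : 0 ≤ k := abs_nonneg _
    rcases lt_or_ge |s - d| δ with hs | hs
    · have h1 : |G s - a - b * (s - d)| ≤ C' * (s - d) ^ 2 := (H s hs).trans (by
        rw [hC']; gcongr; linarith [show 0 ≤ |a| / δ ^ 2 + |b| / δ by positivity])
      have h2 := mul_le_mul_of_nonneg_left h1 hk0
      have h3 : 0 ≤ c * h ^ 2 * |G s| := by positivity
      linarith
    · have hsq : |s - d| ^ 2 = (s - d) ^ 2 := sq_abs _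
      have h1 : |G s - a - b * (s - d)| ≤ |G s| + C' * (s - d) ^ 2 := by
        have e1 : |G s - a - b * (s - d)| ≤ |G s| + |a| + |b| * |s - d| := by
          rw [← abs_mul]
          exact (abs_sub _ _).trans (by gcongr; exact abs_sub _ _)
        have e2 : |a| ≤ |a| / δ ^ 2 * (s - d) ^ 2 := by
          rw [← hsq, div_mul_eq_mul_div, le_div_iff₀ (by positivity)]
          gcongr
        have e3 : |b| * |s - d| ≤ |b| / δ * (s - d) ^ 2 := by
          rw [← hsq, div_mul_eq_mul_div, le_div_iff₀ (by positivity), sq, mul_assoc]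
          gcongr
        have e4 : 0 ≤ C * (s - d) ^ 2 := by positivity
        rw [hC']
        nlinarith
      have h2 := mul_le_mul_of_nonneg_left h1 hk0
      have h3 : k * |G s| ≤ c * h ^ 2 * |G s| := by gcongr; exact hT h hh hlt _ hs
      nlinarith
  have j1 := (hK.integrable_scaled_second hh d).const_mul C'
  have j2 := hi.abs.const_mul (c * h ^ 2)
  refine (norm_integral_le_of_norm_le (j1.add j2) (ae_of_all _ hpt)).trans (le_of_eq ?_)
  simp only [Pi.add_apply]
  rw [integral_add j1 j2, integral_const_mul, integral_const_mul, integral_scaledKernel_second hh]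
  ring

/-- Second moment of the smoothed point mass under a law with a locally bounded density. -/
theorem KernelAssumption.exists_second_moment (hK : KernelAssumption Ker) {d δ B : ℝ} (hδ : 0 < δ)
    (hδd : δ < d) (hB : 0 ≤ B) :
    ∃ A h₀, 0 < h₀ ∧ 0 < A ∧ ∀ h, 0 < h → h < h₀ → ∀ (ρ : Measure ℝ) [IsProbabilityMeasure ρ]
      (f : ℝ → ℝ), Measurable f → (∀ s, 0 ≤ f s) →
      ρ.restrict {0}ᶜ = volume.withDensity (fun s => ENNReal.ofReal (f s)) →
      (∀ s, |s - d| < δ → f s ≤ B) → ∫ s, scaledKernel Ker h (s - d) ^ 2 ∂ρ ≤ A / h := by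
  obtain ⟨c, h₀, hh₀, hc, hT⟩ := hK.exists_tail hδ
  obtain ⟨A, hA, hA'⟩ := hK.exists_integral_sq_le
  obtain ⟨B', hB'0, hB'⟩ := hK.exists_bound
  -- Inside the ball the density bound gives `B * A / h`. Outside it the tail gives $c^2h^4$, at
  -- most $c^2/h$ because $h<1$. The extra `1` makes the constant positive.
  refine ⟨B * A + c ^ 2 + 1, min h₀ 1, by positivity, by positivity,
    fun h hh hlt ρ _ f hfm hf0 hf hfB => ?_⟩
  have hh0 := hlt.trans_le (min_le_left _ _)
  have hh1 := hlt.trans_le (min_le_right _ _)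
  have hm : Measurable fun s => scaledKernel Ker h (s - d) :=
    (hK.measurable_scaled h).comp (by fun_prop)
  have hint : Integrable (fun s => scaledKernel Ker h (s - d) ^ 2) ρ := by
    refine Integrable.of_bound (hm.pow_const 2).aestronglyMeasurable ((B' / h) ^ 2)
      (ae_of_all _ fun s => ?_)
    rw [norm_pow]
    gcongr
    exact hB' h hh _
  have hU : MeasurableSet (Metric.ball d δ) := measurableSet_ball
  rw [← integral_add_compl hU hint]
  have h1 : ∫ s in Metric.ball d δ, scaledKernel Ker h (s - d) ^ 2 ∂ρ ≤ B * (A / h) := by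
    have hsub : Metric.ball d δ ⊆ {0}ᶜ := by
      intro s hs h0
      rw [Metric.mem_ball, Real.dist_eq, h0, zero_sub, abs_neg, abs_of_pos (hδ.trans hδd)] at hs
      linarith
    have hr : ρ.restrict (Metric.ball d δ) = (volume.restrict (Metric.ball d δ)).withDensity
        (fun s => ENNReal.ofReal (f s)) := by
      rw [← restrict_withDensity hU, ← hf, Measure.restrict_restrict_of_subset hsub]
    rw [hr, integral_withDensity_eq_integral_toReal_smul (by fun_prop) (by simp)]
    calc ∫ s in Metric.ball d δ, (ENNReal.ofReal (f s)).toReal • scaledKernel Ker h (s - d) ^ 2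
        ≤ ∫ s in Metric.ball d δ, B * scaledKernel Ker h (s - d) ^ 2 := by
          refine integral_mono_of_nonneg (ae_of_all _ fun s => ?_)
            (((hA' h hh d).1.const_mul B).integrableOn) ?_
          · exact smul_nonneg ENNReal.toReal_nonneg (sq_nonneg _)
          · filter_upwards [self_mem_ae_restrict hU] with s hs
            rw [smul_eq_mul, ENNReal.toReal_ofReal (hf0 s)]
            gcongr
            exact hfB s hs
      _ ≤ ∫ s, B * scaledKernel Ker h (s - d) ^ 2 :=
          setIntegral_le_integral ((hA' h hh d).1.const_mul B) (ae_of_all _ fun s => by positivity)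
      _ ≤ B * (A / h) := by
          rw [integral_const_mul]; gcongr; exact (hA' h hh d).2
  have h2 : ∫ s in (Metric.ball d δ)ᶜ, scaledKernel Ker h (s - d) ^ 2 ∂ρ ≤ c ^ 2 / h := by
    have : ‖∫ s in (Metric.ball d δ)ᶜ, scaledKernel Ker h (s - d) ^ 2 ∂ρ‖
        ≤ (c * h ^ 2) ^ 2 * ρ.real (Metric.ball d δ)ᶜ := by
      refine norm_setIntegral_le_of_norm_le_const (measure_lt_top _ _) fun s hs => ?_
      rw [norm_pow]
      gcongr
      refine hT h hh hh0 _ ?_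
      simpa [Real.dist_eq] using hs
    refine (le_abs_self _).trans (this.trans ?_)
    calc (c * h ^ 2) ^ 2 * ρ.real (Metric.ball d δ)ᶜ ≤ (c * h ^ 2) ^ 2 * 1 := by
          gcongr; exact measureReal_le_one
      _ = c ^ 2 * h ^ 4 := by ring
      _ ≤ c ^ 2 / h := by
          rw [le_div_iff₀ hh, mul_assoc, ← pow_succ]
          exact mul_le_of_le_one_right (sq_nonneg c) (pow_le_one₀ hh.le hh1.le)
  have h3 : (B * A + c ^ 2 + 1) / h = B * (A / h) + c ^ 2 / h + 1 / h := by ring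
  rw [h3]
  have : 0 ≤ 1 / h := by positivity
  linarith

end Kernel

/-! ### Signed densities of moments near the evaluation point. -/

section SmoothMoment

variable {Ω : Type*} [MeasurableSpace Ω] {P : Measure Ω} {D : Ω → ℝ}

/-- The signed measure `E[U; D ∈ ds]` on `D ≠ 0` has an integrable density with a second-order
expansion at `d`, of value `a` there. -/
def HasSmoothMoment (P : Measure Ω) (D U : Ω → ℝ) (d a : ℝ) : Prop :=
  ∃ G : ℝ → ℝ, Integrable G ∧ QuadAt G d a ∧ ∀ k : ℝ → ℝ, Measurable k → (∃ B, ∀ s, |k s| ≤ B) →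
    k 0 = 0 → ∫ ω, U ω * k (D ω) ∂P = ∫ s, k s * G s

theorem HasSmoothMoment.congr {U U' : Ω → ℝ} {d a : ℝ} (h : HasSmoothMoment P D U d a)
    (e : U =ᵐ[P] U') : HasSmoothMoment P D U' d a := by
  obtain ⟨G, hG, hq, hk⟩ := h
  refine ⟨G, hG, hq, fun k hkm hkb hk0 => ?_⟩
  rw [← hk k hkm hkb hk0]
  refine integral_congr_ae ?_
  filter_upwards [e] with ω hω
  rw [hω]

theorem HasSmoothMoment.sub {U U' : Ω → ℝ} {d a a' : ℝ} (hD : Measurable D)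
    (h : HasSmoothMoment P D U d a) (h' : HasSmoothMoment P D U' d a') (hU : Integrable U P)
    (hU' : Integrable U' P) : HasSmoothMoment P D (fun ω => U ω - U' ω) d (a - a') := by
  obtain ⟨G, hG, hq, hk⟩ := h
  obtain ⟨G', hG', hq', hk'⟩ := h'
  refine ⟨fun s => G s - G' s, hG.sub hG', hq.sub hq', fun k hkm ⟨B, hB⟩ hk0 => ?_⟩
  simp only [sub_mul, mul_sub]
  have hkD : AEStronglyMeasurable (fun ω => k (D ω)) P := (hkm.comp hD).aestronglyMeasurable
  rw [integral_sub (hU.mul_bdd hkD (c := B) (ae_of_all _ fun ω => hB _))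
      (hU'.mul_bdd hkD (c := B) (ae_of_all _ fun ω => hB _)),
    integral_sub (hG.bdd_mul hkm.aestronglyMeasurable (c := B) (ae_of_all _ fun ω => hB _))
      (hG'.bdd_mul hkm.aestronglyMeasurable (c := B) (ae_of_all _ fun ω => hB _)),
    hk k hkm ⟨B, hB⟩ hk0, hk' k hkm ⟨B, hB⟩ hk0]

/-- For $r<d$ the ball misses the atom, so its indicator is an admissible test function. -/
theorem HasSmoothMoment.tendsto_average {U : Ω → ℝ} {d a : ℝ} (h : HasSmoothMoment P D U d a)
    (hd : 0 < d) :
    Tendsto (fun r => (2 * r)⁻¹ * ∫ ω, U ω * (Metric.closedBall d r).indicator 1 (D ω) ∂P)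
      (𝓝[>] 0) (𝓝 a) := by
  obtain ⟨G, hG, hq, hk⟩ := h
  refine (hq.tendsto_average hG).congr' ?_
  have hlt : ∀ᶠ r : ℝ in 𝓝[>] 0, r < d := nhdsWithin_le_nhds (eventually_lt_nhds hd)
  filter_upwards [hlt] with r hr
  rw [hk ((Metric.closedBall d r).indicator 1) (measurable_one.indicator measurableSet_closedBall)]
  · rw [← integral_indicator measurableSet_closedBall]
    congr 2
    ext s
    by_cases hs : s ∈ Metric.closedBall d r <;> simp [hs]
  · refine ⟨1, fun s => ?_⟩
    by_cases hs : s ∈ Metric.closedBall d r <;> simp [hs]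
  · rw [indicator_of_notMem]
    rw [Metric.mem_closedBall, Real.dist_eq, zero_sub, abs_neg, abs_of_pos hd]
    linarith

/-- Cutting the kernel off at the atom makes it admissible and changes the Lebesgue integral only on
a null set. -/
theorem HasSmoothMoment.bias {U : Ω → ℝ} {d a : ℝ} (h : HasSmoothMoment P D U d a)
    {Ker : ℝ → ℝ} (hK : KernelAssumption Ker) :
    ∃ A h₀, 0 < h₀ ∧ 0 ≤ A ∧ ∀ h, 0 < h → h < h₀ →
      |(∫ ω, U ω * ({0}ᶜ : Set ℝ).indicator (fun s => scaledKernel Ker h (s - d)) (D ω) ∂P) - a|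
        ≤ A * h ^ 2 := by
  obtain ⟨G, hG, hq, hk⟩ := h
  obtain ⟨A, h₀, hh₀, hA, H⟩ := hK.bias hq hG
  obtain ⟨B, hB0, hB⟩ := hK.exists_bound
  refine ⟨A, h₀, hh₀, hA, fun h hh hlt => ?_⟩
  rw [hk]
  · refine le_of_eq_of_le ?_ (H h hh hlt)
    congr 2
    refine integral_congr_ae ?_
    have : ∀ᵐ s : ℝ, s ≠ 0 := by
      rw [ae_iff]; simp
    filter_upwards [this] with s hs
    rw [indicator_of_mem (by simpa using hs)]
  · exact ((hK.measurable_scaled h).comp (measurable_id.sub_const d)).indicator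
      (measurableSet_singleton 0).compl
  · refine ⟨B / h, fun s => ?_⟩
    by_cases hs : s ∈ ({0}ᶜ : Set ℝ)
    · rw [indicator_of_mem hs]; exact hB h hh _
    · rw [indicator_of_notMem hs, abs_zero]; positivity
  · simp

variable {T : Type*} [MeasurableSpace T] {ν : Measure T} [IsFiniteMeasure ν] {F : T → ℝ → ℝ}

/-- Taylor's formula is integrated over `t`. Only second derivatives are bounded uniformly; an
integrable envelope for the values and slopes near `d` comes from the total mass of each section `F
t`. -/
theorem quadAt_mixture (hFm : Measurable (Function.uncurry F)) (h0 : ∀ t s, 0 ≤ F t s)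
    (hFi : Integrable (Function.uncurry F) (ν.prod volume)) {l u B d : ℝ} (hB0 : 0 ≤ B)
    (hs : ∀ᵐ t ∂ν, ContDiffOn ℝ 2 (F t) (Ioo l u))
    (hB : ∀ᵐ t ∂ν, ∀ s ∈ Ioo l u, |iteratedDeriv 2 (F t) s| ≤ B) (hd : d ∈ Ioo l u)
    {w : T → ℝ} (hw : Measurable w) {W : ℝ} (hW : ∀ t, |w t| ≤ W) :
    ∃ a, QuadAt (fun s => ∫ t, w t * F t s ∂ν) d a := by
  obtain ⟨δ, hδ, hδl, hδu⟩ : ∃ δ : ℝ, 0 < δ ∧ l < d - 2 * δ ∧ d + 2 * δ < u := by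
    -- Room for a window of radius `δ` around every point within `δ` of `d`.
    refine ⟨min (d - l) (u - d) / 3, ?_, ?_, ?_⟩
    · have : 0 < min (d - l) (u - d) := lt_min (by linarith [hd.1]) (by linarith [hd.2])
      positivity
    · have := min_le_left (d - l) (u - d); linarith [hd.1]
    · have := min_le_right (d - l) (u - d); linarith [hd.2]
  set e : T → ℝ := fun t => (2 * δ)⁻¹ * (∫ s, F t s) + B * δ ^ 2 with he
  have hei : Integrable e ν := (hFi.integral_prod_left.const_mul _).add (integrable_const _)
  have hsec : ∀ᵐ t ∂ν, Integrable (F t) := hFi.prod_right_ae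
  have hbd : ∀ s, |s - d| < δ → ∀ᵐ t ∂ν, ‖F t s‖ ≤ e t := by
    intro s hsd
    filter_upwards [hs, hB, hsec] with t h1 h2 h3
    rw [Real.norm_eq_abs, abs_of_nonneg (h0 t s)]
    have := abs_lt.1 hsd
    exact le_integral_of_second_deriv h1 h2 (h0 t) h3 hδ (by linarith) (by linarith)
  have hFs : ∀ s, Measurable fun t => F t s := fun s =>
    hFm.comp (measurable_id.prodMk measurable_const)
  have hint : ∀ s, |s - d| < δ → Integrable (fun t => w t * F t s) ν := fun s hsd =>
    (hei.mono' (hFs s).aestronglyMeasurable (hbd s hsd)).bdd_mul hw.aestronglyMeasurable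
      (c := W) (ae_of_all _ hW)
  have hdd : |d - d| < δ := by simpa using hδ
  -- The derivative in `s` is measurable in `t` as an almost everywhere limit of difference
  -- quotients.
  have hderm : AEStronglyMeasurable (fun t => deriv (F t) d) ν := by
    refine aestronglyMeasurable_of_tendsto_ae atTop
      (f := fun (n : ℕ) t => (1 / ((n : ℝ) + 1))⁻¹ • (F t (d + 1 / ((n : ℝ) + 1)) - F t d))
      (fun n => by
        have h1 := hFs (d + 1 / ((n : ℝ) + 1))
        have h2 := hFs d
        exact Measurable.aestronglyMeasurable (by fun_prop)) ?_
    filter_upwards [hs] with t ht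
    have hda : DifferentiableAt ℝ (F t) d :=
      (ht.differentiableOn (by norm_num)).differentiableAt (isOpen_Ioo.mem_nhds hd)
    refine (hasDerivAt_iff_tendsto_slope_zero.1 hda.hasDerivAt).comp ?_
    refine tendsto_nhdsWithin_iff.2 ⟨tendsto_one_div_add_atTop_nhds_zero_nat, ?_⟩
    exact Eventually.of_forall fun n => by
      have : (0 : ℝ) < 1 / ((n : ℝ) + 1) := by positivity
      exact this.ne'
  have hderi : Integrable (fun t => deriv (F t) d) ν := by
    refine ((hei.div_const δ).add (integrable_const (B * δ))).mono' hderm ?_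
    filter_upwards [hs, hB, hbd d hdd] with t h1 h2 h3
    rw [Real.norm_eq_abs, abs_of_nonneg (h0 t d)] at h3
    refine (abs_deriv_le_of_second_deriv h1 h2 (h0 t) hδ (by linarith) (by linarith)).trans ?_
    simp only [Pi.add_apply]
    gcongr
  have hwder : Integrable (fun t => w t * deriv (F t) d) ν :=
    hderi.bdd_mul hw.aestronglyMeasurable (c := W) (ae_of_all _ hW)
  refine ⟨∫ t, w t * F t d ∂ν, ∫ t, w t * deriv (F t) d ∂ν, |W| * B * ν.real univ, δ, hδ,
    by positivity, fun s hsd => ?_⟩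
  have i1 : Integrable (fun t => w t * F t s - w t * F t d) ν := (hint s hsd).sub (hint d hdd)
  have i2 : Integrable (fun t => w t * deriv (F t) d * (s - d)) ν := hwder.mul_const _
  rw [← integral_sub (hint s hsd) (hint d hdd), ← integral_mul_const, ← integral_sub i1 i2,
    ← Real.norm_eq_abs]
  have := norm_integral_le_of_norm_le (μ := ν)
    (f := fun t => w t * F t s - w t * F t d - w t * deriv (F t) d * (s - d))
    (integrable_const (|W| * (B * (s - d) ^ 2))) (by
      filter_upwards [hs, hB] with t h1 h2
      have hsm : s ∈ Ioo l u := by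
        have := abs_lt.1 hsd
        exact ⟨by linarith, by linarith⟩
      have h3 := taylor_two_bound h1 h2 hd hsm
      have h4 : w t * F t s - w t * F t d - w t * deriv (F t) d * (s - d)
          = w t * (F t s - F t d - deriv (F t) d * (s - d)) := by ring
      rw [h4, Real.norm_eq_abs, abs_mul]
      exact mul_le_mul ((hW t).trans (le_abs_self W)) h3 (abs_nonneg _) (abs_nonneg _))
  refine this.trans (le_of_eq ?_)
  rw [integral_const, smul_eq_mul]
  ring

/-- Test functions vanish at `0`, so only the law off the atom matters. Fubini then exhibits the
signed density as the mixture $\int w(t)F(t,\cdot)\,d\nu(t)$. The base measure `ν` is free, so that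
it can be the law of `X` or restricted Lebesgue measure. -/
theorem hasSmoothMoment_of_density [IsFiniteMeasure P] {V : Ω → T} (hV : Measurable V)
    (hD : Measurable D) (hFm : Measurable (Function.uncurry F)) (h0 : ∀ t s, 0 ≤ F t s)
    (hlaw : (P.map (fun ω => (V ω, D ω))).restrict {p | p.2 ≠ 0}
      = (ν.prod volume).withDensity (fun p => ENNReal.ofReal (F p.1 p.2))) {l u B d : ℝ}
    (hs : ∀ᵐ t ∂ν, ContDiffOn ℝ 2 (F t) (Ioo l u))
    (hB : ∀ᵐ t ∂ν, ∀ s ∈ Ioo l u, |iteratedDeriv 2 (F t) s| ≤ B) (hd : d ∈ Ioo l u)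
    {w : T → ℝ} (hw : Measurable w) {W : ℝ} (hW : ∀ t, |w t| ≤ W) :
    ∃ a, HasSmoothMoment P D (fun ω => w (V ω)) d a := by
  have hFm' : Measurable fun p : T × ℝ => F p.1 p.2 := hFm
  have hFi : Integrable (Function.uncurry F) (ν.prod volume) := by
    refine ⟨hFm.aestronglyMeasurable, ?_⟩
    have h1 : (ν.prod volume).withDensity (fun p => ENNReal.ofReal (F p.1 p.2)) univ < ∞ := by
      rw [← hlaw]; exact measure_lt_top _ _
    rw [withDensity_apply _ MeasurableSet.univ, Measure.restrict_univ] at h1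
    exact (hasFiniteIntegral_iff_ofReal (f := Function.uncurry F)
      (ae_of_all _ fun p => h0 p.1 p.2)).2 h1
  obtain ⟨a, ha⟩ := quadAt_mixture hFm h0 hFi (abs_nonneg B) hs
    (by filter_upwards [hB] with t ht s hs using (ht s hs).trans (le_abs_self B)) hd hw hW
  have hwF : Integrable (fun p : T × ℝ => w p.1 * F p.1 p.2) (ν.prod volume) :=
    hFi.bdd_mul (hw.comp measurable_fst).aestronglyMeasurable (c := W)
      (ae_of_all _ fun p => hW _)
  refine ⟨a, _, hwF.integral_prod_right, ha, fun k hkm ⟨Bk, hBk⟩ hk0 => ?_⟩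
  have hset : MeasurableSet {p : T × ℝ | p.2 ≠ 0} :=
    (measurable_snd (measurableSet_singleton (0 : ℝ))).compl
  have hf : Measurable fun p : T × ℝ => w p.1 * k p.2 := by fun_prop
  have e1 : ∫ ω, w (V ω) * k (D ω) ∂P
      = ∫ p, w p.1 * k p.2 ∂((P.map (fun ω => (V ω, D ω))).restrict {p | p.2 ≠ 0}) := by
    rw [setIntegral_eq_integral_of_forall_compl_eq_zero,
      integral_map (hV.prodMk hD).aemeasurable hf.aestronglyMeasurable]
    intro p hp
    have : p.2 = 0 := by simpa using hp
    rw [this, hk0, mul_zero]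
  rw [e1, hlaw, integral_withDensity_eq_integral_toReal_smul (by fun_prop) (by simp)]
  have e2 : ∀ p : T × ℝ, (ENNReal.ofReal (F p.1 p.2)).toReal • (w p.1 * k p.2)
      = k p.2 * (w p.1 * F p.1 p.2) := fun p => by
    rw [ENNReal.toReal_ofReal (h0 _ _), smul_eq_mul]; ring
  simp only [e2]
  have i1 : Integrable (fun p : T × ℝ => k p.2 * (w p.1 * F p.1 p.2)) (ν.prod volume) :=
    hwF.bdd_mul (hkm.comp measurable_snd).aestronglyMeasurable (c := Bk)
      (ae_of_all _ fun p => hBk _)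
  rw [integral_prod_symm _ i1]
  simp only [integral_const_mul]

end SmoothMoment

/-! ### Conditional means, the law of the treated, and identification of $ATT(d)$. -/

section PopulationFacts

variable {Ω 𝒳 : Type*} [MeasurableSpace Ω] [MeasurableSpace 𝒳] {P : Measure Ω}
  [IsProbabilityMeasure P] {M : Population Ω 𝒳}

theorem integral_mul_condDistrib {β : Type*} [MeasurableSpace β] {V : Ω → β} (hV : Measurable V)
    {Y : Ω → ℝ} (hY : AEMeasurable Y P) {ρ : β → ℝ} (hρ : Measurable ρ) {φ : ℝ → ℝ}
    (hφ : Measurable φ) (hi : Integrable (fun ω => ρ (V ω) * φ (Y ω)) P) :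
    ∫ ω, ρ (V ω) * φ (Y ω) ∂P = ∫ ω, ρ (V ω) * ∫ y, φ y ∂(condDistrib Y V P (V ω)) ∂P := by
  have hf : Measurable fun p : β × ℝ => ρ p.1 * φ p.2 := by fun_prop
  have hVY : AEMeasurable (fun ω => (V ω, Y ω)) P := hV.aemeasurable.prodMk hY
  have h1 : Integrable (fun p : β × ℝ => ρ p.1 * φ p.2) (P.map fun ω => (V ω, Y ω)) := by
    rw [integrable_map_measure hf.aestronglyMeasurable hVY]
    exact hi
  have h2 : ∫ ω, ρ (V ω) * φ (Y ω) ∂P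
      = ∫ p, ρ p.1 * φ p.2 ∂(P.map fun ω => (V ω, Y ω)) :=
    (integral_map hVY hf.aestronglyMeasurable).symm
  rw [h2]
  rw [← compProd_map_condDistrib hY] at h1 ⊢
  have hsm : StronglyMeasurable fun v => ρ v * ∫ y, φ y ∂(condDistrib Y V P v) :=
    hρ.stronglyMeasurable.mul
      ((hφ.comp measurable_snd).stronglyMeasurable.integral_condDistrib (f := fun p => φ p.2))
  rw [Measure.integral_compProd h1, ← integral_map hV.aemeasurable hsm.aestronglyMeasurable]
  simp only [integral_const_mul]

theorem measurable_condMean {β : Type*} [MeasurableSpace β] (W : Ω → ℝ) (V : Ω → β) :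
    Measurable (condMean P W V) :=
  (StronglyMeasurable.integral_condDistrib (f := fun p : β × ℝ => p.2)
    measurable_snd.stronglyMeasurable).measurable

theorem measurable_controlTrend : Measurable (controlTrend P M) :=
  (measurable_condMean _ _).comp (measurable_id.prodMk measurable_const)

theorem measurable_propensity : Measurable (propensity P M) :=
  ((Kernel.measurable_coe _ (measurableSet_singleton 0))).ennreal_toReal

theorem measurable_smoothedCondDensity {Ker : ℝ → ℝ} (hK : KernelAssumption Ker) (h d : ℝ) :
    Measurable (smoothedCondDensity P M Ker h d) := by
  have hm : Measurable fun p : 𝒳 × ℝ => scaledKernel Ker h (p.2 - d) :=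
    (hK.measurable_scaled h).comp (measurable_snd.sub_const d)
  exact (StronglyMeasurable.integral_condDistrib hm.stronglyMeasurable).measurable

theorem Population.measurable_dY (M : Population Ω 𝒳) : Measurable M.dY :=
  M.measurable_Ypost.sub M.measurable_Ypre

theorem Population.measurable_obs (M : Population Ω 𝒳) : Measurable M.obs :=
  M.measurable_Ypre.prodMk (M.measurable_Ypost.prodMk (M.measurable_D.prodMk M.measurable_X))

theorem Population.measurable_XD (M : Population Ω 𝒳) : Measurable fun ω => (M.X ω, M.D ω) :=
  M.measurable_X.prodMk M.measurable_D

omit [IsProbabilityMeasure P] in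
theorem ae_map_X {p : 𝒳 → Prop} (h : ∀ᵐ x ∂(P.map M.X), p x) : ∀ᵐ ω ∂P, p (M.X ω) :=
  ae_of_ae_map M.measurable_X.aemeasurable h

/-- Orthogonality of the control residual: `E[1{D = 0} ρ(X) (ΔY - ℰ⁰(X))] = 0`. -/
theorem integral_control_residual (hdY : Integrable M.dY P)
    (hm : Integrable (fun ω => controlTrend P M (M.X ω)) P) {ρ : 𝒳 → ℝ} (hρ : Measurable ρ)
    {B : ℝ} (hB : ∀ᵐ x ∂(P.map M.X), |ρ x| ≤ B) :
    ∫ ω, ({0} : Set ℝ).indicator (fun _ => (1 : ℝ)) (M.D ω) * ρ (M.X ω) *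
      (M.dY ω - controlTrend P M (M.X ω)) ∂P = 0 := by
  set φ : 𝒳 × ℝ → ℝ := fun p => ({0} : Set ℝ).indicator (fun _ => (1 : ℝ)) p.2 * ρ p.1 with hφd
  have hφ : Measurable φ :=
    ((measurable_const.indicator (measurableSet_singleton 0)).comp measurable_snd).mul
      (hρ.comp measurable_fst)
  have hφb : ∀ᵐ ω ∂P, ‖φ (M.X ω, M.D ω)‖ ≤ |B| := by
    filter_upwards [ae_map_X hB] with ω hω
    simp only [hφd, norm_mul, Real.norm_eq_abs]
    by_cases h0 : M.D ω ∈ ({0} : Set ℝ)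
    · rw [indicator_of_mem h0, abs_one, one_mul]; exact hω.trans (le_abs_self B)
    · rw [indicator_of_notMem h0]; simp
  have hφm : AEStronglyMeasurable (fun ω => φ (M.X ω, M.D ω)) P :=
    (hφ.comp M.measurable_XD).aestronglyMeasurable
  have i1 : Integrable (fun ω => φ (M.X ω, M.D ω) * M.dY ω) P := hdY.bdd_mul hφm hφb
  have i2 : Integrable (fun ω => φ (M.X ω, M.D ω) * controlTrend P M (M.X ω)) P :=
    hm.bdd_mul hφm hφb
  have e1 := integral_mul_condDistrib M.measurable_XD M.measurable_dY.aemeasurable hφ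
    measurable_id i1
  have e2 : ∀ ω, φ (M.X ω, M.D ω) * ∫ y, id y
      ∂(condDistrib M.dY (fun ω => (M.X ω, M.D ω)) P (M.X ω, M.D ω))
      = φ (M.X ω, M.D ω) * controlTrend P M (M.X ω) := by
    intro ω
    by_cases h0 : M.D ω = 0
    · simp only [h0]; rfl
    · simp [hφd, h0]
  simp only [e2] at e1
  have e3 : ∀ ω, ({0} : Set ℝ).indicator (fun _ => (1 : ℝ)) (M.D ω) * ρ (M.X ω) *
      (M.dY ω - controlTrend P M (M.X ω)) = φ (M.X ω, M.D ω) * M.dY ω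
        - φ (M.X ω, M.D ω) * controlTrend P M (M.X ω) := fun ω => by
    simp only [hφd]; ring
  simp only [e3]
  rw [integral_sub i1 i2, ← e1]
  simp

/-- The exceptional covariates have $E[g_0(X);X\text{ exceptional}]=0$, and $g_0>\kappa$. Overlap
thus carries identities of conditional means at `(x, 0)`, known only on the controls, over to almost
every `x`. -/
theorem ae_X_of_ae_control {dL dH κ : ℝ} {fDX : 𝒳 → ℝ → ℝ}
    (hsupp : SupportAssumption P M fDX dL dH κ) {p : 𝒳 → Prop} (hp : MeasurableSet {x | p x})
    (h : ∀ᵐ ω ∂P, M.D ω = 0 → p (M.X ω)) : ∀ᵐ x ∂(P.map M.X), p x := by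
  have h1 := setLIntegral_preimage_condDistrib (μ := P) M.measurable_X M.measurable_D.aemeasurable
    (measurableSet_singleton (0 : ℝ)) hp.compl
  have h2 : P (M.X ⁻¹' {x | p x}ᶜ ∩ M.D ⁻¹' {0}) = 0 := by
    rw [← nonpos_iff_eq_zero, ← (ae_iff.1 h)]
    refine measure_mono fun ω hω => ?_
    simp only [mem_ofPred_eq, Classical.not_imp]
    exact ⟨hω.2, hω.1⟩
  rw [h2, lintegral_eq_zero_iff (by
    exact (Kernel.measurable_coe _ (measurableSet_singleton 0)).comp M.measurable_X)] at h1
  rw [ae_map_iff M.measurable_X.aemeasurable hp]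
  have h3 := (ae_restrict_iff' (M.measurable_X hp.compl)).1 h1
  filter_upwards [h3, ae_map_X hsupp.overlap] with ω h3 h4
  by_contra hc
  have h5 := h3 hc
  have h6 : propensity P M (M.X ω) = 0 := by
    simp only [propensity, Measure.real]
    rw [show (condDistrib M.D M.X P (M.X ω)) {0} = 0 from h5]; rfl
  linarith [h4.1, hsupp.κ_pos]

/-- On the treated, the conditional mean of the untreated trend is the control trend. -/
theorem integral_untreated_trend {dL dH κ : ℝ} {fDX : 𝒳 → ℝ → ℝ}
    (hsupp : SupportAssumption P M fDX dL dH κ) (hanticip : NoAnticipation P M)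
    (htrend : ParallelTrends P M dL dH) (hdY : Integrable M.dY P) (hpre : Integrable M.Ypre P)
    {A : Set ℝ} (hA : MeasurableSet A) (hAs : A ⊆ Icc dL dH) :
    ∫ ω in M.D ⁻¹' A, (M.potPost 0 ω - M.potPre ω) ∂P
      = ∫ ω in M.D ⁻¹' A, controlTrend P M (M.X ω) ∂P := by
  set W : Ω → ℝ := fun ω => M.potPost 0 ω - M.potPre ω with hW
  have hWi : Integrable W P := htrend.integrable.sub (hpre.congr hanticip.pre)
  set V : Ω → 𝒳 × ℝ := fun ω => (M.X ω, M.D ω) with hV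
  have hVm : Measurable V := M.measurable_XD
  have hce := condExp_ae_eq_integral_condDistrib' hVm hWi
  have hce' := condExp_ae_eq_integral_condDistrib' hVm hdY
  -- On the controls `W = ΔY`.
  have hS : MeasurableSet[MeasurableSpace.comap V inferInstance] (M.D ⁻¹' {0}) :=
    ⟨Prod.snd ⁻¹' {0}, measurable_snd (measurableSet_singleton 0), rfl⟩
  have hind : (M.D ⁻¹' {0}).indicator W =ᵐ[P] (M.D ⁻¹' {0}).indicator M.dY := by
    filter_upwards [hanticip.post, hanticip.pre] with ω h1 h2
    by_cases h0 : M.D ω = 0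
    · have : ω ∈ M.D ⁻¹' {0} := h0
      rw [indicator_of_mem this, indicator_of_mem this]
      simp only [hW, Population.dY, h1, h2, h0]
    · have : ω ∉ M.D ⁻¹' {0} := h0
      rw [indicator_of_notMem this, indicator_of_notMem this]
  -- The event $D=0$ is determined by $(X,D)$, so conditional expectations of variables that agree
  -- on it agree on it too.
  have hc1 := (condExp_indicator (m := MeasurableSpace.comap V inferInstance) hWi hS).symm.trans
    ((condExp_congr_ae (m := MeasurableSpace.comap V inferInstance) hind).trans
      (condExp_indicator hdY hS))
  have hctrl : ∀ᵐ ω ∂P, M.D ω = 0 →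
      condMean P W V (M.X ω, 0) = controlTrend P M (M.X ω) := by
    filter_upwards [hc1, hce, hce'] with ω h1 h2 h3 h0
    have hmem : ω ∈ M.D ⁻¹' {0} := h0
    rw [indicator_of_mem hmem, indicator_of_mem hmem, h2, h3] at h1
    simp only [hV, h0] at h1
    exact h1
  have hX : ∀ᵐ x ∂(P.map M.X), condMean P W V (x, 0) = controlTrend P M x := by
    refine ae_X_of_ae_control hsupp ?_ hctrl
    exact measurableSet_eq_fun
      ((measurable_condMean W V).comp (measurable_id.prodMk measurable_const))
      measurable_controlTrend
  have htr := ae_of_ae_map hVm.aemeasurable htrend.trend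
  have hSA : MeasurableSet[MeasurableSpace.comap V inferInstance] (M.D ⁻¹' A) :=
    ⟨Prod.snd ⁻¹' A, measurable_snd hA, rfl⟩
  rw [← setIntegral_condExp hVm.comap_le hWi hSA]
  refine setIntegral_congr_ae (M.measurable_D hA) ?_
  filter_upwards [hce, htr, ae_map_X hX] with ω h1 h2 h3 hωA
  rw [h1, ← h3]
  exact h2 (hAs hωA)

/-- Disintegration along `X`: the joint law off the atom integrates the conditional laws off the
atom. -/
theorem treated_law_XD {fDX : 𝒳 → ℝ → ℝ} (hfDX : IsTreatedCondDensity P M fDX) :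
    (P.map (fun ω => (M.X ω, M.D ω))).restrict {p | p.2 ≠ 0}
      = ((P.map M.X).prod volume).withDensity (fun p => ENNReal.ofReal (fDX p.1 p.2)) := by
  have := Measure.isProbabilityMeasure_map (μ := P) M.measurable_X.aemeasurable
  have hf : Measurable fun p : 𝒳 × ℝ => ENNReal.ofReal (fDX p.1 p.2) :=
    hfDX.measurable.ennreal_ofReal
  have hset : MeasurableSet {p : 𝒳 × ℝ | p.2 ≠ 0} :=
    (measurable_snd (measurableSet_singleton (0 : ℝ))).compl
  ext s hs
  rw [Measure.restrict_apply hs, ← compProd_map_condDistrib M.measurable_D.aemeasurable,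
    Measure.compProd_apply (hs.inter hset), withDensity_apply _ hs, ← lintegral_indicator hs,
    lintegral_prod _ (hf.indicator hs).aemeasurable]
  refine lintegral_congr_ae ?_
  filter_upwards [hfDX.law] with x hx
  have hsx : MeasurableSet (Prod.mk x ⁻¹' s) := measurable_prodMk_left hs
  have e : Prod.mk x ⁻¹' (s ∩ {p | p.2 ≠ 0}) = Prod.mk x ⁻¹' s ∩ {0}ᶜ := by
    ext y; simp
  rw [e, ← Measure.restrict_apply hsx, hx, withDensity_apply _ hsx, ← lintegral_indicator hsx]
  rfl

omit [IsProbabilityMeasure P] in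
-- Confines the base measure to a set that carries `ΔY`. Smoothness of `fYD t` holds for almost
-- every `t` under the law of `ΔY`, which says nothing Lebesgue-almost everywhere.
theorem treated_law_dY {fYD : ℝ → ℝ → ℝ} (hfYD : IsTreatedJointDensity P M fYD) {A : Set ℝ}
    (hA : MeasurableSet A) (hdA : ∀ᵐ ω ∂P, M.dY ω ∈ A) :
    (P.map (fun ω => (M.dY ω, M.D ω))).restrict {p | p.2 ≠ 0}
      = ((volume.restrict A).prod volume).withDensity (fun p => ENNReal.ofReal (fYD p.1 p.2)) := by
  have hm : Measurable fun ω => (M.dY ω, M.D ω) := M.measurable_dY.prodMk M.measurable_D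
  have hS : MeasurableSet (A ×ˢ (univ : Set ℝ)) := hA.prod MeasurableSet.univ
  have h1 : ∀ᵐ p ∂(P.map (fun ω => (M.dY ω, M.D ω))).restrict {p | p.2 ≠ 0},
      p ∈ A ×ˢ (univ : Set ℝ) := by
    refine ae_restrict_of_ae ?_
    refine (ae_map_iff hm.aemeasurable hS).2 ?_
    filter_upwards [hdA] with ω hω
    exact ⟨hω, mem_univ _⟩
  rw [← Measure.restrict_eq_self_of_ae_mem h1, hfYD.law, restrict_withDensity hS]
  congr 1
  rw [Measure.volume_eq_prod, ← Measure.prod_restrict, Measure.restrict_univ]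

theorem BoundsSmoothness.dY_lt {Ker : ℝ → ℝ} {h : ℕ → ℝ} {fD : ℝ → ℝ} {fDX : 𝒳 → ℝ → ℝ}
    {fYD : ℝ → ℝ → ℝ} {dL dH c C : ℝ}
    (hb : BoundsSmoothness P M Ker h fD fDX fYD dL dH c C) : ∀ᵐ ω ∂P, |M.dY ω| < 2 * C := by
  filter_upwards [hb.Ypre_lt, hb.Ypost_lt] with ω h1 h2
  have := abs_sub (M.Ypost ω) (M.Ypre ω)
  unfold Population.dY
  linarith

theorem exists_smoothMoment_dY {Ker : ℝ → ℝ} {h : ℕ → ℝ} {fD : ℝ → ℝ} {fDX : 𝒳 → ℝ → ℝ}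
    {fYD : ℝ → ℝ → ℝ} {dL dH c C d : ℝ} (hfYD : IsTreatedJointDensity P M fYD)
    (hb : BoundsSmoothness P M Ker h fD fDX fYD dL dH c C) (hd : d ∈ Ioo dL dH) :
    ∃ a, HasSmoothMoment P M.D M.dY d a := by
  obtain ⟨B, hB⟩ := hb.fYD_second
  have hlt : ∀ᵐ t ∂(P.map M.dY), |t| < 2 * C := by
    rw [ae_map_iff M.measurable_dY.aemeasurable (measurableSet_lt (by fun_prop) (by fun_prop))]
    exact hb.dY_lt
  have hgood := (hb.fYD_smooth.and hB).and hlt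
  -- A measurable set, null for the law of `ΔY`, containing every bad `t`. Its complement lies in
  -- $(-2C,2C)$, so Lebesgue measure there is finite.
  set N := toMeasurable (P.map M.dY) {t | ¬((ContDiffOn ℝ 2 (fYD t) (Ioo dL dH) ∧
    ∀ s ∈ Ioo dL dH, |iteratedDeriv 2 (fYD t) s| ≤ B) ∧ |t| < 2 * C)} with hN
  have hN0 : P.map M.dY N = 0 := by rw [hN, measure_toMeasurable]; exact ae_iff.1 hgood
  have hNm : MeasurableSet N := measurableSet_toMeasurable _ _
  have hsub : ∀ t ∈ Nᶜ, (ContDiffOn ℝ 2 (fYD t) (Ioo dL dH) ∧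
    ∀ s ∈ Ioo dL dH, |iteratedDeriv 2 (fYD t) s| ≤ B) ∧ |t| < 2 * C := by
    intro t ht
    by_contra hc
    exact ht (subset_toMeasurable _ _ hc)
  have hmem : ∀ᵐ ω ∂P, M.dY ω ∈ Nᶜ :=
    ae_of_ae_map M.measurable_dY.aemeasurable (by rw [ae_iff]; simpa using hN0)
  have hfin : IsFiniteMeasure (volume.restrict Nᶜ) := by
    refine ⟨?_⟩
    rw [Measure.restrict_apply_univ]
    refine lt_of_le_of_lt (measure_mono (t := Ioo (-(2 * C)) (2 * C)) fun t ht => ?_) (by simp)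
    exact abs_lt.1 (hsub t ht).2
  -- Truncation makes the weight bounded everywhere without changing `ΔY` almost surely.
  set w : ℝ → ℝ := fun t => max (-(2 * C)) (min t (2 * C)) with hw
  have hC := hb.C_pos
  obtain ⟨a, ha⟩ := hasSmoothMoment_of_density (P := P) (D := M.D) (ν := volume.restrict Nᶜ)
    M.measurable_dY M.measurable_D hfYD.measurable hfYD.nonneg
    (treated_law_dY hfYD hNm.compl hmem) (l := dL) (u := dH) (B := B)
    (by filter_upwards [self_mem_ae_restrict hNm.compl] with t ht using (hsub t ht).1.1)
    (by filter_upwards [self_mem_ae_restrict hNm.compl] with t ht using (hsub t ht).1.2)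
    hd (w := w) (by fun_prop) (W := 2 * C) (fun t => by
      rw [hw, abs_le]
      exact ⟨le_max_left _ _, max_le (by linarith) (min_le_right _ _)⟩)
  refine ⟨a, ha.congr ?_⟩
  filter_upwards [hb.dY_lt] with ω hω
  have := abs_lt.1 hω
  simp only [hw]
  rw [min_eq_left this.2.le, max_eq_right this.1.le]

theorem exists_smoothMoment_trend {Ker : ℝ → ℝ} {h : ℕ → ℝ} {fD : ℝ → ℝ} {fDX : 𝒳 → ℝ → ℝ}
    {fYD : ℝ → ℝ → ℝ} {dL dH c C d : ℝ} (hfDX : IsTreatedCondDensity P M fDX)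
    (hb : BoundsSmoothness P M Ker h fD fDX fYD dL dH c C) (hd : d ∈ Ioo dL dH) :
    ∃ a, HasSmoothMoment P M.D (fun ω => controlTrend P M (M.X ω)) d a := by
  have := Measure.isProbabilityMeasure_map (μ := P) M.measurable_X.aemeasurable
  obtain ⟨B, hB⟩ := hb.fDX_second
  have hC := hb.C_pos
  obtain ⟨a, ha⟩ := hasSmoothMoment_of_density (P := P) (D := M.D)
    M.measurable_X M.measurable_D hfDX.measurable hfDX.nonneg
    (treated_law_XD hfDX) hb.fDX_smooth hB hd
    (w := fun x => max (-C) (min (controlTrend P M x) C))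
    (measurable_const.max (measurable_controlTrend.min measurable_const)) (W := C) (fun t => by
      rw [abs_le]
      exact ⟨le_max_left _ _, max_le (by linarith) (min_le_right _ _)⟩)
  refine ⟨a, ha.congr ?_⟩
  filter_upwards [ae_map_X hb.trend_lt] with ω hω
  have := abs_lt.1 hω
  rw [min_eq_left this.2.le, max_eq_right this.1.le]

theorem smoothMoment_one {fD : ℝ → ℝ} {l u B d : ℝ} (hfD : IsTreatedDensity P M fD)
    (hs : ContDiffOn ℝ 2 fD (Ioo l u)) (hB : ∀ s ∈ Ioo l u, |iteratedDeriv 2 fD s| ≤ B)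
    (hd : d ∈ Ioo l u) : HasSmoothMoment P M.D (fun _ => 1) d (fD d) := by
  have hfm := hfD.measurable
  have hi : Integrable fD := by
    refine ⟨hfm.aestronglyMeasurable, ?_⟩
    have h1 : volume.withDensity (fun s => ENNReal.ofReal (fD s)) univ < ∞ := by
      rw [← hfD.law]
      have := Measure.isProbabilityMeasure_map (μ := P) M.measurable_D.aemeasurable
      exact measure_lt_top _ _
    rw [withDensity_apply _ MeasurableSet.univ, Measure.restrict_univ] at h1
    exact (hasFiniteIntegral_iff_ofReal (ae_of_all _ fun s => hfD.nonneg s)).2 h1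
  refine ⟨fD, hi, quadAt_of_contDiffOn hs hB hd, fun k hkm ⟨Bk, hBk⟩ hk0 => ?_⟩
  have e1 : ∫ ω, 1 * k (M.D ω) ∂P = ∫ s, k s ∂((P.map M.D).restrict {0}ᶜ) := by
    rw [setIntegral_eq_integral_of_forall_compl_eq_zero,
      integral_map M.measurable_D.aemeasurable hkm.aestronglyMeasurable]
    · simp
    intro p hp
    have : p = 0 := by simpa using hp
    rw [this, hk0]
  rw [e1, hfD.law, integral_withDensity_eq_integral_toReal_smul (by fun_prop) (by simp)]
  refine integral_congr_ae (ae_of_all _ fun s => ?_)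
  simp only [ENNReal.toReal_ofReal (hfD.nonneg s), smul_eq_mul, mul_comm]

omit [IsProbabilityMeasure P] in
theorem integral_closedBall_eq {U : Ω → ℝ} (d r : ℝ) :
    ∫ ω, U ω * (Metric.closedBall d r).indicator 1 (M.D ω) ∂P
      = ∫ ω in M.D ⁻¹' Metric.closedBall d r, U ω ∂P := by
  rw [← integral_indicator (M.measurable_D measurableSet_closedBall)]
  congr 1
  ext ω
  by_cases h : M.D ω ∈ Metric.closedBall d r
  · rw [indicator_of_mem h, indicator_of_mem (show ω ∈ M.D ⁻¹' Metric.closedBall d r from h)]; simp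
  · rw [indicator_of_notMem h, indicator_of_notMem (show ω ∉ M.D ⁻¹' Metric.closedBall d r from h)]; simp

/-- The conditional density exceeds `κ` on the whole ball for almost every covariate value; average
over `X`. -/
theorem le_prob_closedBall {dL dH κ : ℝ} {fDX : 𝒳 → ℝ → ℝ} (hfDX : IsTreatedCondDensity P M fDX)
    (hsupp : SupportAssumption P M fDX dL dH κ) {d r : ℝ}
    (hsub : Metric.closedBall d r ⊆ Icc dL dH) :
    κ * (2 * r) ≤ P.real (M.D ⁻¹' Metric.closedBall d r) := by
  have := Measure.isProbabilityMeasure_map (μ := P) M.measurable_X.aemeasurable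
  have h1 := setLIntegral_preimage_condDistrib (μ := P) M.measurable_X M.measurable_D.aemeasurable
    (measurableSet_closedBall (x := d) (ε := r)) MeasurableSet.univ
  rw [preimage_univ, univ_inter, Measure.restrict_univ] at h1
  rw [Measure.real, ← h1, ← ENNReal.ofReal_le_iff_le_toReal (by
    rw [h1]; exact measure_ne_top _ _)]
  calc ENNReal.ofReal (κ * (2 * r)) = ∫⁻ _, ENNReal.ofReal (κ * (2 * r)) ∂P := by simp
    _ ≤ _ := by
      refine lintegral_mono_ae ?_
      filter_upwards [ae_map_X hfDX.law, ae_map_X hsupp.density_gt] with ω hl hg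
      have h0 : Metric.closedBall d r ⊆ {0}ᶜ := fun s hs h0 => by
        have h2 := (hsub hs).1
        rw [h0] at h2
        linarith [hsupp.dL_pos]
      have h2 : (condDistrib M.D M.X P (M.X ω)) (Metric.closedBall d r)
          = (condDistrib M.D M.X P (M.X ω)).restrict {0}ᶜ (Metric.closedBall d r) := by
        rw [Measure.restrict_eq_self _ h0]
      rw [h2, hl, withDensity_apply _ measurableSet_closedBall]
      calc ENNReal.ofReal (κ * (2 * r))
          = ∫⁻ _ in Metric.closedBall d r, ENNReal.ofReal κ := by
            rw [setLIntegral_const, Real.volume_closedBall,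
              ENNReal.ofReal_mul hsupp.κ_pos.le]
        _ ≤ _ := setLIntegral_mono' measurableSet_closedBall fun s hs =>
            ENNReal.ofReal_le_ofReal (hg s (hsub hs)).le

theorem eventually_closedBall_subset {l u d : ℝ} (hd : d ∈ Ioo l u) :
    ∀ᶠ r in 𝓝[>] (0 : ℝ), Metric.closedBall d r ⊆ Icc l u := by
  have : ∀ᶠ r in 𝓝[>] (0 : ℝ), r < min (d - l) (u - d) :=
    nhdsWithin_le_nhds (eventually_lt_nhds (lt_min (by linarith [hd.1]) (by linarith [hd.2])))
  filter_upwards [this] with r hr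
  have h1 := hr.trans_le (min_le_left _ _)
  have h2 := hr.trans_le (min_le_right _ _)
  rw [Real.closedBall_eq_Icc]
  exact Icc_subset_Icc (by linarith) (by linarith)

/-- Positivity at `d` itself comes from overlap, through averages over shrinking balls; the bound
`sup_density` concerns some point of the interval only. -/
theorem density_pos {dL dH κ d a : ℝ} {fDX : 𝒳 → ℝ → ℝ} (hfDX : IsTreatedCondDensity P M fDX)
    (hsupp : SupportAssumption P M fDX dL dH κ) (hd : d ∈ Ioo dL dH)
    (h1 : HasSmoothMoment P M.D (fun _ => 1) d a) : 0 < a := by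
  refine hsupp.κ_pos.trans_le (ge_of_tendsto (h1.tendsto_average (hsupp.dL_pos.trans hd.1)) ?_)
  filter_upwards [self_mem_nhdsWithin, eventually_closedBall_subset hd] with r hr hsub
  have hr : 0 < r := hr
  rw [integral_closedBall_eq, setIntegral_const, smul_eq_mul, mul_one, inv_mul_eq_div,
    le_div_iff₀ (by positivity)]
  exact le_prob_closedBall hfDX hsupp hsub

/-- On a treated ball the effect is `ΔY` minus the untreated trend, and parallel trends replace the
latter in the mean by the control trend. The local effect becomes a ratio of ball averages in which
$(2r)^{-1}$ cancels. -/
theorem tendsto_localEffect {dL dH κ d f aY am : ℝ} {fDX : 𝒳 → ℝ → ℝ}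
    (hfDX : IsTreatedCondDensity P M fDX)
    (hsupp : SupportAssumption P M fDX dL dH κ) (hanticip : NoAnticipation P M)
    (htrend : ParallelTrends P M dL dH) (hdY : Integrable M.dY P) (hpre : Integrable M.Ypre P)
    (hm : Integrable (fun ω => controlTrend P M (M.X ω)) P) (hd : d ∈ Ioo dL dH)
    (h1 : HasSmoothMoment P M.D (fun _ => 1) d f) (hY : HasSmoothMoment P M.D M.dY d aY)
    (hT : HasSmoothMoment P M.D (fun ω => controlTrend P M (M.X ω)) d am) :
    Tendsto (localEffect P M d) (𝓝[>] 0) (𝓝 ((aY - am) / f)) := by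
  have hd0 : 0 < d := hsupp.dL_pos.trans hd.1
  have hf : 0 < f := density_pos hfDX hsupp hd h1
  have hlim := ((hY.sub M.measurable_D hT hdY hm).tendsto_average hd0).div
    (h1.tendsto_average hd0) hf.ne'
  refine hlim.congr' ?_
  filter_upwards [self_mem_nhdsWithin, eventually_closedBall_subset hd] with r hr hsub
  have hr : 0 < r := hr
  have hA : MeasurableSet (M.D ⁻¹' Metric.closedBall d r) :=
    M.measurable_D measurableSet_closedBall
  simp only [Pi.div_apply]
  rw [integral_closedBall_eq, integral_closedBall_eq, setIntegral_const, localEffect,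
    ProbabilityTheory.cond, integral_smul_measure, ENNReal.toReal_inv]
  have e : ∫ ω in M.D ⁻¹' Metric.closedBall d r, (M.potPost (M.D ω) ω - M.potPost 0 ω) ∂P
      = ∫ ω in M.D ⁻¹' Metric.closedBall d r, (M.dY ω - controlTrend P M (M.X ω)) ∂P := by
    have hWi : Integrable (fun ω => M.potPost 0 ω - M.potPre ω) P :=
      htrend.integrable.sub (hpre.congr hanticip.pre)
    rw [integral_sub hdY.integrableOn hm.integrableOn,
      ← integral_untreated_trend hsupp hanticip htrend hdY hpre measurableSet_closedBall hsub,
      ← integral_sub hdY.integrableOn hWi.integrableOn]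
    refine integral_congr_ae (ae_restrict_of_ae ?_)
    filter_upwards [hanticip.post, hanticip.pre] with ω h1 h2
    rw [Population.dY, h1, h2]
    ring
  rw [e, smul_eq_mul, smul_eq_mul, mul_one, Measure.real]
  have : (0 : ℝ) < (2 * r)⁻¹ := by positivity
  rw [mul_div_mul_left _ _ this.ne', inv_mul_eq_div]

/-- A conditional second moment bound for the kernel, uniform in the covariates. -/
theorem exists_cond_second_moment {Ker : ℝ → ℝ} (hK : KernelAssumption Ker) {l u d : ℝ}
    {fDX : 𝒳 → ℝ → ℝ} (hfDX : IsTreatedCondDensity P M fDX) (hl : 0 < l) (hd : d ∈ Ioo l u)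
    (hs : ∀ᵐ x ∂(P.map M.X), ContDiffOn ℝ 2 (fDX x) (Ioo l u))
    (hB : ∃ B, ∀ᵐ x ∂(P.map M.X), ∀ s ∈ Ioo l u, |iteratedDeriv 2 (fDX x) s| ≤ B) :
    ∃ A h₀, 0 < h₀ ∧ 0 < A ∧ ∀ h, 0 < h → h < h₀ → ∀ᵐ x ∂(P.map M.X),
      ∫ s, scaledKernel Ker h (s - d) ^ 2 ∂(condDistrib M.D M.X P x) ≤ A / h := by
  obtain ⟨B, hB⟩ := hB
  obtain ⟨δ, hδ, hδl, hδu⟩ : ∃ δ : ℝ, 0 < δ ∧ l < d - 2 * δ ∧ d + 2 * δ < u := by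
    refine ⟨min (d - l) (u - d) / 3, ?_, ?_, ?_⟩
    · have : 0 < min (d - l) (u - d) := lt_min (by linarith [hd.1]) (by linarith [hd.2])
      positivity
    · have := min_le_left (d - l) (u - d); linarith [hd.1]
    · have := min_le_right (d - l) (u - d); linarith [hd.2]
  -- Each conditional density has mass at most `1`, so `le_integral_of_second_deriv` bounds it near
  -- `d` by this constant, uniformly in the covariates.
  obtain ⟨A, h₀, hh₀, hA, H⟩ := hK.exists_second_moment (d := d) (B := (2 * δ)⁻¹ + |B| * δ ^ 2) hδ
    (by linarith) (by positivity)
  refine ⟨A, h₀, hh₀, hA, fun h hh hlt => ?_⟩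
  filter_upwards [hfDX.law, hs, hB] with x h1 h2 h3
  have hm : Measurable (fDX x) := hfDX.measurable.comp measurable_prodMk_left
  have htot : ∫⁻ s, ENNReal.ofReal (fDX x s) ≤ 1 := by
    have := congrArg (fun ρ => ρ univ) h1
    simp only [withDensity_apply _ MeasurableSet.univ, Measure.restrict_univ] at this
    rw [← this]
    exact (Measure.restrict_apply_le _ _).trans prob_le_one
  have hi : Integrable (fDX x) := ⟨hm.aestronglyMeasurable,
    (hasFiniteIntegral_iff_ofReal (ae_of_all _ fun s => hfDX.nonneg x s)).2
      (htot.trans_lt (by simp))⟩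
  have hle : ∫ s, fDX x s ≤ 1 := by
    rw [integral_eq_lintegral_of_nonneg_ae (ae_of_all _ fun s => hfDX.nonneg x s)
      hm.aestronglyMeasurable]
    exact ENNReal.toReal_le_of_le_ofReal zero_le_one (by simpa using htot)
  refine H h hh hlt _ (fDX x) hm (hfDX.nonneg x) h1 fun s hs => ?_
  have hsd := abs_lt.1 hs
  refine (le_integral_of_second_deriv h2 (B := |B|) (fun s hs => (h3 s hs).trans (le_abs_self B))
    (hfDX.nonneg x) hi hδ (by linarith) (by linarith)).trans ?_
  have : (2 * δ)⁻¹ * ∫ s, fDX x s ≤ (2 * δ)⁻¹ * 1 := by gcongr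
  linarith

end PopulationFacts

/-! ### Effect of perturbing the nuisance parameters: second moment and mean. -/

section NuisanceBounds

variable {Ω 𝒳 : Type*} [MeasurableSpace Ω] [MeasurableSpace 𝒳] {P : Measure Ω}
  {M : Population Ω 𝒳}

/-- The residual score `(K_h(D - d) - 1{D = 0} f_h(X) / g(X)) (ΔY - ℰ(X))`, which does not involve
the density of `D`. -/
noncomputable def residualScore (Ker : ℝ → ℝ) (h d : ℝ) (η : Nuisance 𝒳) (z : Obs 𝒳) : ℝ :=
  weight Ker h d 1 η z * (z.dY - η.m z.cov)

omit [MeasurableSpace 𝒳] in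
-- The density enters only as a divisor, so its estimation can be separated from that of the other
-- nuisances.
theorem weight_eq_div (Ker : ℝ → ℝ) (h d f : ℝ) (η : Nuisance 𝒳) (z : Obs 𝒳) :
    weight Ker h d f η z = weight Ker h d 1 η z / f := by
  simp only [weight, one_mul, div_div]
  rw [mul_comm f]

theorem measurable_residualScore {Ker : ℝ → ℝ} (hK : KernelAssumption Ker) (h d : ℝ)
    {η : Nuisance 𝒳} (h1 : Measurable η.fh) (h2 : Measurable η.g) (h3 : Measurable η.m) :
    Measurable (residualScore Ker h d η) := by
  have hk := hK.measurable_scaled h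
  have hi : Measurable (({0} : Set ℝ).indicator (fun _ => (1 : ℝ))) :=
    measurable_const.indicator (measurableSet_singleton 0)
  unfold residualScore weight Obs.dY Obs.trt Obs.cov
  fun_prop

/-- The bounds on the population that are used at a single bandwidth `h`. -/
structure RegularAt (P : Measure Ω) [IsFiniteMeasure P] (M : Population Ω 𝒳) (Ker : ℝ → ℝ)
    (h d κ C A : ℝ) : Prop where
  kernel : KernelAssumption Ker
  h_pos : 0 < h
  h_le : h ≤ 1
  κ_pos : 0 < κ
  C_pos : 0 < C
  A_pos : 0 < A
  dY_lt : ∀ᵐ ω ∂P, |M.dY ω| < 2 * C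
  trend_lt : ∀ᵐ ω ∂P, |controlTrend P M (M.X ω)| < C
  smoothed_lt : ∀ᵐ ω ∂P, |smoothedCondDensity P M Ker h d (M.X ω)| < C
  overlap : ∀ᵐ ω ∂P, κ < propensity P M (M.X ω) ∧ propensity P M (M.X ω) ≤ 1
  second_moment : ∀ᵐ ω ∂P,
    ∫ s, scaledKernel Ker h (s - d) ^ 2 ∂(condDistrib M.D M.X P (M.X ω)) ≤ A / h

/-- A measurable version of `GoodNuisance`, with a non-strict essential bound. -/
structure IsAccurate (P : Measure Ω) [IsFiniteMeasure P] (M : Population Ω 𝒳)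
    (Ker : ℝ → ℝ) (h d ε κ c C : ℝ) (η : Nuisance 𝒳) : Prop where
  fh_rate : eLpNorm (fun x => η.fh x - smoothedCondDensity P M Ker h d x) 2 (P.map M.X)
    ≤ ENNReal.ofReal ((√h)⁻¹ * ε)
  g_rate : eLpNorm (fun x => η.g x - propensity P M x) 2 (P.map M.X) ≤ ENNReal.ofReal ε
  m_rate : eLpNorm (fun x => η.m x - controlTrend P M x) 2 (P.map M.X) ≤ ENNReal.ofReal ε
  g_bounds : ∀ᵐ x ∂(P.map M.X), κ < η.g x ∧ η.g x < 1 - κ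
  fh_bounds : ∀ᵐ x ∂(P.map M.X), c < η.fh x ∧ η.fh x < C
  m_bound : ∀ᵐ x ∂(P.map M.X), |η.m x| ≤ C

theorem GoodNuisance.isAccurate [IsFiniteMeasure P] {Ker : ℝ → ℝ} {h d ε κ c C : ℝ}
    {η : Nuisance 𝒳} (hg : GoodNuisance P M Ker h d ε κ c C η) :
    IsAccurate P M Ker h d ε κ c C η where
  fh_rate := hg.fh_rate
  g_rate := hg.g_rate
  m_rate := hg.m_rate
  g_bounds := hg.g_bounds
  fh_bounds := hg.fh_bounds
  m_bound := by
    have h1 := hg.m_bound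
    have hC : 0 < C := by
      by_contra hc
      rw [ENNReal.ofReal_eq_zero.2 (not_lt.1 hc)] at h1
      exact absurd h1 not_lt_zero
    rw [eLpNorm_exponent_top] at h1
    filter_upwards [ae_le_eLpNormEssSup (f := η.m) (μ := P.map M.X)] with x hx
    have h2 := hx.trans h1.le
    rw [← ofReal_norm, ENNReal.ofReal_le_ofReal_iff hC.le] at h2
    exact h2

theorem integral_sq_le_of_eLpNorm_le {T : Type*} [MeasurableSpace T] {ν : Measure T} {f : T → ℝ}
    (hf : AEStronglyMeasurable f ν) {e : ℝ} (h : eLpNorm f 2 ν ≤ ENNReal.ofReal e) :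
    Integrable (fun t => f t ^ 2) ν ∧ ∫ t, f t ^ 2 ∂ν ≤ e ^ 2 := by
  have hmem : MemLp f 2 ν := ⟨hf, h.trans_lt ENNReal.ofReal_lt_top⟩
  refine ⟨hmem.integrable_sq, ?_⟩
  have h0 : 0 ≤ ∫ t, f t ^ 2 ∂ν := integral_nonneg fun _ => sq_nonneg _
  have h1 : eLpNorm f 2 ν = ENNReal.ofReal (√(∫ t, f t ^ 2 ∂ν)) := by
    rw [hmem.eLpNorm_eq_integral_rpow_norm (by norm_num) (by norm_num), Real.sqrt_eq_rpow]
    simp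
  rw [h1] at h
  rcases le_or_gt 0 e with he | he
  · rw [ENNReal.ofReal_le_ofReal_iff he, Real.sqrt_le_left he] at h
    exact h
  · rw [ENNReal.ofReal_of_nonpos he.le, nonpos_iff_eq_zero, ENNReal.ofReal_eq_zero] at h
    have := Real.sqrt_eq_zero'.1 (le_antisymm h (Real.sqrt_nonneg _))
    exact this.trans (sq_nonneg e)

variable [IsProbabilityMeasure P] {Ker : ℝ → ℝ} {h d κ C A : ℝ}

theorem IsAccurate.integral_sq {ε c : ℝ} {η : Nuisance 𝒳} (hK : KernelAssumption Ker)
    (hh : 0 < h) (h1 : Measurable η.fh) (h2 : Measurable η.g) (h3 : Measurable η.m)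
    (ha : IsAccurate P M Ker h d ε κ c C η) :
    (Integrable (fun ω => (η.fh (M.X ω) - smoothedCondDensity P M Ker h d (M.X ω)) ^ 2) P ∧
      ∫ ω, (η.fh (M.X ω) - smoothedCondDensity P M Ker h d (M.X ω)) ^ 2 ∂P ≤ ε ^ 2 / h) ∧
    (Integrable (fun ω => (η.g (M.X ω) - propensity P M (M.X ω)) ^ 2) P ∧
      ∫ ω, (η.g (M.X ω) - propensity P M (M.X ω)) ^ 2 ∂P ≤ ε ^ 2) ∧
    (Integrable (fun ω => (η.m (M.X ω) - controlTrend P M (M.X ω)) ^ 2) P ∧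
      ∫ ω, (η.m (M.X ω) - controlTrend P M (M.X ω)) ^ 2 ∂P ≤ ε ^ 2) := by
  have key : ∀ (f : 𝒳 → ℝ) (e : ℝ), Measurable f →
      eLpNorm f 2 (P.map M.X) ≤ ENNReal.ofReal e →
      Integrable (fun ω => f (M.X ω) ^ 2) P ∧ ∫ ω, f (M.X ω) ^ 2 ∂P ≤ e ^ 2 := by
    intro f e hf he
    obtain ⟨i1, i2⟩ := integral_sq_le_of_eLpNorm_le hf.aestronglyMeasurable he
    rw [integrable_map_measure (by fun_prop) M.measurable_X.aemeasurable] at i1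
    rw [integral_map M.measurable_X.aemeasurable (by fun_prop)] at i2
    exact ⟨i1, i2⟩
  have e1 : ((√h)⁻¹ * ε) ^ 2 = ε ^ 2 / h := by
    rw [mul_pow, inv_pow, Real.sq_sqrt hh.le]; field_simp
  refine ⟨?_, key (fun x => η.g x - propensity P M x) ε (h2.sub measurable_propensity) ha.g_rate,
    key (fun x => η.m x - controlTrend P M x) ε (h3.sub measurable_controlTrend) ha.m_rate⟩
  rw [← e1]
  exact key (fun x => η.fh x - smoothedCondDensity P M Ker h d x) _
    (h1.sub (measurable_smoothedCondDensity hK h d)) ha.fh_rate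

theorem trueNuisance_measurable (hK : KernelAssumption Ker) :
    Measurable (trueNuisance P M Ker h d).fh ∧ Measurable (trueNuisance P M Ker h d).g ∧
      Measurable (trueNuisance P M Ker h d).m :=
  ⟨measurable_smoothedCondDensity hK h d, measurable_propensity, measurable_controlTrend⟩

theorem integrable_of_ae_bound {f : Ω → ℝ} (hf : Measurable f) {B : ℝ}
    (hB : ∀ᵐ ω ∂P, |f ω| ≤ B) : Integrable f P :=
  Integrable.of_bound hf.aestronglyMeasurable B hB

omit [IsProbabilityMeasure P] in
theorem measurable_kernel_D (hK : KernelAssumption Ker) :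
    Measurable fun ω => scaledKernel Ker h (M.D ω - d) :=
  (hK.measurable_scaled h).comp (M.measurable_D.sub_const d)

/-- `E[ρ(X) K_h(D - d)²] ≤ (A / h) E[ρ(X)]` for bounded `ρ ≥ 0`. -/
theorem RegularAt.integral_mul_kernel_sq_le (hr : RegularAt P M Ker h d κ C A) {ρ : 𝒳 → ℝ}
    (hρ : Measurable ρ) (h0 : ∀ x, 0 ≤ ρ x) {B : ℝ} (hB : ∀ᵐ ω ∂P, ρ (M.X ω) ≤ B) :
    Integrable (fun ω => ρ (M.X ω) * scaledKernel Ker h (M.D ω - d) ^ 2) P ∧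
    ∫ ω, ρ (M.X ω) * scaledKernel Ker h (M.D ω - d) ^ 2 ∂P ≤ A / h * ∫ ω, ρ (M.X ω) ∂P := by
  obtain ⟨Bk, hBk, hk⟩ := hr.kernel.exists_bound
  have hkm : Measurable fun s => scaledKernel Ker h (s - d) ^ 2 :=
    ((hr.kernel.measurable_scaled h).comp (measurable_id.sub_const d)).pow_const 2
  have hρX : Integrable (fun ω => ρ (M.X ω)) P :=
    integrable_of_ae_bound (hρ.comp M.measurable_X) (by
      filter_upwards [hB] with ω hω
      rwa [abs_of_nonneg (h0 _)])
  have hi : Integrable (fun ω => ρ (M.X ω) * scaledKernel Ker h (M.D ω - d) ^ 2) P := by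
    refine hρX.mul_bdd (hkm.comp M.measurable_D).aestronglyMeasurable (c := (Bk / h) ^ 2)
      (ae_of_all _ fun ω => ?_)
    rw [norm_pow]
    gcongr
    exact hk h hr.h_pos _
  refine ⟨hi, ?_⟩
  rw [integral_mul_condDistrib M.measurable_X M.measurable_D.aemeasurable hρ hkm hi,
    ← integral_const_mul]
  refine integral_mono_of_nonneg (ae_of_all _ fun ω => ?_) (hρX.const_mul _) ?_
  · exact mul_nonneg (h0 _) (integral_nonneg fun _ => sq_nonneg _)
  · filter_upwards [hr.second_moment] with ω hω
    rw [mul_comm]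
    exact mul_le_mul_of_nonneg_right hω (h0 _)

/-- `E[ρ(X) K_h(D - d)] = E[ρ(X) f_h⁰(X)]` for bounded `ρ`. -/
theorem RegularAt.integral_mul_kernel (hr : RegularAt P M Ker h d κ C A) {ρ : 𝒳 → ℝ}
    (hρ : Measurable ρ) {B : ℝ} (hB : ∀ᵐ ω ∂P, |ρ (M.X ω)| ≤ B) :
    ∫ ω, ρ (M.X ω) * scaledKernel Ker h (M.D ω - d) ∂P
      = ∫ ω, ρ (M.X ω) * smoothedCondDensity P M Ker h d (M.X ω) ∂P := by
  obtain ⟨Bk, hBk, hk⟩ := hr.kernel.exists_bound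
  have hkm : Measurable fun s => scaledKernel Ker h (s - d) :=
    (hr.kernel.measurable_scaled h).comp (measurable_id.sub_const d)
  exact integral_mul_condDistrib M.measurable_X M.measurable_D.aemeasurable hρ hkm
    ((integrable_of_ae_bound (hρ.comp M.measurable_X) hB).mul_bdd
      (hkm.comp M.measurable_D).aestronglyMeasurable (c := Bk / h)
      (ae_of_all _ fun ω => hk h hr.h_pos _))

/-- `E[ρ(X) 1{D = 0}] = E[ρ(X) g₀(X)]` for bounded `ρ`. -/
theorem integral_mul_control {ρ : 𝒳 → ℝ} (hρ : Measurable ρ) {B : ℝ}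
    (hB : ∀ᵐ ω ∂P, |ρ (M.X ω)| ≤ B) :
    ∫ ω, ρ (M.X ω) * ({0} : Set ℝ).indicator (fun _ => (1 : ℝ)) (M.D ω) ∂P
      = ∫ ω, ρ (M.X ω) * propensity P M (M.X ω) ∂P := by
  have hm : Measurable (({0} : Set ℝ).indicator (fun _ => (1 : ℝ))) :=
    measurable_const.indicator (measurableSet_singleton 0)
  rw [integral_mul_condDistrib M.measurable_X M.measurable_D.aemeasurable hρ hm]
  · simp only [propensity, integral_indicator_const (1 : ℝ) (measurableSet_singleton (0 : ℝ)),
      smul_eq_mul, mul_one]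
  · refine (integrable_of_ae_bound (hρ.comp M.measurable_X) hB).mul_bdd
      (hm.comp M.measurable_D).aestronglyMeasurable (c := 1) (ae_of_all _ fun ω => ?_)
    by_cases h0 : M.D ω ∈ ({0} : Set ℝ) <;> simp [h0]

theorem abs_indicator_one_le (s : ℝ) :
    |({0} : Set ℝ).indicator (fun _ => (1 : ℝ)) s| ≤ 1 := by
  by_cases h0 : s ∈ ({0} : Set ℝ) <;> simp [h0]

theorem residualScore_eq (η : Nuisance 𝒳) (ω : Ω) (hg : η.g (M.X ω) ≠ 0) :
    residualScore Ker h d η (M.obs ω) = (scaledKernel Ker h (M.D ω - d)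
      - ({0} : Set ℝ).indicator (fun _ => (1 : ℝ)) (M.D ω) * (η.fh (M.X ω) / η.g (M.X ω))) *
        (M.dY ω - η.m (M.X ω)) := by
  simp only [residualScore, weight]
  change (scaledKernel Ker h (M.D ω - d) * η.g (M.X ω) - _ * η.fh (M.X ω)) / (1 * η.g (M.X ω)) *
    (M.dY ω - η.m (M.X ω)) = _
  rw [one_mul, sub_div, mul_div_assoc, div_self hg, mul_one, mul_div_assoc]
  rfl

/-- The difference of the residual scores at `η` and at the truth. -/
theorem residualScore_sub_eq (η : Nuisance 𝒳) (ω : Ω) (hg : η.g (M.X ω) ≠ 0)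
    (hg0 : propensity P M (M.X ω) ≠ 0) :
    residualScore Ker h d η (M.obs ω) - residualScore Ker h d (trueNuisance P M Ker h d) (M.obs ω)
      = (controlTrend P M (M.X ω) - η.m (M.X ω)) * scaledKernel Ker h (M.D ω - d)
        - (η.fh (M.X ω) / η.g (M.X ω) * (controlTrend P M (M.X ω) - η.m (M.X ω))) *
          ({0} : Set ℝ).indicator (fun _ => (1 : ℝ)) (M.D ω)
        - ({0} : Set ℝ).indicator (fun _ => (1 : ℝ)) (M.D ω) *
          (η.fh (M.X ω) / η.g (M.X ω) - smoothedCondDensity P M Ker h d (M.X ω) /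
            propensity P M (M.X ω)) * (M.dY ω - controlTrend P M (M.X ω)) := by
  rw [residualScore_eq η ω hg, residualScore_eq (trueNuisance P M Ker h d) ω hg0]
  simp only [trueNuisance]
  ring

theorem abs_ratio_sub_le {f f₀ g g₀ κ C : ℝ} (hκ : 0 < κ) (hg : κ ≤ g) (hg0 : κ ≤ g₀)
    (hf0 : |f₀| ≤ C) : |f / g - f₀ / g₀| ≤ |f - f₀| / κ + C * |g - g₀| / κ ^ 2 := by
  have h1 : 0 < g := hκ.trans_le hg
  have h2 : 0 < g₀ := hκ.trans_le hg0
  have hC : 0 ≤ C := (abs_nonneg _).trans hf0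
  have e : f / g - f₀ / g₀ = (f - f₀) / g - f₀ * (g - g₀) / (g * g₀) := by
    field_simp; ring
  rw [e]
  refine (abs_sub _ _).trans ?_
  rw [abs_div, abs_div, abs_mul, abs_of_pos h1, abs_of_pos (mul_pos h1 h2)]
  gcongr
  rw [sq]
  gcongr

/-- The error in `m` is multiplied by the kernel, whose conditional second moment is at most `A /
h`. The error in `fh` already has square norm $\varepsilon^2/h$, and the remaining errors are
smaller because $h\le1$. -/
theorem RegularAt.second_moment_sub (hr : RegularAt P M Ker h d κ C A) {ε c : ℝ} {η : Nuisance 𝒳}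
    (h1 : Measurable η.fh) (h2 : Measurable η.g) (h3 : Measurable η.m) (hc : 0 < c)
    (ha : IsAccurate P M Ker h d ε κ c C η) :
    ∫ ω, (residualScore Ker h d η (M.obs ω)
        - residualScore Ker h d (trueNuisance P M Ker h d) (M.obs ω)) ^ 2 ∂P
      ≤ 4 * (A + (C / κ) ^ 2 + (3 * C / κ) ^ 2 + (3 * C ^ 2 / κ ^ 2) ^ 2) * (ε ^ 2 / h) := by
  obtain ⟨⟨if1, if2⟩, ⟨ig1, ig2⟩, ⟨im1, im2⟩⟩ := ha.integral_sq hr.kernel hr.h_pos h1 h2 h3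
  have hκ := hr.κ_pos
  have hC := hr.C_pos
  have hmb : ∀ᵐ ω ∂P, (η.m (M.X ω) - controlTrend P M (M.X ω)) ^ 2 ≤ (2 * C) ^ 2 := by
    filter_upwards [ae_map_X ha.m_bound, hr.trend_lt] with ω e1 e2
    rw [← sq_abs]
    have := abs_sub (η.m (M.X ω)) (controlTrend P M (M.X ω))
    gcongr
    linarith
  obtain ⟨ik1, ik2⟩ := hr.integral_mul_kernel_sq_le
    (ρ := fun x => (η.m x - controlTrend P M x) ^ 2)
    ((h3.sub measurable_controlTrend).pow_const 2) (fun _ => sq_nonneg _) hmb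
  have hpt : ∀ᵐ ω ∂P, (residualScore Ker h d η (M.obs ω)
        - residualScore Ker h d (trueNuisance P M Ker h d) (M.obs ω)) ^ 2 ≤
      4 * ((η.m (M.X ω) - controlTrend P M (M.X ω)) ^ 2 * scaledKernel Ker h (M.D ω - d) ^ 2)
      + 4 * (C / κ) ^ 2 * (η.m (M.X ω) - controlTrend P M (M.X ω)) ^ 2
      + 4 * (3 * C / κ) ^ 2 * (η.fh (M.X ω) - smoothedCondDensity P M Ker h d (M.X ω)) ^ 2
      + 4 * (3 * C ^ 2 / κ ^ 2) ^ 2 * (η.g (M.X ω) - propensity P M (M.X ω)) ^ 2 := by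
    filter_upwards [ae_map_X ha.g_bounds, ae_map_X ha.fh_bounds, hr.overlap, hr.dY_lt, hr.trend_lt,
      hr.smoothed_lt] with ω g1 f1 o1 y1 t1 s1
    have hg0 : 0 < η.g (M.X ω) := hκ.trans g1.1
    rw [residualScore_sub_eq η ω hg0.ne' (hκ.trans o1.1).ne']
    set i := ({0} : Set ℝ).indicator (fun _ => (1 : ℝ)) (M.D ω)
    have hi : |i| ≤ 1 := abs_indicator_one_le _
    set k := scaledKernel Ker h (M.D ω - d)
    set m := η.m (M.X ω)
    set m₀ := controlTrend P M (M.X ω)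
    set f := η.fh (M.X ω)
    set f₀ := smoothedCondDensity P M Ker h d (M.X ω)
    set g := η.g (M.X ω)
    set g₀ := propensity P M (M.X ω)
    set y := M.dY ω
    have b1 : |(m₀ - m) * k| = |m - m₀| * |k| := by rw [abs_mul, abs_sub_comm]
    have b2 : |f / g * (m₀ - m) * i| ≤ C / κ * |m - m₀| := by
      have : |f / g| ≤ C / κ := by
        rw [abs_div, abs_of_pos hg0, abs_of_pos (hc.trans f1.1)]
        have := f1.2.le
        have := g1.1.le
        gcongr
      rw [abs_mul, abs_mul, abs_sub_comm m₀]
      calc |f / g| * |m - m₀| * |i| ≤ C / κ * |m - m₀| * 1 := by gcongr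
        _ = _ := mul_one _
    have b3 : |i * (f / g - f₀ / g₀) * (y - m₀)|
        ≤ 3 * C / κ * |f - f₀| + 3 * C ^ 2 / κ ^ 2 * |g - g₀| := by
      have e1 := abs_ratio_sub_le (f := f) hκ g1.1.le o1.1.le s1.le
      have e2 : |y - m₀| ≤ 3 * C := (abs_sub _ _).trans (by linarith)
      rw [abs_mul, abs_mul]
      calc |i| * |f / g - f₀ / g₀| * |y - m₀|
          ≤ 1 * (|f - f₀| / κ + C * |g - g₀| / κ ^ 2) * (3 * C) := by gcongr
        _ = _ := by field_simp
    have b4 : |(m₀ - m) * k - f / g * (m₀ - m) * i - i * (f / g - f₀ / g₀) * (y - m₀)|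
        ≤ |m - m₀| * |k| + C / κ * |m - m₀| + 3 * C / κ * |f - f₀|
          + 3 * C ^ 2 / κ ^ 2 * |g - g₀| := by
      have t1 := abs_sub ((m₀ - m) * k - f / g * (m₀ - m) * i) (i * (f / g - f₀ / g₀) * (y - m₀))
      have t2 := abs_sub ((m₀ - m) * k) (f / g * (m₀ - m) * i)
      linarith
    rw [← sq_abs]
    refine (pow_le_pow_left₀ (abs_nonneg _) b4 2).trans ?_
    have q : ∀ a b c e : ℝ, (a + b + c + e) ^ 2 ≤ 4 * a ^ 2 + 4 * b ^ 2 + 4 * c ^ 2 + 4 * e ^ 2 := by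
      intro a b c e
      nlinarith [sq_nonneg (a - b), sq_nonneg (a - c), sq_nonneg (a - e), sq_nonneg (b - c),
        sq_nonneg (b - e), sq_nonneg (c - e)]
    refine (q _ _ _ _).trans (le_of_eq ?_)
    simp only [mul_pow, sq_abs]
    ring
  have j1 := ik1.const_mul 4
  have j2 := im1.const_mul (4 * (C / κ) ^ 2)
  have j3 := if1.const_mul (4 * (3 * C / κ) ^ 2)
  have j4 := ig1.const_mul (4 * (3 * C ^ 2 / κ ^ 2) ^ 2)
  refine (integral_mono_of_nonneg (ae_of_all _ fun _ => sq_nonneg _) (((j1.add j2).add j3).add j4)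
    hpt).trans ?_
  have e := integral_add ((j1.add j2).add j3) j4
  have e' := integral_add (j1.add j2) j3
  have e'' := integral_add j1 j2
  simp only [Pi.add_apply] at e e' e'' ⊢
  rw [e, e', e'', integral_const_mul, integral_const_mul, integral_const_mul, integral_const_mul]
  have hε : ε ^ 2 ≤ ε ^ 2 / h := by
    rw [le_div_iff₀ hr.h_pos]
    exact mul_le_of_le_one_right (sq_nonneg _) hr.h_le
  have hAh : 0 ≤ A / h := div_nonneg hr.A_pos.le hr.h_pos.le
  have k1 : ∫ ω, (η.m (M.X ω) - controlTrend P M (M.X ω)) ^ 2 * scaledKernel Ker h (M.D ω - d) ^ 2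
      ∂P ≤ A * (ε ^ 2 / h) := by
    refine ik2.trans ?_
    calc _ ≤ A / h * ε ^ 2 := by gcongr
      _ = _ := by ring
  have k2 := mul_le_mul_of_nonneg_left (im2.trans hε) (by positivity : 0 ≤ 4 * (C / κ) ^ 2)
  have k3 := mul_le_mul_of_nonneg_left if2 (by positivity : 0 ≤ 4 * (3 * C / κ) ^ 2)
  have k4 := mul_le_mul_of_nonneg_left (ig2.trans hε)
    (by positivity : 0 ≤ 4 * (3 * C ^ 2 / κ ^ 2) ^ 2)
  linarith

theorem RegularAt.integrable_dY (hr : RegularAt P M Ker h d κ C A) : Integrable M.dY P :=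
  integrable_of_ae_bound M.measurable_dY (by filter_upwards [hr.dY_lt] with ω hω using hω.le)

theorem RegularAt.integrable_trend (hr : RegularAt P M Ker h d κ C A) :
    Integrable (fun ω => controlTrend P M (M.X ω)) P :=
  integrable_of_ae_bound (measurable_controlTrend.comp M.measurable_X)
    (by filter_upwards [hr.trend_lt] with ω hω using hω.le)

theorem measurable_control_D :
    Measurable fun ω => ({0} : Set ℝ).indicator (fun _ => (1 : ℝ)) (M.D ω) :=
  (measurable_const.indicator (measurableSet_singleton 0)).comp M.measurable_D

/-- Neyman orthogonality. The term linear in the error of `fh / g` multiplies the control residual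
and has mean zero. Conditioning the rest on `X` turns the kernel into $f_h^0$ and the control
indicator into $g_0$, so only products with the error of `m` survive. -/
theorem RegularAt.abs_mean_sub (hr : RegularAt P M Ker h d κ C A) {ε c : ℝ} {η : Nuisance 𝒳}
    (h1 : Measurable η.fh) (h2 : Measurable η.g) (h3 : Measurable η.m) (hc : 0 < c)
    (ha : IsAccurate P M Ker h d ε κ c C η) :
    |∫ ω, (residualScore Ker h d η (M.obs ω)
        - residualScore Ker h d (trueNuisance P M Ker h d) (M.obs ω)) ∂P|
      ≤ (C + 1) / κ * (ε ^ 2 / √h) := by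
  obtain ⟨⟨if1, if2⟩, ⟨ig1, ig2⟩, ⟨im1, im2⟩⟩ := ha.integral_sq hr.kernel hr.h_pos h1 h2 h3
  have hκ := hr.κ_pos
  have hC := hr.C_pos
  have hh := hr.h_pos
  obtain ⟨Bk, hBk, hk⟩ := hr.kernel.exists_bound
  have hmm : Measurable fun x => controlTrend P M x - η.m x := measurable_controlTrend.sub h3
  have hmb : ∀ᵐ ω ∂P, |controlTrend P M (M.X ω) - η.m (M.X ω)| ≤ 2 * C := by
    filter_upwards [ae_map_X ha.m_bound, hr.trend_lt] with ω e1 e2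
    have := abs_sub (controlTrend P M (M.X ω)) (η.m (M.X ω))
    linarith
  have hfgb : ∀ᵐ ω ∂P, |η.fh (M.X ω) / η.g (M.X ω)| ≤ C / κ := by
    filter_upwards [ae_map_X ha.g_bounds, ae_map_X ha.fh_bounds] with ω g1 f1
    rw [abs_div, abs_of_pos (hκ.trans g1.1), abs_of_pos (hc.trans f1.1)]
    have := f1.2.le
    have := g1.1.le
    gcongr
  have hfgm : Measurable fun x => η.fh x / η.g x := h1.div h2
  have hfmb : ∀ᵐ ω ∂P, |η.fh (M.X ω) / η.g (M.X ω) * (controlTrend P M (M.X ω) - η.m (M.X ω))|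
      ≤ C / κ * (2 * C) := by
    filter_upwards [hmb, hfgb] with ω e1 e2
    rw [abs_mul]
    gcongr
  have hρm : Measurable fun x => η.fh x / η.g x - smoothedCondDensity P M Ker h d x /
      propensity P M x :=
    hfgm.sub ((measurable_smoothedCondDensity hr.kernel h d).div measurable_propensity)
  have hρb' : ∀ᵐ ω ∂P, |η.fh (M.X ω) / η.g (M.X ω) - smoothedCondDensity P M Ker h d (M.X ω) /
      propensity P M (M.X ω)| ≤ C / κ + C / κ := by
    filter_upwards [hfgb, hr.overlap, hr.smoothed_lt] with ω e1 o1 s1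
    refine (abs_sub _ _).trans (add_le_add e1 ?_)
    rw [abs_div, abs_of_pos (hκ.trans o1.1)]
    have := s1.le
    have := o1.1.le
    gcongr
  have hρb : ∀ᵐ x ∂(P.map M.X), |η.fh x / η.g x - smoothedCondDensity P M Ker h d x /
      propensity P M x| ≤ C / κ + C / κ :=
    (ae_map_iff M.measurable_X.aemeasurable
      (measurableSet_le hρm.abs measurable_const)).2 hρb'
  have hI := measurable_control_D (M := M)
  have j1 : Integrable (fun ω => (controlTrend P M (M.X ω) - η.m (M.X ω)) *
      scaledKernel Ker h (M.D ω - d)) P :=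
    (integrable_of_ae_bound (hmm.comp M.measurable_X) hmb).mul_bdd
      (measurable_kernel_D hr.kernel).aestronglyMeasurable (c := Bk / h)
      (ae_of_all _ fun ω => hk h hh _)
  have j2 : Integrable (fun ω => η.fh (M.X ω) / η.g (M.X ω) *
      (controlTrend P M (M.X ω) - η.m (M.X ω)) *
      ({0} : Set ℝ).indicator (fun _ => (1 : ℝ)) (M.D ω)) P :=
    (integrable_of_ae_bound ((hfgm.mul hmm).comp M.measurable_X) hfmb).mul_bdd
      hI.aestronglyMeasurable (c := 1) (ae_of_all _ fun ω => abs_indicator_one_le _)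
  have j3 : Integrable (fun ω => ({0} : Set ℝ).indicator (fun _ => (1 : ℝ)) (M.D ω) *
      (η.fh (M.X ω) / η.g (M.X ω) - smoothedCondDensity P M Ker h d (M.X ω) /
        propensity P M (M.X ω)) * (M.dY ω - controlTrend P M (M.X ω))) P := by
    refine (hr.integrable_dY.sub hr.integrable_trend).bdd_mul (c := C / κ + C / κ)
      (hI.mul (hρm.comp M.measurable_X)).aestronglyMeasurable ?_
    filter_upwards [hρb'] with ω hω
    rw [Real.norm_eq_abs, abs_mul]
    calc _ ≤ 1 * (C / κ + C / κ) := by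
          gcongr
          exact abs_indicator_one_le _
      _ = _ := one_mul _
  have e1 : ∫ ω, (residualScore Ker h d η (M.obs ω)
        - residualScore Ker h d (trueNuisance P M Ker h d) (M.obs ω)) ∂P
      = ∫ ω, ((controlTrend P M (M.X ω) - η.m (M.X ω)) * scaledKernel Ker h (M.D ω - d)
        - (η.fh (M.X ω) / η.g (M.X ω) * (controlTrend P M (M.X ω) - η.m (M.X ω))) *
          ({0} : Set ℝ).indicator (fun _ => (1 : ℝ)) (M.D ω)
        - ({0} : Set ℝ).indicator (fun _ => (1 : ℝ)) (M.D ω) *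
          (η.fh (M.X ω) / η.g (M.X ω) - smoothedCondDensity P M Ker h d (M.X ω) /
            propensity P M (M.X ω)) * (M.dY ω - controlTrend P M (M.X ω))) ∂P := by
    refine integral_congr_ae ?_
    filter_upwards [ae_map_X ha.g_bounds, hr.overlap] with ω g1 o1
    exact residualScore_sub_eq η ω (hκ.trans g1.1).ne' (hκ.trans o1.1).ne'
  have j12 : Integrable (fun ω => (controlTrend P M (M.X ω) - η.m (M.X ω)) *
      scaledKernel Ker h (M.D ω - d) - η.fh (M.X ω) / η.g (M.X ω) *
      (controlTrend P M (M.X ω) - η.m (M.X ω)) *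
      ({0} : Set ℝ).indicator (fun _ => (1 : ℝ)) (M.D ω)) P := j1.sub j2
  have l1 : Integrable (fun ω => (controlTrend P M (M.X ω) - η.m (M.X ω)) *
      smoothedCondDensity P M Ker h d (M.X ω)) P :=
    (integrable_of_ae_bound (hmm.comp M.measurable_X) hmb).mul_bdd
      ((measurable_smoothedCondDensity hr.kernel h d).comp M.measurable_X).aestronglyMeasurable
      (c := C) (by filter_upwards [hr.smoothed_lt] with ω hω using hω.le)
  have l2 : Integrable (fun ω => η.fh (M.X ω) / η.g (M.X ω) *
      (controlTrend P M (M.X ω) - η.m (M.X ω)) * propensity P M (M.X ω)) P :=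
    (integrable_of_ae_bound ((hfgm.mul hmm).comp M.measurable_X) hfmb).mul_bdd
      (measurable_propensity.comp M.measurable_X).aestronglyMeasurable (c := 1) (by
        filter_upwards [hr.overlap] with ω hω
        rw [Real.norm_eq_abs, abs_of_pos (hκ.trans hω.1)]
        exact hω.2)
  rw [e1, integral_sub j12 j3, integral_sub j1 j2,
    integral_control_residual hr.integrable_dY hr.integrable_trend hρm hρb, sub_zero,
    hr.integral_mul_kernel hmm hmb,
    integral_mul_control (ρ := fun x => η.fh x / η.g x * (controlTrend P M x - η.m x))
      (hfgm.mul hmm) hfmb, ← integral_sub l1 l2, ← Real.norm_eq_abs]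
  have hs : 0 < √h := Real.sqrt_pos.2 hh
  have hpt : ∀ᵐ ω ∂P, ‖(controlTrend P M (M.X ω) - η.m (M.X ω)) *
      smoothedCondDensity P M Ker h d (M.X ω) - η.fh (M.X ω) / η.g (M.X ω) *
      (controlTrend P M (M.X ω) - η.m (M.X ω)) * propensity P M (M.X ω)‖ ≤
      C / (2 * κ) * (η.g (M.X ω) - propensity P M (M.X ω)) ^ 2 +
      (C / (2 * κ) + 1 / (2 * κ * √h)) * (η.m (M.X ω) - controlTrend P M (M.X ω)) ^ 2 +
      √h / (2 * κ) * (η.fh (M.X ω) - smoothedCondDensity P M Ker h d (M.X ω)) ^ 2 := by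
    filter_upwards [ae_map_X ha.g_bounds, hr.overlap, hr.smoothed_lt] with ω g1 o1 s1
    set m := η.m (M.X ω)
    set m₀ := controlTrend P M (M.X ω)
    set f := η.fh (M.X ω)
    set f₀ := smoothedCondDensity P M Ker h d (M.X ω)
    set g := η.g (M.X ω)
    set g₀ := propensity P M (M.X ω)
    have hg0 : 0 < g := hκ.trans g1.1
    -- The bracket vanishes at the truth: every term is a product of two errors.
    have e : (m₀ - m) * f₀ - f / g * (m₀ - m) * g₀
        = (f₀ * (g - g₀) - g₀ * (f - f₀)) * (m₀ - m) / g := by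
      field_simp
      ring
    rw [e, Real.norm_eq_abs, abs_div, abs_mul, abs_of_pos hg0, abs_sub_comm m₀]
    have b1 : |f₀ * (g - g₀) - g₀ * (f - f₀)| ≤ C * |g - g₀| + |f - f₀| := by
      refine (abs_sub _ _).trans ?_
      rw [abs_mul, abs_mul, abs_of_pos (hκ.trans o1.1)]
      have h2 : g₀ * |f - f₀| ≤ 1 * |f - f₀| := by gcongr; exact o1.2
      have h3 := s1.le
      rw [one_mul] at h2
      gcongr
    have b2 : |g - g₀| * |m - m₀| ≤ ((g - g₀) ^ 2 + (m - m₀) ^ 2) / 2 := by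
      rw [← sq_abs (g - g₀), ← sq_abs (m - m₀)]
      nlinarith [sq_nonneg (|g - g₀| - |m - m₀|)]
    -- The weight $\sqrt h$ balances squared norms $\varepsilon^2/h$ and $\varepsilon^2$; both terms
    -- become $\varepsilon^2/\sqrt h$.
    have b3 : |f - f₀| * |m - m₀| ≤ (√h * (f - f₀) ^ 2 + (m - m₀) ^ 2 / √h) / 2 := by
      rw [← sq_abs (f - f₀), ← sq_abs (m - m₀)]
      have : 0 ≤ (√h * |f - f₀| - |m - m₀|) ^ 2 / √h := by positivity
      have e2 : (√h * |f - f₀| - |m - m₀|) ^ 2 / √h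
          = √h * |f - f₀| ^ 2 - 2 * (|f - f₀| * |m - m₀|) + |m - m₀| ^ 2 / √h := by
        field_simp; ring
      linarith
    calc |f₀ * (g - g₀) - g₀ * (f - f₀)| * |m - m₀| / g
        ≤ (C * |g - g₀| + |f - f₀|) * |m - m₀| / κ := by gcongr; exact g1.1.le
      _ = (C * (|g - g₀| * |m - m₀|) + |f - f₀| * |m - m₀|) / κ := by ring
      _ ≤ (C * (((g - g₀) ^ 2 + (m - m₀) ^ 2) / 2)
          + (√h * (f - f₀) ^ 2 + (m - m₀) ^ 2 / √h) / 2) / κ := by gcongr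
      _ = _ := by field_simp; ring
  have k1 := ig1.const_mul (C / (2 * κ))
  have k2 := im1.const_mul (C / (2 * κ) + 1 / (2 * κ * √h))
  have k3 := if1.const_mul (√h / (2 * κ))
  refine (norm_integral_le_of_norm_le ((k1.add k2).add k3) hpt).trans ?_
  have q := integral_add (k1.add k2) k3
  have q' := integral_add k1 k2
  simp only [Pi.add_apply] at q q' ⊢
  rw [q, q', integral_const_mul, integral_const_mul, integral_const_mul]
  have p1 := mul_le_mul_of_nonneg_left ig2 (by positivity : 0 ≤ C / (2 * κ))
  have p2 := mul_le_mul_of_nonneg_left im2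
    (by positivity : 0 ≤ C / (2 * κ) + 1 / (2 * κ * √h))
  have p3 := mul_le_mul_of_nonneg_left if2 (by positivity : 0 ≤ √h / (2 * κ))
  have p4 : √h / (2 * κ) * (ε ^ 2 / h) = 1 / (2 * κ) * (ε ^ 2 / √h) := by
    have : h = √h ^ 2 := (Real.sq_sqrt hh.le).symm
    conv_lhs => rw [this, Real.sqrt_sq hs.le]
    field_simp
  have p5 : ε ^ 2 ≤ ε ^ 2 / √h := by
    rw [le_div_iff₀ hs]
    exact mul_le_of_le_one_right (sq_nonneg _) (Real.sqrt_le_one.2 hr.h_le)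
  have p6 := mul_le_mul_of_nonneg_left p5 (by positivity : 0 ≤ C / κ)
  have p7 : C / (2 * κ) * ε ^ 2 + (C / (2 * κ) + 1 / (2 * κ * √h)) * ε ^ 2
      = C / κ * ε ^ 2 + 1 / (2 * κ) * (ε ^ 2 / √h) := by field_simp; ring
  have p8 : (C + 1) / κ * (ε ^ 2 / √h) = C / κ * (ε ^ 2 / √h) + 1 / (2 * κ) * (ε ^ 2 / √h)
      + 1 / (2 * κ) * (ε ^ 2 / √h) := by field_simp; ring
  linarith

end NuisanceBounds

/-! ### Bounds, moments and mean of the score at the true nuisance parameters. -/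

section TrueScore

variable {Ω 𝒳 : Type*} [MeasurableSpace Ω] [MeasurableSpace 𝒳] {P : Measure Ω}
  [IsProbabilityMeasure P] {M : Population Ω 𝒳} {Ker : ℝ → ℝ} {h d κ C A : ℝ}

theorem RegularAt.ae_true_ratio_le (hr : RegularAt P M Ker h d κ C A) :
    ∀ᵐ ω ∂P, |smoothedCondDensity P M Ker h d (M.X ω) / propensity P M (M.X ω)| ≤ C / κ := by
  have hκ := hr.κ_pos
  have hC := hr.C_pos
  filter_upwards [hr.overlap, hr.smoothed_lt] with ω o1 s1
  rw [abs_div, abs_of_pos (hκ.trans o1.1)]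
  have := s1.le
  have := o1.1.le
  gcongr

theorem RegularAt.ae_true_residualScore_le (hr : RegularAt P M Ker h d κ C A) :
    ∀ᵐ ω ∂P, |residualScore Ker h d (trueNuisance P M Ker h d) (M.obs ω)|
      ≤ 3 * C * (|scaledKernel Ker h (M.D ω - d)| + C / κ) := by
  have hκ := hr.κ_pos
  have hC := hr.C_pos
  filter_upwards [hr.overlap, hr.ae_true_ratio_le, hr.dY_lt, hr.trend_lt] with ω o1 r1 y1 t1
  rw [residualScore_eq (trueNuisance P M Ker h d) ω (hκ.trans o1.1).ne']
  simp only [trueNuisance]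
  rw [abs_mul, mul_comm]
  have e1 : |M.dY ω - controlTrend P M (M.X ω)| ≤ 3 * C := (abs_sub _ _).trans (by linarith)
  have e2 : |scaledKernel Ker h (M.D ω - d) - ({0} : Set ℝ).indicator (fun _ => (1 : ℝ)) (M.D ω) *
      (smoothedCondDensity P M Ker h d (M.X ω) / propensity P M (M.X ω))|
      ≤ |scaledKernel Ker h (M.D ω - d)| + C / κ := by
    refine (abs_sub _ _).trans ?_
    rw [abs_mul]
    gcongr
    calc _ ≤ 1 * (C / κ) := by gcongr; exact abs_indicator_one_le _
      _ = _ := one_mul _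
  gcongr

theorem RegularAt.ae_true_residualScore_le_const (hr : RegularAt P M Ker h d κ C A) {Bk : ℝ}
    (hBk : ∀ u, |scaledKernel Ker h u| ≤ Bk / h) :
    ∀ᵐ ω ∂P, |residualScore Ker h d (trueNuisance P M Ker h d) (M.obs ω)|
      ≤ 3 * C * (Bk + C / κ) / h := by
  have hκ := hr.κ_pos
  have hC := hr.C_pos
  have hh := hr.h_pos
  filter_upwards [hr.ae_true_residualScore_le] with ω hω
  refine hω.trans ?_
  have h1 : C / κ ≤ C / κ / h := by
    rw [le_div_iff₀ hh]
    exact mul_le_of_le_one_right (by positivity) hr.h_le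
  rw [mul_div_assoc, add_div]
  exact mul_le_mul_of_nonneg_left (add_le_add (hBk _) h1) (by positivity)

theorem measurable_true_residualScore (hK : KernelAssumption Ker) :
    Measurable (residualScore Ker h d (trueNuisance P M Ker h d)) :=
  measurable_residualScore hK h d (trueNuisance_measurable hK).1 (trueNuisance_measurable hK).2.1
    (trueNuisance_measurable hK).2.2

theorem RegularAt.kernel_sq_le (hr : RegularAt P M Ker h d κ C A) :
    Integrable (fun ω => scaledKernel Ker h (M.D ω - d) ^ 2) P ∧
      ∫ ω, scaledKernel Ker h (M.D ω - d) ^ 2 ∂P ≤ A / h := by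
  have := hr.integral_mul_kernel_sq_le (ρ := fun _ => 1) measurable_const (fun _ => zero_le_one)
    (B := 1) (ae_of_all _ fun _ => le_rfl)
  simpa using this

theorem RegularAt.true_second_moment (hr : RegularAt P M Ker h d κ C A) :
    ∫ ω, residualScore Ker h d (trueNuisance P M Ker h d) (M.obs ω) ^ 2 ∂P
      ≤ 18 * C ^ 2 * (A + (C / κ) ^ 2) / h := by
  obtain ⟨i1, i2⟩ := hr.kernel_sq_le
  have hh := hr.h_pos
  have hC := hr.C_pos
  have hκ := hr.κ_pos
  have hi : Integrable (fun ω => 18 * C ^ 2 *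
      (scaledKernel Ker h (M.D ω - d) ^ 2 + (C / κ) ^ 2)) P :=
    (i1.add (integrable_const _)).const_mul _
  refine (integral_mono_of_nonneg (ae_of_all _ fun _ => sq_nonneg _) hi ?_).trans ?_
  · filter_upwards [hr.ae_true_residualScore_le] with ω hω
    have h1 := pow_le_pow_left₀ (abs_nonneg _) hω 2
    rw [sq_abs] at h1
    refine h1.trans ?_
    rw [← sq_abs (scaledKernel Ker h (M.D ω - d))]
    set k := |scaledKernel Ker h (M.D ω - d)|
    have h2 : (k + C / κ) ^ 2 ≤ 2 * (k ^ 2 + (C / κ) ^ 2) := by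
      nlinarith [sq_nonneg (k - C / κ)]
    calc (3 * C * (k + C / κ)) ^ 2 = 9 * C ^ 2 * (k + C / κ) ^ 2 := by ring
      _ ≤ 9 * C ^ 2 * (2 * (k ^ 2 + (C / κ) ^ 2)) := by gcongr
      _ = _ := by ring
  · rw [integral_const_mul, integral_add i1 (integrable_const _), integral_const, mul_div_assoc,
      add_div]
    simp only [probReal_univ, one_smul]
    gcongr
    rw [le_div_iff₀ hh]
    exact mul_le_of_le_one_right (by positivity) hr.h_le

theorem RegularAt.integrable_kernel (hr : RegularAt P M Ker h d κ C A) :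
    Integrable (fun ω => scaledKernel Ker h (M.D ω - d)) P := by
  obtain ⟨Bk, hBk, hk⟩ := hr.kernel.exists_bound
  exact integrable_of_ae_bound (measurable_kernel_D hr.kernel)
    (ae_of_all _ fun ω => hk h hr.h_pos _)

omit [IsProbabilityMeasure P] in
theorem integrable_control_term {Y ρ : Ω → ℝ} (hY : Integrable Y P) (hρ : Measurable ρ) {B : ℝ}
    (hB : ∀ᵐ ω ∂P, |ρ ω| ≤ B) :
    Integrable (fun ω => ({0} : Set ℝ).indicator (fun _ => (1 : ℝ)) (M.D ω) * ρ ω * Y ω) P := by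
  refine hY.bdd_mul (c := B) (measurable_control_D.mul hρ).aestronglyMeasurable ?_
  filter_upwards [hB] with ω hω
  rw [Real.norm_eq_abs, abs_mul]
  exact (mul_le_of_le_one_left (abs_nonneg _) (abs_indicator_one_le _)).trans hω

theorem measurable_true_ratio (hK : KernelAssumption Ker) :
    Measurable fun x => smoothedCondDensity P M Ker h d x / propensity P M x :=
  (measurable_smoothedCondDensity hK h d).div measurable_propensity

/-- On $D=0$ the whole weight, the kernel value $K_h(-d)$ included, is a function of `X`, so the
control residual annihilates it. The atom adds no bias to the numerator. -/
theorem RegularAt.true_mean (hr : RegularAt P M Ker h d κ C A) :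
    ∫ ω, residualScore Ker h d (trueNuisance P M Ker h d) (M.obs ω) ∂P
      = ∫ ω, (M.dY ω - controlTrend P M (M.X ω)) * ({0}ᶜ : Set ℝ).indicator
          (fun s => scaledKernel Ker h (s - d)) (M.D ω) ∂P := by
  have hκ := hr.κ_pos
  obtain ⟨Bk, hBk, hk⟩ := hr.kernel.exists_bound
  set ρ : 𝒳 → ℝ := fun x => scaledKernel Ker h (0 - d) -
    smoothedCondDensity P M Ker h d x / propensity P M x with hρ
  have hρm : Measurable ρ := measurable_const.sub (measurable_true_ratio hr.kernel)
  have hρb' : ∀ᵐ ω ∂P, |ρ (M.X ω)| ≤ Bk / h + C / κ := by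
    filter_upwards [hr.ae_true_ratio_le] with ω hω
    exact (abs_sub _ _).trans (add_le_add (hk h hr.h_pos _) hω)
  have hρb : ∀ᵐ x ∂(P.map M.X), |ρ x| ≤ Bk / h + C / κ :=
    (ae_map_iff M.measurable_X.aemeasurable (measurableSet_le hρm.abs measurable_const)).2 hρb'
  have hY : Integrable (fun ω => M.dY ω - controlTrend P M (M.X ω)) P :=
    hr.integrable_dY.sub hr.integrable_trend
  have j1 : Integrable (fun ω => ({0} : Set ℝ).indicator (fun _ => (1 : ℝ)) (M.D ω) * ρ (M.X ω) *
      (M.dY ω - controlTrend P M (M.X ω))) P :=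
    integrable_control_term hY (hρm.comp M.measurable_X) hρb'
  have j2 : Integrable (fun ω => (M.dY ω - controlTrend P M (M.X ω)) * ({0}ᶜ : Set ℝ).indicator
      (fun s => scaledKernel Ker h (s - d)) (M.D ω)) P := by
    refine hY.mul_bdd (c := Bk / h) ?_ (ae_of_all _ fun ω => ?_)
    · exact ((((hr.kernel.measurable_scaled h).comp (measurable_id.sub_const d)).indicator
        (measurableSet_singleton 0).compl).comp M.measurable_D).aestronglyMeasurable
    · by_cases hs : M.D ω ∈ ({0}ᶜ : Set ℝ)
      · rw [indicator_of_mem hs]; exact hk h hr.h_pos _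
      · rw [indicator_of_notMem hs, norm_zero]; exact div_nonneg hBk.le hr.h_pos.le
  have e : ∀ᵐ ω ∂P, residualScore Ker h d (trueNuisance P M Ker h d) (M.obs ω)
      = (M.dY ω - controlTrend P M (M.X ω)) * ({0}ᶜ : Set ℝ).indicator
          (fun s => scaledKernel Ker h (s - d)) (M.D ω)
        + ({0} : Set ℝ).indicator (fun _ => (1 : ℝ)) (M.D ω) * ρ (M.X ω) *
          (M.dY ω - controlTrend P M (M.X ω)) := by
    filter_upwards [hr.overlap] with ω o1
    rw [residualScore_eq (trueNuisance P M Ker h d) ω (hκ.trans o1.1).ne']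
    simp only [trueNuisance, hρ]
    by_cases h0 : M.D ω = 0
    · simp [h0]
    · simp [h0, mul_comm]
  rw [integral_congr_ae e, integral_add j2 j1,
    integral_control_residual hr.integrable_dY hr.integrable_trend hρm hρb, add_zero]

/-- The weight balances covariates, $E[\mathcal E^0(X)w]=0$. Hence `ATTh`, defined with `ΔY` alone,
has the same value with the residual in its place. -/
theorem RegularAt.ATTh_eq (hr : RegularAt P M Ker h d κ C A) (f : ℝ) :
    ATTh P M Ker h d f
      = (∫ ω, residualScore Ker h d (trueNuisance P M Ker h d) (M.obs ω) ∂P) / f := by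
  have hκ := hr.κ_pos
  obtain ⟨Bk, hBk, hk⟩ := hr.kernel.exists_bound
  have hm : Measurable fun ω => weight Ker h d 1 (trueNuisance P M Ker h d) (M.obs ω) := by
    obtain ⟨m1, m2, -⟩ := trueNuisance_measurable (P := P) (M := M) (h := h) (d := d) hr.kernel
    have hkm := hr.kernel.measurable_scaled h
    have hi : Measurable (({0} : Set ℝ).indicator (fun _ => (1 : ℝ))) :=
      measurable_const.indicator (measurableSet_singleton 0)
    have hD := M.measurable_D
    have hX := M.measurable_X
    change Measurable fun ω => (scaledKernel Ker h (M.D ω - d) * (trueNuisance P M Ker h d).g (M.X ω)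
      - ({0} : Set ℝ).indicator (fun _ => (1 : ℝ)) (M.D ω) * (trueNuisance P M Ker h d).fh (M.X ω))
        / (1 * (trueNuisance P M Ker h d).g (M.X ω))
    fun_prop
  have hweq : ∀ᵐ ω ∂P, weight Ker h d 1 (trueNuisance P M Ker h d) (M.obs ω)
      = scaledKernel Ker h (M.D ω - d) - ({0} : Set ℝ).indicator (fun _ => (1 : ℝ)) (M.D ω) *
        (smoothedCondDensity P M Ker h d (M.X ω) / propensity P M (M.X ω)) := by
    filter_upwards [hr.overlap] with ω o1
    have hg : propensity P M (M.X ω) ≠ 0 := (hκ.trans o1.1).ne'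
    change (scaledKernel Ker h (M.D ω - d) * propensity P M (M.X ω)
      - ({0} : Set ℝ).indicator (fun _ => (1 : ℝ)) (M.D ω) * smoothedCondDensity P M Ker h d (M.X ω))
        / (1 * propensity P M (M.X ω)) = _
    rw [one_mul, sub_div, mul_div_assoc, div_self hg, mul_one, mul_div_assoc]
  have hwb : ∀ᵐ ω ∂P, |weight Ker h d 1 (trueNuisance P M Ker h d) (M.obs ω)|
      ≤ Bk / h + C / κ := by
    filter_upwards [hweq, hr.ae_true_ratio_le] with ω e r1
    rw [e]
    refine (abs_sub _ _).trans (add_le_add (hk h hr.h_pos _) ?_)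
    rw [abs_mul]
    exact (mul_le_of_le_one_left (abs_nonneg _) (abs_indicator_one_le _)).trans r1
  have hYw : Integrable (fun ω => M.dY ω * weight Ker h d 1 (trueNuisance P M Ker h d) (M.obs ω)) P :=
    hr.integrable_dY.mul_bdd hm.aestronglyMeasurable hwb
  have htw : Integrable (fun ω => controlTrend P M (M.X ω) *
      weight Ker h d 1 (trueNuisance P M Ker h d) (M.obs ω)) P :=
    hr.integrable_trend.mul_bdd hm.aestronglyMeasurable hwb
  have htb : ∀ᵐ ω ∂P, |controlTrend P M (M.X ω)| ≤ C := by
    filter_upwards [hr.trend_lt] with ω hω using hω.le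
  have hrb : ∀ᵐ ω ∂P, |controlTrend P M (M.X ω) *
      (smoothedCondDensity P M Ker h d (M.X ω) / propensity P M (M.X ω))| ≤ C * (C / κ) := by
    filter_upwards [htb, hr.ae_true_ratio_le] with ω e1 e2
    rw [abs_mul]
    have := hr.C_pos
    gcongr
  have hrm : Measurable fun x => controlTrend P M x *
      (smoothedCondDensity P M Ker h d x / propensity P M x) :=
    measurable_controlTrend.mul (measurable_true_ratio hr.kernel)
  have hzero : ∫ ω, controlTrend P M (M.X ω) *
      weight Ker h d 1 (trueNuisance P M Ker h d) (M.obs ω) ∂P = 0 := by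
    have e : ∀ᵐ ω ∂P, controlTrend P M (M.X ω) *
        weight Ker h d 1 (trueNuisance P M Ker h d) (M.obs ω)
        = controlTrend P M (M.X ω) * scaledKernel Ker h (M.D ω - d)
          - controlTrend P M (M.X ω) *
            (smoothedCondDensity P M Ker h d (M.X ω) / propensity P M (M.X ω)) *
            ({0} : Set ℝ).indicator (fun _ => (1 : ℝ)) (M.D ω) := by
      filter_upwards [hweq] with ω e
      rw [e]; ring
    have k1 : Integrable (fun ω => controlTrend P M (M.X ω) *
        scaledKernel Ker h (M.D ω - d)) P :=
      hr.integrable_trend.mul_bdd (measurable_kernel_D hr.kernel).aestronglyMeasurable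
        (c := Bk / h) (ae_of_all _ fun ω => hk h hr.h_pos _)
    have k2 : Integrable (fun ω => controlTrend P M (M.X ω) *
        (smoothedCondDensity P M Ker h d (M.X ω) / propensity P M (M.X ω)) *
        ({0} : Set ℝ).indicator (fun _ => (1 : ℝ)) (M.D ω)) P :=
      (integrable_of_ae_bound (hrm.comp M.measurable_X) hrb).mul_bdd
        measurable_control_D.aestronglyMeasurable (c := 1)
        (ae_of_all _ fun ω => abs_indicator_one_le _)
    rw [integral_congr_ae e, integral_sub k1 k2,
      hr.integral_mul_kernel measurable_controlTrend htb,
      integral_mul_control (ρ := fun x => controlTrend P M x *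
        (smoothedCondDensity P M Ker h d x / propensity P M x)) hrm hrb, sub_eq_zero]
    refine integral_congr_ae ?_
    filter_upwards [hr.overlap] with ω o1
    have hg : propensity P M (M.X ω) ≠ 0 := (hκ.trans o1.1).ne'
    field_simp
  have e1 : ∀ ω, M.dY ω * weight Ker h d f (trueNuisance P M Ker h d) (M.obs ω)
      = (M.dY ω * weight Ker h d 1 (trueNuisance P M Ker h d) (M.obs ω)) / f := fun ω => by
    rw [weight_eq_div, mul_div_assoc]
  have e2 : ∀ ω, residualScore Ker h d (trueNuisance P M Ker h d) (M.obs ω)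
      = M.dY ω * weight Ker h d 1 (trueNuisance P M Ker h d) (M.obs ω)
        - controlTrend P M (M.X ω) * weight Ker h d 1 (trueNuisance P M Ker h d) (M.obs ω) :=
    fun ω => by
      change weight Ker h d 1 (trueNuisance P M Ker h d) (M.obs ω) *
        (M.dY ω - controlTrend P M (M.X ω)) = _
      ring
  simp only [ATTh, e1, e2]
  rw [integral_div, integral_sub hYw htw, hzero, sub_zero]

/-- The two integrands differ only on the atom, where the kernel equals $K_h(-d)$. -/
theorem RegularAt.kernel_mean (hr : RegularAt P M Ker h d κ C A) :
    |(∫ ω, scaledKernel Ker h (M.D ω - d) ∂P) - ∫ ω, 1 * ({0}ᶜ : Set ℝ).indicator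
      (fun s => scaledKernel Ker h (s - d)) (M.D ω) ∂P| ≤ |scaledKernel Ker h (0 - d)| := by
  obtain ⟨Bk, hBk, hk⟩ := hr.kernel.exists_bound
  have j2 : Integrable (fun ω => 1 * ({0}ᶜ : Set ℝ).indicator
      (fun s => scaledKernel Ker h (s - d)) (M.D ω)) P := by
    refine (integrable_const (1 : ℝ)).mul_bdd (c := Bk / h) ?_ (ae_of_all _ fun ω => ?_)
    · exact ((((hr.kernel.measurable_scaled h).comp (measurable_id.sub_const d)).indicator
        (measurableSet_singleton 0).compl).comp M.measurable_D).aestronglyMeasurable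
    · by_cases hs : M.D ω ∈ ({0}ᶜ : Set ℝ)
      · rw [indicator_of_mem hs]; exact hk h hr.h_pos _
      · rw [indicator_of_notMem hs, norm_zero]; exact div_nonneg hBk.le hr.h_pos.le
  rw [← integral_sub hr.integrable_kernel j2, ← Real.norm_eq_abs]
  refine (norm_integral_le_of_norm_le (integrable_const |scaledKernel Ker h (0 - d)|)
    (ae_of_all _ fun ω => ?_)).trans (by simp)
  by_cases h0 : M.D ω = 0
  · simp [h0]
  · simp [h0]

omit [MeasurableSpace 𝒳] in
theorem score_eq (θ f : ℝ) (η : Nuisance 𝒳) (z : Obs 𝒳) :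
    score Ker h d θ f η z = residualScore Ker h d η z / f - θ := by
  rw [score, residualScore, weight_eq_div, div_mul_eq_mul_div]

end TrueScore

/-! ### Chebyshev bounds, independence of folds, measurability of accuracy. -/

section Sampling

variable {Ω' E : Type*} [MeasurableSpace Ω'] [MeasurableSpace E]

/-- Chebyshev's inequality for a sum of functions of an i.i.d. family. -/
theorem measure_sum_sub_ge_le {Q : Measure Ω'} [IsProbabilityMeasure Q] {μ : Measure E}
    {ι : Type*} {Z : ι → Ω' → E} (hZ : ∀ i, AEMeasurable (Z i) Q)
    (hlaw : ∀ i, Q.map (Z i) = μ) (hind : iIndepFun Z Q) (s : Finset ι) {f : E → ℝ}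
    (hf : Measurable f) (hf2 : MemLp f 2 μ) {c : ℝ} (hc : 0 < c) :
    Q {ω | c ≤ |∑ i ∈ s, f (Z i ω) - s.card * ∫ z, f z ∂μ|}
      ≤ ENNReal.ofReal (s.card * (∫ z, f z ^ 2 ∂μ) / c ^ 2) := by
  have hmem : ∀ i, MemLp (fun ω => f (Z i ω)) 2 Q := fun i => by
    have := hf2
    rw [← hlaw i] at this
    exact (memLp_map_measure_iff hf.aestronglyMeasurable (hZ i)).1 this
  have hint : ∀ i, ∫ ω, f (Z i ω) ∂Q = ∫ z, f z ∂μ := fun i => by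
    rw [← hlaw i, integral_map (hZ i) hf.aestronglyMeasurable]
  have hint2 : ∀ i, ∫ ω, f (Z i ω) ^ 2 ∂Q = ∫ z, f z ^ 2 ∂μ := fun i => by
    rw [← hlaw i, integral_map (hZ i) (hf.pow_const 2).aestronglyMeasurable]
  have hsum : MemLp (∑ i ∈ s, fun ω => f (Z i ω)) 2 Q := memLp_finsetSum' s fun i _ => hmem i
  have hmean : Q[∑ i ∈ s, fun ω => f (Z i ω)] = s.card * ∫ z, f z ∂μ := by
    simp only [Finset.sum_apply]
    rw [integral_finsetSum s fun i _ => (hmem i).integrable (by norm_num)]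
    simp [hint]
  have hvar : variance (∑ i ∈ s, fun ω => f (Z i ω)) Q ≤ s.card * ∫ z, f z ^ 2 ∂μ := by
    rw [IndepFun.variance_sum (fun i _ => hmem i) (fun i _ j _ hij =>
      (hind.indepFun hij).comp hf hf)]
    calc ∑ i ∈ s, variance (fun ω => f (Z i ω)) Q ≤ ∑ _i ∈ s, ∫ z, f z ^ 2 ∂μ :=
          Finset.sum_le_sum fun i _ => by
            refine (variance_le_expectation_sq (hmem i).aestronglyMeasurable).trans (le_of_eq ?_)
            rw [← hint2 i]
            rfl
      _ = _ := by simp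
  have := meas_ge_le_variance_div_sq hsum hc
  rw [hmean] at this
  simp only [Finset.sum_apply] at this
  refine this.trans (ENNReal.ofReal_le_ofReal ?_)
  gcongr

/-- Chebyshev's inequality conditional on an independent auxiliary variable `v` that determines
the summand. -/
theorem measure_sum_ge_le_of_indep {Q : Measure Ω'} [IsProbabilityMeasure Q] {μ : Measure E}
    [IsProbabilityMeasure μ] {ι β : Type*} [Fintype ι] [MeasurableSpace β] {u : Ω' → ι → E}
    {v : Ω' → β} (hu : AEMeasurable u Q) (hv : AEMeasurable v Q)
    (hlaw : Q.map u = Measure.pi fun _ => μ) (hind : IndepFun u v Q) {F : β → E → ℝ}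
    (hF : Measurable (Function.uncurry F)) {G : Set β} (hG : MeasurableSet G) {a b c : ℝ}
    (hL2 : ∀ y ∈ G, MemLp (F y) 2 μ) (ha : ∀ y ∈ G, |∫ z, F y z ∂μ| ≤ a)
    (hb : ∀ y ∈ G, ∫ z, F y z ^ 2 ∂μ ≤ b) (hc : Fintype.card ι * a < c) :
    Q {ω | c ≤ |∑ i, F (v ω) (u ω i)|}
      ≤ Q {ω | v ω ∉ G} + ENNReal.ofReal (Fintype.card ι * b / (c - Fintype.card ι * a) ^ 2) := by
  set R := ENNReal.ofReal (Fintype.card ι * b / (c - Fintype.card ι * a) ^ 2)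
  set Bad : Set (β × (ι → E)) := {p | p.1 ∈ G ∧ c ≤ |∑ i, F p.1 (p.2 i)|} with hBad
  have hsm : Measurable fun p : β × (ι → E) => ∑ i, F p.1 (p.2 i) := by
    refine Finset.measurable_sum _ fun i _ => ?_
    exact hF.comp (measurable_fst.prodMk ((measurable_pi_apply i).comp measurable_snd))
  have hBadm : MeasurableSet Bad :=
    (measurable_fst hG).inter (measurableSet_le measurable_const hsm.abs)
  have h1 : Q {ω | c ≤ |∑ i, F (v ω) (u ω i)|} ≤ Q {ω | v ω ∉ G} + Q {ω | (v ω, u ω) ∈ Bad} := by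
    refine (measure_mono fun ω hω => ?_).trans (measure_union_le _ _)
    by_cases hvG : v ω ∈ G
    · exact Or.inr ⟨hvG, hω⟩
    · exact Or.inl hvG
  refine h1.trans (add_le_add_right ?_ _)
  -- Independence makes the joint law a product, so `v` can be frozen: for each $y\in G$ the
  -- unconditional inequality applies to `F y`, and for $y\notin G$ the section of `Bad` is empty.
  have h2 : Q {ω | (v ω, u ω) ∈ Bad} = (Q.map v).prod (Q.map u) Bad := by
    rw [← hind.symm.map_prod_eq_prod_map_map hv hu,
      Measure.map_apply_of_aemeasurable (hv.prodMk hu) hBadm]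
    rfl
  have := Measure.isProbabilityMeasure_map hv
  rw [h2, hlaw, Measure.prod_apply hBadm]
  calc ∫⁻ y, (Measure.pi fun _ => μ) (Prod.mk y ⁻¹' Bad) ∂(Q.map v) ≤ ∫⁻ _, R ∂(Q.map v) := by
        refine lintegral_mono fun y => ?_
        by_cases hy : y ∈ G
        · have hF' : Measurable (F y) := hF.comp measurable_prodMk_left
          have hch := measure_sum_sub_ge_le (Q := Measure.pi fun _ : ι => μ)
            (Z := fun i (w : ι → E) => w i) (fun i => (measurable_pi_apply i).aemeasurable)
            (fun i => (measurePreserving_eval (fun _ => μ) i).map_eq)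
            (iIndepFun_pi (X := fun _ => id) fun _ => aemeasurable_id)
            Finset.univ hF' (hL2 y hy) (sub_pos.2 hc)
          rw [Finset.card_univ] at hch
          refine (measure_mono fun w hw => ?_).trans (hch.trans (ENNReal.ofReal_le_ofReal ?_))
          · have hw2 : c ≤ |∑ i, F y (w i)| := hw.2
            have h3 : |∑ i, F y (w i)| ≤ |∑ i, F y (w i) - Fintype.card ι * ∫ z, F y z ∂μ|
                + |Fintype.card ι * ∫ z, F y z ∂μ| := by
              have := abs_add_le (∑ i, F y (w i) - Fintype.card ι * ∫ z, F y z ∂μ)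
                (Fintype.card ι * ∫ z, F y z ∂μ)
              rwa [sub_add_cancel] at this
            have h4 : |Fintype.card ι * ∫ z, F y z ∂μ| ≤ Fintype.card ι * a := by
              rw [abs_mul, Nat.abs_cast]
              gcongr
              exact ha y hy
            change c - Fintype.card ι * a ≤ _
            linarith
          · gcongr
            exact hb y hy
        · have : Prod.mk y ⁻¹' Bad = ∅ := by
            ext w; simp [hBad, hy]
          rw [this, measure_empty]
          exact zero_le
    _ = R := by simp

/-- The law of `((u, v), ξ)` is a triple product; reassociating it separates `u` from `(v, ξ)`. This
adds the seed of the learners to the data outside the fold. -/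
theorem indepFun_prodMk_of_indep_pair {α β γ : Type*} [MeasurableSpace α] [MeasurableSpace β]
    [MeasurableSpace γ] {Q : Measure Ω'} [IsProbabilityMeasure Q] {u : Ω' → α} {v : Ω' → β}
    {ξ : Ω' → γ} (hu : AEMeasurable u Q) (hv : AEMeasurable v Q) (hξ : AEMeasurable ξ Q)
    (huv : IndepFun u v Q) (h : IndepFun (fun ω => (u ω, v ω)) ξ Q) :
    IndepFun u (fun ω => (v ω, ξ ω)) Q := by
  have := Measure.isProbabilityMeasure_map hu
  have := Measure.isProbabilityMeasure_map hv
  have := Measure.isProbabilityMeasure_map hξ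
  have hvξ : IndepFun v ξ Q := h.comp (φ := Prod.snd) (ψ := id) measurable_snd measurable_id
  rw [indepFun_iff_map_prod_eq_prod_map_map hu (hv.prodMk hξ),
    hvξ.map_prod_eq_prod_map_map hv hξ]
  have h1 := h.map_prod_eq_prod_map_map (hu.prodMk hv) hξ
  rw [huv.map_prod_eq_prod_map_map hu hv] at h1
  have h2 := congrArg (Measure.map MeasurableEquiv.prodAssoc) h1
  rw [Measure.prodAssoc_prod, AEMeasurable.map_map_of_aemeasurable
    MeasurableEquiv.prodAssoc.measurable.aemeasurable ((hu.prodMk hv).prodMk hξ)] at h2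
  exact h2

theorem measurableSet_ae {β T : Type*} [MeasurableSpace β] [MeasurableSpace T] {ν : Measure T}
    [SFinite ν] {A : Set (β × T)} (hA : MeasurableSet A) :
    MeasurableSet {y | ∀ᵐ x ∂ν, (y, x) ∈ A} := by
  have h1 : {y | ∀ᵐ x ∂ν, (y, x) ∈ A} = (fun y => ν (Prod.mk y ⁻¹' Aᶜ)) ⁻¹' {0} := by
    ext y
    simp only [mem_ofPred_eq, ae_iff, mem_preimage, mem_singleton_iff]
    rfl
  rw [h1]
  exact measurable_measure_prodMk_left hA.compl (measurableSet_singleton 0)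

theorem measurable_eLpNorm_two {β T : Type*} [MeasurableSpace β] [MeasurableSpace T]
    {ν : Measure T} [SFinite ν] {f : β × T → ℝ} (hf : Measurable f) :
    Measurable fun y => eLpNorm (fun x => f (y, x)) 2 ν := by
  simp only [eLpNorm_eq_lintegral_rpow_enorm_toReal (p := 2) (by norm_num) (by norm_num)]
  exact ((hf.enorm.pow_const _).lintegral_prod_right').pow_const _

variable {Ω 𝒳 S : Type*} [MeasurableSpace Ω] [MeasurableSpace 𝒳] [MeasurableSpace S]

/-- Needed to condition on accurate auxiliary data. Each clause is an $L^2$ norm or an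
almost-everywhere statement over `X`, and both depend measurably on the parameter by Tonelli. -/
theorem measurableSet_isAccurate {P : Measure Ω} [IsProbabilityMeasure P] {M : Population Ω 𝒳}
    {Ker : ℝ → ℝ} (hK : KernelAssumption Ker) {h d ε κ c C : ℝ} {K : ℕ} {I : Folds K}
    (L : Learner I 𝒳 S) (n : ℕ) (k : Fin K) :
    MeasurableSet {v : (I.Aux n k → Obs 𝒳) × S |
      IsAccurate P M Ker h d ε κ c C (L.fit n k v.1 v.2)} := by
  have := Measure.isProbabilityMeasure_map (μ := P) M.measurable_X.aemeasurable
  have m1 := L.measurable_fh n k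
  have m2 := L.measurable_g n k
  have m3 := L.measurable_m n k
  have s1 : Measurable fun p : ((I.Aux n k → Obs 𝒳) × S) × 𝒳 =>
      smoothedCondDensity P M Ker h d p.2 :=
    (measurable_smoothedCondDensity hK h d).comp measurable_snd
  have s2 : Measurable fun p : ((I.Aux n k → Obs 𝒳) × S) × 𝒳 => propensity P M p.2 :=
    measurable_propensity.comp measurable_snd
  have s3 : Measurable fun p : ((I.Aux n k → Obs 𝒳) × S) × 𝒳 => controlTrend P M p.2 :=
    measurable_controlTrend.comp measurable_snd
  have r1 := measurableSet_le (measurable_eLpNorm_two (ν := P.map M.X) (m1.sub s1))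
    (measurable_const (a := ENNReal.ofReal ((√h)⁻¹ * ε)))
  have r2 := measurableSet_le (measurable_eLpNorm_two (ν := P.map M.X) (m2.sub s2))
    (measurable_const (a := ENNReal.ofReal ε))
  have r3 := measurableSet_le (measurable_eLpNorm_two (ν := P.map M.X) (m3.sub s3))
    (measurable_const (a := ENNReal.ofReal ε))
  have r4 := measurableSet_ae (ν := P.map M.X)
    ((measurableSet_lt (measurable_const (a := κ)) m2).inter
      (measurableSet_lt m2 (measurable_const (a := 1 - κ))))
  have r5 := measurableSet_ae (ν := P.map M.X)
    ((measurableSet_lt (measurable_const (a := c)) m1).inter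
      (measurableSet_lt m1 (measurable_const (a := C))))
  have r6 := measurableSet_ae (ν := P.map M.X)
    (measurableSet_le m3.abs (measurable_const (a := C)))
  convert! ((((r1.inter r2).inter r3).inter r4).inter r5).inter r6 using 1
  ext v
  exact ⟨fun hv => ⟨⟨⟨⟨⟨hv.1, hv.2⟩, hv.3⟩, hv.4⟩, hv.5⟩, hv.6⟩,
    fun hv => ⟨hv.1.1.1.1.1, hv.1.1.1.1.2, hv.1.1.1.2, hv.1.1.2, hv.1.2, hv.2⟩⟩

section Panel

variable {P : Measure Ω} [IsProbabilityMeasure P] {M : Population Ω 𝒳} {Q : Measure Ω'}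
  [IsProbabilityMeasure Q] {Z : ℕ → Ω' → Obs 𝒳} {ξ : Ω' → S} {K : ℕ}

omit [IsProbabilityMeasure P] [IsProbabilityMeasure Q] in
theorem PanelSample.aemeasurable (hs : PanelSample P M Q Z ξ) (i : ℕ) : AEMeasurable (Z i) Q :=
  (hs.ident i).aemeasurable_fst

omit [IsProbabilityMeasure P] [IsProbabilityMeasure Q] in
theorem PanelSample.law (hs : PanelSample P M Q Z ξ) (i : ℕ) : Q.map (Z i) = P.map M.obs :=
  (hs.ident i).map_eq

omit [IsProbabilityMeasure P] in
theorem PanelSample.fold_law (hs : PanelSample P M Q Z ξ) (I : Folds K) (n : ℕ) (k : Fin K) :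
    Q.map (fun ω (i : {i : Fin (K * n) // I.fold n i = k}) => Z i.1 ω)
      = Measure.pi fun _ => P.map M.obs := by
  have hi : iIndepFun (fun (i : {i : Fin (K * n) // I.fold n i = k}) ω => Z i.1 ω) Q :=
    hs.indep.precomp (g := fun i : {i : Fin (K * n) // I.fold n i = k} => (i.1 : ℕ))
      (Fin.val_injective.comp Subtype.val_injective)
  rw [iIndepFun_iff_map_fun_eq_pi_map fun i => hs.aemeasurable _] at hi
  rw [hi]
  simp only [hs.law]

omit [IsProbabilityMeasure P] in
/-- The data of a fold are independent of the nuisance estimates used on it. -/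
theorem PanelSample.indepFun_fold_aux (hs : PanelSample P M Q Z ξ) (I : Folds K) (n : ℕ)
    (k : Fin K) :
    IndepFun (fun ω (i : {i : Fin (K * n) // I.fold n i = k}) => Z i.1 ω)
      (fun ω => ((fun i : I.Aux n k => Z i.1 ω), ξ ω)) Q := by
  classical
  have hind : iIndepFun (fun (i : Fin (K * n)) => Z i) Q := hs.indep.precomp Fin.val_injective
  have hdisj : Disjoint (Finset.univ.filter fun i => I.fold n i = k)
      (Finset.univ.filter fun i => I.fold n i ≠ k) := by
    rw [Finset.disjoint_filter]
    exact fun i _ h1 h2 => h2 h1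
  have h1 := hind.indepFun_finset₀ _ _ hdisj fun i => hs.aemeasurable _
  have h2 : IndepFun (fun ω (i : {i : Fin (K * n) // I.fold n i = k}) => Z i.1 ω)
      (fun ω (i : I.Aux n k) => Z i.1 ω) Q :=
    h1.comp (φ := fun w (i : {i : Fin (K * n) // I.fold n i = k}) =>
        w ⟨i.1, by simp [i.2]⟩)
      (ψ := fun w (i : I.Aux n k) => w ⟨i.1, by simp [i.2]⟩)
      (measurable_pi_lambda _ fun i => measurable_pi_apply _)
      (measurable_pi_lambda _ fun i => measurable_pi_apply _)
  refine indepFun_prodMk_of_indep_pair (aemeasurable_pi_lambda _ fun i => hs.aemeasurable _)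
    (aemeasurable_pi_lambda _ fun i => hs.aemeasurable _) hs.measurable_seed.aemeasurable h2 ?_
  refine hs.indep_seed.symm.comp (φ := fun w : ℕ → Obs 𝒳 =>
    ((fun i : {i : Fin (K * n) // I.fold n i = k} => w i.1), fun i : I.Aux n k => w i.1))
    (ψ := id) ?_ measurable_id
  exact (measurable_pi_lambda _ fun i => measurable_pi_apply _).prodMk
    (measurable_pi_lambda _ fun i => measurable_pi_apply _)

end Panel

end Sampling

/-! ### Negligible terms: sample means, nuisance replacement, linearization of the ratio. -/

section Assembly

variable {Ω Ω' 𝒳 S : Type*} [MeasurableSpace Ω] [MeasurableSpace Ω'] [MeasurableSpace 𝒳]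
  [MeasurableSpace S]

/-- Convergence to zero in probability. -/
def ToZero (Q : Measure Ω') (X : ℕ → Ω' → ℝ) : Prop :=
  ∀ e > 0, Tendsto (fun n => Q {ω | e ≤ |X n ω|}) atTop (𝓝 0)

/-- If `R` is small whenever finitely many `X j` are, and all `X j` vanish in probability, then so
does `R`. -/
theorem ToZero.of_forall {Q : Measure Ω'} {J : Type*} [Fintype J] {X : J → ℕ → Ω' → ℝ}
    (hX : ∀ j, ToZero Q (X j)) {R : ℕ → Ω' → ℝ}
    (h : ∀ e > 0, ∃ δ > 0, ∀ᶠ n in atTop, ∀ ω, (∀ j, |X j n ω| < δ) → |R n ω| < e) :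
    ToZero Q R := by
  intro e he
  obtain ⟨δ, hδ, H⟩ := h e he
  have hlim : Tendsto (fun n => ∑ j, Q {ω | δ ≤ |X j n ω|}) atTop (𝓝 0) := by
    have := tendsto_finsetSum Finset.univ fun j _ => hX j δ hδ
    simpa using this
  refine tendsto_of_tendsto_of_tendsto_of_le_of_le' tendsto_const_nhds hlim
    (Eventually.of_forall fun _ => zero_le) ?_
  filter_upwards [H] with n hn
  refine (measure_mono fun ω hω => ?_).trans (measure_iUnion_fintype_le Q fun j => {ω | δ ≤ |X j n ω|})
  rw [mem_iUnion]
  by_contra hc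
  push Not at hc
  have := hn ω fun j => not_le.1 (hc j)
  exact absurd hω (not_le.2 this)

theorem ToZero.tendstoInMeasure {Q : Measure Ω'} {X : ℕ → Ω' → ℝ} (h : ToZero Q X) :
    TendstoInMeasure Q X atTop fun _ => 0 := by
  rw [tendstoInMeasure_iff_norm]
  intro e he
  simpa using h e he

theorem sum_fold {K n : ℕ} (I : Folds K) (a : Fin (K * n) → ℝ) :
    ∑ k : Fin K, ∑ i with I.fold n i = k, a i = ∑ i, a i :=
  Finset.sum_fiberwise _ _ _

/-- Each index lies outside all but one of the `K` folds. -/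
theorem sum_fold_compl {K n : ℕ} (I : Folds K) (a : Fin (K * n) → ℝ) :
    ∑ k : Fin K, ∑ i with I.fold n i ≠ k, a i = ((K : ℝ) - 1) * ∑ i, a i := by
  have h1 : ∀ k : Fin K, ∑ i with I.fold n i ≠ k, a i
      = ∑ i, a i - ∑ i with I.fold n i = k, a i := fun k => by
    rw [← Finset.sum_filter_add_sum_filter_not Finset.univ (fun i => I.fold n i = k) a]
    ring
  simp only [h1]
  rw [Finset.sum_sub_distrib, sum_fold]
  simp
  ring

theorem card_fold_compl {K n : ℕ} (I : Folds K) (k : Fin K) :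
    ((Finset.univ.filter fun i => I.fold n i ≠ k).card : ℝ) = (K : ℝ) * n - n := by
  have h := Finset.card_filter_add_card_filter_not (s := (Finset.univ : Finset (Fin (K * n))))
    (fun i => I.fold n i = k)
  rw [I.card_eq n k, Finset.card_univ, Fintype.card_fin] at h
  have h' : ((n + (Finset.univ.filter fun i => ¬ I.fold n i = k).card : ℕ) : ℝ)
      = ((K * n : ℕ) : ℝ) := congrArg _ h
  push_cast at h'
  linarith

omit [MeasurableSpace Ω'] in
-- Displays the fold estimate as the ratio to be linearized.
theorem foldEstimator_eq {K : ℕ} {I : Folds K} (L : Learner I 𝒳 S) (Ker : ℝ → ℝ) (h d : ℝ)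
    (Z : ℕ → Ω' → Obs 𝒳) (ξ : Ω' → S) (n : ℕ) (k : Fin K) (ω : Ω') :
    foldEstimator L Ker h d Z ξ n k ω
      = (∑ i with I.fold n i = k, residualScore Ker h d (fittedNuisance L Z ξ n k ω) (Z i ω)) / n
        / fittedDensity I Ker h d Z n k ω := by
  have h1 : ∀ i, weight Ker h d (fittedDensity I Ker h d Z n k ω) (fittedNuisance L Z ξ n k ω)
      (Z i ω) * ((Z i ω).dY - (fittedNuisance L Z ξ n k ω).m (Z i ω).cov)
      = residualScore Ker h d (fittedNuisance L Z ξ n k ω) (Z i ω)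
        / fittedDensity I Ker h d Z n k ω := fun i => by
    rw [weight_eq_div, residualScore, div_mul_eq_mul_div]
  simp only [foldEstimator, h1]
  rw [← Finset.sum_div, div_right_comm]

theorem measurable_uncurry_residualScore {Ker : ℝ → ℝ} (hK : KernelAssumption Ker) (h d : ℝ)
    {K : ℕ} {I : Folds K} (L : Learner I 𝒳 S) (n : ℕ) (k : Fin K) :
    Measurable fun p : ((I.Aux n k → Obs 𝒳) × S) × Obs 𝒳 =>
      residualScore Ker h d (L.fit n k p.1.1 p.1.2) p.2 := by
  have hk := hK.measurable_scaled h
  have hi : Measurable (({0} : Set ℝ).indicator (fun _ => (1 : ℝ))) :=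
    measurable_const.indicator (measurableSet_singleton 0)
  have hX : Measurable fun p : ((I.Aux n k → Obs 𝒳) × S) × Obs 𝒳 => (p.1, p.2.2.2.2) := by
    fun_prop
  have m1 := (L.measurable_fh n k).comp hX
  have m2 := (L.measurable_g n k).comp hX
  have m3 := (L.measurable_m n k).comp hX
  simp only [Function.comp_def] at m1 m2 m3
  unfold residualScore weight Obs.dY Obs.trt Obs.cov
  fun_prop

section Panel

variable {P : Measure Ω} [IsProbabilityMeasure P] {M : Population Ω 𝒳} {Q : Measure Ω'}
  [IsProbabilityMeasure Q] {Z : ℕ → Ω' → Obs 𝒳} {ξ : Ω' → S} {K : ℕ}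

omit [IsProbabilityMeasure P] [IsProbabilityMeasure Q] in
theorem PanelSample.aemeasurable_aux (hs : PanelSample P M Q Z ξ) (I : Folds K) (n : ℕ)
    (k : Fin K) : AEMeasurable (fun ω => ((fun i : I.Aux n k => Z i.1 ω), ξ ω)) Q :=
  (aemeasurable_pi_lambda _ fun _ => hs.aemeasurable _).prodMk hs.measurable_seed.aemeasurable

omit [IsProbabilityMeasure P] [IsProbabilityMeasure Q] in
theorem PanelSample.aemeasurable_density (hs : PanelSample P M Q Z ξ) (I : Folds K)
    {Ker : ℝ → ℝ} (hK : KernelAssumption Ker) (h d : ℝ) (n : ℕ) (k : Fin K) :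
    AEMeasurable (fittedDensity I Ker h d Z n k) Q := by
  refine (Finset.aemeasurable_fun_sum _ fun i _ => ?_).div_const _
  have hk := hK.measurable_scaled h
  have : Measurable fun z : Obs 𝒳 => scaledKernel Ker h (z.trt - d) := by
    unfold Obs.trt; fun_prop
  exact this.comp_aemeasurable (hs.aemeasurable _)

omit [IsProbabilityMeasure P] [IsProbabilityMeasure Q] in
theorem PanelSample.aemeasurable_residualScore (hs : PanelSample P M Q Z ξ) {I : Folds K}
    (L : Learner I 𝒳 S) {Ker : ℝ → ℝ} (hK : KernelAssumption Ker) (h d : ℝ) (n : ℕ)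
    (k : Fin K) (i : Fin (K * n)) :
    AEMeasurable (fun ω => residualScore Ker h d (fittedNuisance L Z ξ n k ω) (Z i ω)) Q := by
  have h1 : AEMeasurable (fun ω => (((fun j : I.Aux n k => Z j.1 ω), ξ ω), Z i ω)) Q :=
    (hs.aemeasurable_aux I n k).prodMk (hs.aemeasurable i)
  have h2 := (measurable_uncurry_residualScore hK h d L n k).comp_aemeasurable h1
  exact h2

omit [IsProbabilityMeasure P] [IsProbabilityMeasure Q] in
theorem PanelSample.aemeasurable_estimator (hs : PanelSample P M Q Z ξ) {I : Folds K}
    (L : Learner I 𝒳 S) {Ker : ℝ → ℝ} (hK : KernelAssumption Ker) (h d : ℝ) (n : ℕ) :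
    AEMeasurable (estimator L Ker h d Z ξ n) Q := by
  have h1 : ∀ k, AEMeasurable (fun ω => foldEstimator L Ker h d Z ξ n k ω) Q := by
    intro k
    simp only [foldEstimator_eq]
    refine AEMeasurable.div (AEMeasurable.div_const ?_ _) (hs.aemeasurable_density I hK h d n k)
    exact Finset.aemeasurable_fun_sum _ fun i _ => hs.aemeasurable_residualScore L hK h d n k i
  unfold estimator
  exact (Finset.aemeasurable_fun_sum _ fun k _ => h1 k).div_const _
omit [IsProbabilityMeasure P] in
theorem integral_obs {f : Obs 𝒳 → ℝ} (hf : Measurable f) :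
    ∫ z, f z ∂(P.map M.obs) = ∫ ω, f (M.obs ω) ∂P :=
  integral_map M.measurable_obs.aemeasurable hf.aestronglyMeasurable

omit [IsProbabilityMeasure P] in
theorem ae_obs_le {f : Obs 𝒳 → ℝ} (hf : Measurable f) {B : ℝ} (h : ∀ᵐ ω ∂P, |f (M.obs ω)| ≤ B) :
    ∀ᵐ z ∂(P.map M.obs), |f z| ≤ B :=
  (ae_map_iff M.measurable_obs.aemeasurable (measurableSet_le hf.abs measurable_const)).2 h

theorem memLp_two_obs {f : Obs 𝒳 → ℝ} (hf : Measurable f) {B : ℝ}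
    (h : ∀ᵐ ω ∂P, |f (M.obs ω)| ≤ B) : MemLp f 2 (P.map M.obs) := by
  have := Measure.isProbabilityMeasure_map (μ := P) M.measurable_obs.aemeasurable
  exact MemLp.of_bound hf.aestronglyMeasurable B (ae_obs_le hf h)

/-- Sample means of variables with second moments `O(1 / h)` converge faster than `(N h)^{-1/4}`. -/
theorem PanelSample.mean_toZero (hs : PanelSample P M Q Z ξ) (hK : 0 < K) {h : ℕ → ℝ}
    (hh : ∀ n, 0 < h n) (hNh : Tendsto (fun n => ((K * n : ℕ) : ℝ) * h n) atTop atTop)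
    {f : ℕ → Obs 𝒳 → ℝ} (hf : ∀ n, Measurable (f n)) {A B : ℝ}
    (hfb : ∀ᶠ n in atTop, ∀ᵐ ω ∂P, |f n (M.obs ω)| ≤ B / h n)
    (hf2 : ∀ᶠ n in atTop, ∫ ω, f n (M.obs ω) ^ 2 ∂P ≤ A / h n)
    (s : ∀ n, Finset (Fin (K * n))) {m : ℝ} (hm : 0 < m) (hcard : ∀ n, ((s n).card : ℝ) = m * n) :
    ToZero Q fun n ω => √(√(((K * n : ℕ) : ℝ) * h n)) *
      ((∑ i ∈ s n, f n (Z i ω)) / (s n).card - ∫ ω, f n (M.obs ω) ∂P) := by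
  intro e he
  have hsq : Tendsto (fun n => √(((K * n : ℕ) : ℝ) * h n)) atTop atTop :=
    Real.tendsto_sqrt_atTop.comp hNh
  have hlim : Tendsto (fun n => ENNReal.ofReal (A * K / (e ^ 2 * m) *
      (√(((K * n : ℕ) : ℝ) * h n))⁻¹)) atTop (𝓝 0) := by
    rw [← ENNReal.ofReal_zero]
    refine ENNReal.tendsto_ofReal ?_
    simpa using hsq.inv_tendsto_atTop.const_mul (A * K / (e ^ 2 * m))
  refine tendsto_of_tendsto_of_tendsto_of_le_of_le' tendsto_const_nhds hlim
    (Eventually.of_forall fun _ => zero_le) ?_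
  filter_upwards [hfb, hf2, eventually_gt_atTop 0] with n h1 h2 hn
  have hnr : (0 : ℝ) < n := by exact_mod_cast hn
  have hKr : (0 : ℝ) < K := by exact_mod_cast hK
  have hhn := hh n
  set r := √(((K * n : ℕ) : ℝ) * h n) with hr
  have hr2 : r ^ 2 = K * n * h n := by
    rw [hr, Real.sq_sqrt (by positivity)]; push_cast; ring
  have hr0 : 0 < r := by
    rw [hr]; apply Real.sqrt_pos.2; push_cast; positivity
  have hrr : √r ^ 2 = r := Real.sq_sqrt hr0.le
  have hrr0 : 0 < √r := Real.sqrt_pos.2 hr0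
  have hind : iIndepFun (fun (i : Fin (K * n)) => Z i) Q := hs.indep.precomp Fin.val_injective
  have hch := measure_sum_sub_ge_le (fun i : Fin (K * n) => hs.aemeasurable i)
    (fun i => hs.law i) hind (s n) (hf n) (memLp_two_obs (hf n) h1)
    (c := e * (m * n) / √r) (by positivity)
  rw [hcard, integral_obs (hf n), integral_obs ((hf n).pow_const 2)] at hch
  rw [hcard]
  refine (measure_mono fun ω hω => ?_).trans (hch.trans (ENNReal.ofReal_le_ofReal ?_))
  · have hω' : e ≤ |√r * ((∑ i ∈ s n, f n (Z i ω)) / (m * n) - ∫ ω, f n (M.obs ω) ∂P)| := hω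
    have e1 : √r * ((∑ i ∈ s n, f n (Z i ω)) / (m * n) - ∫ ω, f n (M.obs ω) ∂P)
        = √r / (m * n) * (∑ i ∈ s n, f n (Z i ω) - m * n * ∫ ω, f n (M.obs ω) ∂P) := by
      field_simp
    rw [e1, abs_mul, abs_of_pos (by positivity : 0 < √r / (m * n))] at hω'
    change e * (m * n) / √r ≤ _
    rw [div_le_iff₀ hrr0]
    rw [div_mul_eq_mul_div, le_div_iff₀ (by positivity)] at hω'
    linarith
  · calc m * n * (∫ ω, f n (M.obs ω) ^ 2 ∂P) / (e * (m * n) / √r) ^ 2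
        ≤ m * n * (A / h n) / (e * (m * n) / √r) ^ 2 := by gcongr
      _ = A * r / (e ^ 2 * m * n * h n) := by
        rw [div_pow, hrr]; field_simp
      -- Since $nh=r^2/K$, Chebyshev's bound at scale $\sqrt r$ is of order $1/r$, which tends to
      -- zero.
      _ = A * K * r / (e ^ 2 * m * r ^ 2) := by
        rw [hr2]; field_simp
      _ = _ := by field_simp

/-- The bound depends on `h` and serves only to put the score in $L^2$. -/
theorem RegularAt.ae_residualScore_le {Ker : ℝ → ℝ} {h d ε κ c C A : ℝ} {η : Nuisance 𝒳}
    (hr : RegularAt P M Ker h d κ C A) (hc : 0 < c) (ha : IsAccurate P M Ker h d ε κ c C η) :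
    ∃ B, ∀ᵐ ω ∂P, |residualScore Ker h d η (M.obs ω)| ≤ B := by
  have hκ := hr.κ_pos
  have hC := hr.C_pos
  obtain ⟨Bk, hBk, hk⟩ := hr.kernel.exists_bound
  refine ⟨(Bk / h + C / κ) * (3 * C), ?_⟩
  filter_upwards [ae_map_X ha.g_bounds, ae_map_X ha.fh_bounds, ae_map_X ha.m_bound, hr.dY_lt]
    with ω g1 f1 m1 y1
  have hg0 := hκ.trans g1.1
  rw [residualScore_eq η ω hg0.ne', abs_mul]
  have e1 : |M.dY ω - η.m (M.X ω)| ≤ 3 * C := (abs_sub _ _).trans (by linarith)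
  have e2 : |η.fh (M.X ω) / η.g (M.X ω)| ≤ C / κ := by
    rw [abs_div, abs_of_pos hg0, abs_of_pos (hc.trans f1.1)]
    have := f1.2.le
    have := g1.1.le
    gcongr
  have e3 : |scaledKernel Ker h (M.D ω - d) - ({0} : Set ℝ).indicator (fun _ => (1 : ℝ)) (M.D ω) *
      (η.fh (M.X ω) / η.g (M.X ω))| ≤ Bk / h + C / κ := by
    refine (abs_sub _ _).trans (add_le_add (hk h hr.h_pos _) ?_)
    rw [abs_mul]
    exact (mul_le_of_le_one_left (abs_nonneg _) (abs_indicator_one_le _)).trans e2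
  have hh := hr.h_pos
  gcongr

theorem PanelSample.measure_not_isAccurate_tendsto (hs : PanelSample P M Q Z ξ) {I : Folds K}
    (L : Learner I 𝒳 S) {Ker : ℝ → ℝ} (hKer : KernelAssumption Ker) {h ε : ℕ → ℝ} {d κ c C : ℝ}
    (k : Fin K)
    (hnuis : Tendsto (fun n => Q {ω |
      GoodNuisance P M Ker (h n) d (ε n) κ c C (fittedNuisance L Z ξ n k ω)}) atTop (𝓝 1)) :
    Tendsto (fun n => Q {ω | ¬ IsAccurate P M Ker (h n) d (ε n) κ c C
      (fittedNuisance L Z ξ n k ω)}) atTop (𝓝 0) := by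
  have h1 : Tendsto (fun n => Q {ω | IsAccurate P M Ker (h n) d (ε n) κ c C
      (fittedNuisance L Z ξ n k ω)}) atTop (𝓝 1) :=
    tendsto_of_tendsto_of_tendsto_of_le_of_le hnuis tendsto_const_nhds
      (fun n => measure_mono fun ω hω => GoodNuisance.isAccurate hω) fun n => prob_le_one
  have h2 : ∀ n, Q {ω | ¬ IsAccurate P M Ker (h n) d (ε n) κ c C (fittedNuisance L Z ξ n k ω)}
      = 1 - Q {ω | IsAccurate P M Ker (h n) d (ε n) κ c C (fittedNuisance L Z ξ n k ω)} :=
    fun n => prob_compl_eq_one_sub₀ ((hs.aemeasurable_aux I n k).nullMeasurableSet_preimage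
      (measurableSet_isAccurate hKer L n k))
  simp only [h2]
  have := ENNReal.Tendsto.sub (tendsto_const_nhds (x := (1 : ℝ≥0∞))) h1 (Or.inl (by simp))
  simpa using this

/-- The probability that replacing the true nuisance parameters by cross-fitted estimates changes a
fold mean by more than `e / √(N h)`. -/
theorem PanelSample.measure_nuisance_ge_le (hs : PanelSample P M Q Z ξ) (hK : 0 < K) {I : Folds K}
    (L : Learner I 𝒳 S) {Ker : ℝ → ℝ} {h ε d κ c C A : ℝ} (hc : 0 < c)
    (hr : RegularAt P M Ker h d κ C A) (k : Fin K) {e : ℝ} (he : 0 < e) {n : ℕ} (hn : 0 < n)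
    (hsm : (C + 1) / κ * (√((K * n : ℕ) : ℝ) * ε ^ 2) < e / 2) :
    Q {ω | e ≤ |√(((K * n : ℕ) : ℝ) * h) *
      ((∑ i with I.fold n i = k,
          residualScore Ker h d (fittedNuisance L Z ξ n k ω) (Z i ω)) / n
        - (∑ i with I.fold n i = k,
          residualScore Ker h d (trueNuisance P M Ker h d) (Z i ω)) / n)|}
      ≤ Q {ω | ¬ IsAccurate P M Ker h d ε κ c C (fittedNuisance L Z ξ n k ω)} +
        ENNReal.ofReal (4 * K * (4 * (A + (C / κ) ^ 2 + (3 * C / κ) ^ 2 +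
          (3 * C ^ 2 / κ ^ 2) ^ 2)) / e ^ 2 * ε ^ 2) := by
  have hKer := hr.kernel
  have hκ := hr.κ_pos
  have hC := hr.C_pos
  have hKr : (0 : ℝ) < K := by exact_mod_cast hK
  set B := 4 * (A + (C / κ) ^ 2 + (3 * C / κ) ^ 2 + (3 * C ^ 2 / κ ^ 2) ^ 2) with hB
  have hB0 : 0 < B := by
    have := hr.A_pos
    positivity
  have hnr : (0 : ℝ) < n := by exact_mod_cast hn
  have hhn := hr.h_pos
  have hs0 : 0 < √h := Real.sqrt_pos.2 hhn
  have hN0 : (0 : ℝ) < ((K * n : ℕ) : ℝ) := by push_cast; positivity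
  have hsN0 : 0 < √((K * n : ℕ) : ℝ) := Real.sqrt_pos.2 hN0
  have hrsplit : √(((K * n : ℕ) : ℝ) * h) = √((K * n : ℕ) : ℝ) * √h :=
    Real.sqrt_mul hN0.le _
  set r := √(((K * n : ℕ) : ℝ) * h) with hrdef
  have hr2 : r ^ 2 = K * n * h := by
    rw [hrdef, Real.sq_sqrt (by positivity)]; push_cast; ring
  have hr0 : 0 < r := Real.sqrt_pos.2 (by positivity)
  set a := (C + 1) / κ * (ε ^ 2 / √h) with ha
  -- The factors $\sqrt h$ cancel: on the scale $\sqrt{Nh}$ the mean shift is a multiple of $\sqrt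
  -- N\varepsilon^2$.
  have hra : r * a = (C + 1) / κ * (√((K * n : ℕ) : ℝ) * ε ^ 2) := by
    rw [ha, hrsplit]; field_simp
  have hcardι : (Fintype.card {i : Fin (K * n) // I.fold n i = k} : ℝ) = n := by
    rw [Fintype.card_subtype, I.card_eq]
  set F : (I.Aux n k → Obs 𝒳) × S → Obs 𝒳 → ℝ := fun y z =>
    residualScore Ker h d (L.fit n k y.1 y.2) z
      - residualScore Ker h d (trueNuisance P M Ker h d) z with hFd
  have hFm : Measurable (Function.uncurry F) :=
    (measurable_uncurry_residualScore hKer h d L n k).sub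
      ((measurable_true_residualScore hKer).comp measurable_snd)
  have mfh : ∀ y : (I.Aux n k → Obs 𝒳) × S, Measurable (L.fit n k y.1 y.2).fh := fun y =>
    show Measurable fun x => (L.fit n k y.1 y.2).fh x from
      (L.measurable_fh n k).comp (measurable_prodMk_left (x := y))
  have mg : ∀ y : (I.Aux n k → Obs 𝒳) × S, Measurable (L.fit n k y.1 y.2).g := fun y =>
    show Measurable fun x => (L.fit n k y.1 y.2).g x from
      (L.measurable_g n k).comp (measurable_prodMk_left (x := y))
  have mm : ∀ y : (I.Aux n k → Obs 𝒳) × S, Measurable (L.fit n k y.1 y.2).m := fun y =>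
    show Measurable fun x => (L.fit n k y.1 y.2).m x from
      (L.measurable_m n k).comp (measurable_prodMk_left (x := y))
  have hFy : ∀ y, Measurable (F y) := fun y => by
    change Measurable fun z => Function.uncurry F (y, z)
    fun_prop
  have := Measure.isProbabilityMeasure_map (μ := P) M.measurable_obs.aemeasurable
  obtain ⟨Bk, hBk, hk⟩ := hKer.exists_bound
  have hT := measure_sum_ge_le_of_indep (Q := Q) (μ := P.map M.obs)
    (u := fun ω (i : {i : Fin (K * n) // I.fold n i = k}) => Z i.1 ω)
    (v := fun ω => ((fun i : I.Aux n k => Z i.1 ω), ξ ω))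
    (aemeasurable_pi_lambda _ fun i => hs.aemeasurable _) (hs.aemeasurable_aux I n k)
    (hs.fold_law I n k)
    (hs.indepFun_fold_aux I n k) hFm (measurableSet_isAccurate hKer L n k) (a := a)
    (b := B * (ε ^ 2 / h)) (c := e * n / r)
    (fun y hy => by
      obtain ⟨B1, hB1⟩ := hr.ae_residualScore_le hc hy
      refine memLp_two_obs (hFy y) (B := B1 + 3 * C * (Bk + C / κ) / h) ?_
      filter_upwards [hB1, hr.ae_true_residualScore_le_const (hk h hhn)] with ω e1 e2
      exact (abs_sub _ _).trans (add_le_add e1 e2))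
    (fun y hy => by
      rw [integral_obs (hFy y)]
      exact hr.abs_mean_sub (mfh y) (mg y) (mm y) hc hy)
    (fun y hy => by
      rw [integral_obs ((hFy y).pow_const 2)]
      exact hr.second_moment_sub (mfh y) (mg y) (mm y) hc hy)
    (by
      rw [hcardι, lt_div_iff₀ hr0]
      nlinarith)
  rw [hcardι] at hT
  refine (measure_mono fun ω hω => ?_).trans (hT.trans ?_)
  · have hω' : e ≤ |r * ((∑ i with I.fold n i = k,
          residualScore Ker h d (fittedNuisance L Z ξ n k ω) (Z i ω)) / n
        - (∑ i with I.fold n i = k,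
          residualScore Ker h d (trueNuisance P M Ker h d) (Z i ω)) / n)| := hω
    rw [← sub_div, ← Finset.sum_sub_distrib, abs_mul, abs_div, abs_of_pos hr0, abs_of_pos hnr,
      ← mul_div_assoc, le_div_iff₀ hnr] at hω'
    change e * n / r ≤ _
    rw [div_le_iff₀ hr0, mul_comm _ r]
    refine hω'.trans (le_of_eq ?_)
    rw [Finset.sum_subtype _ (p := fun i => I.fold n i = k) (by simp)]
    rfl
  · refine add_le_add le_rfl (ENNReal.ofReal_le_ofReal ?_)
    have e1 : e * n / r - n * a = n * (e - r * a) / r := by field_simp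
    rw [e1, hra]
    -- The mean shift uses at most half of the threshold; this is the source of the factor `4` in
    -- the bound.
    have e2 : e / 2 ≤ e - (C + 1) / κ * (√((K * n : ℕ) : ℝ) * ε ^ 2) := by linarith
    calc n * (B * (ε ^ 2 / h)) / (n * (e - (C + 1) / κ * (√((K * n : ℕ) : ℝ) * ε ^ 2)) / r) ^ 2
        ≤ n * (B * (ε ^ 2 / h)) / (n * (e / 2) / r) ^ 2 := by gcongr
      _ = 4 * B * ε ^ 2 * r ^ 2 / (n * h * e ^ 2) := by field_simp; ring
      _ = _ := by rw [hr2]; field_simp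

/-- Replacing the true nuisance parameters by cross-fitted estimates changes the fold means by
`o_P((N h)^{-1/2})`. -/
theorem PanelSample.nuisance_toZero (hs : PanelSample P M Q Z ξ) (hK : 0 < K) {I : Folds K}
    (L : Learner I 𝒳 S) {Ker : ℝ → ℝ} {h ε : ℕ → ℝ} {d κ c C A : ℝ} (hc : 0 < c)
    (hreg : ∀ᶠ n in atTop, RegularAt P M Ker (h n) d κ C A)
    (hnuis : ∀ k : Fin K, Tendsto (fun n => Q {ω |
      GoodNuisance P M Ker (h n) d (ε n) κ c C (fittedNuisance L Z ξ n k ω)}) atTop (𝓝 1))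
    (hε0 : Tendsto ε atTop (𝓝 0))
    (hε : Tendsto (fun n => √((K * n : ℕ) : ℝ) * ε n ^ 2) atTop (𝓝 0)) (k : Fin K) :
    ToZero Q fun n ω => √(((K * n : ℕ) : ℝ) * h n) *
      ((∑ i with I.fold n i = k,
          residualScore Ker (h n) d (fittedNuisance L Z ξ n k ω) (Z i ω)) / n
        - (∑ i with I.fold n i = k,
          residualScore Ker (h n) d (trueNuisance P M Ker (h n) d) (Z i ω)) / n) := by
  intro e he
  obtain ⟨n₀, hn₀⟩ := hreg.exists
  have hKer := hn₀.kernel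
  have hκ := hn₀.κ_pos
  have hC := hn₀.C_pos
  set B := 4 * (A + (C / κ) ^ 2 + (3 * C / κ) ^ 2 + (3 * C ^ 2 / κ ^ 2) ^ 2) with hB
  have hlim : Tendsto (fun n => Q {ω | ¬ IsAccurate P M Ker (h n) d (ε n) κ c C
      (fittedNuisance L Z ξ n k ω)} + ENNReal.ofReal (4 * K * B / e ^ 2 * ε n ^ 2)) atTop (𝓝 0) := by
    have h1 : Tendsto (fun n => ENNReal.ofReal (4 * K * B / e ^ 2 * ε n ^ 2)) atTop (𝓝 0) := by
      rw [← ENNReal.ofReal_zero]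
      refine ENNReal.tendsto_ofReal ?_
      simpa using (hε0.pow 2).const_mul (4 * K * B / e ^ 2)
    simpa using (hs.measure_not_isAccurate_tendsto L hKer k (hnuis k)).add h1
  refine tendsto_of_tendsto_of_tendsto_of_le_of_le' tendsto_const_nhds hlim
    (Eventually.of_forall fun _ => zero_le) ?_
  have hsmall : ∀ᶠ n in atTop, (C + 1) / κ * (√((K * n : ℕ) : ℝ) * ε n ^ 2) < e / 2 := by
    have := hε.const_mul ((C + 1) / κ)
    rw [mul_zero] at this
    exact this.eventually_lt_const (by positivity)
  filter_upwards [hreg, hsmall, eventually_gt_atTop 0] with n hr hsm hn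
  exact hs.measure_nuisance_ge_le hK L hc hr k he hn hsm

end Panel

/-- Linearization of a ratio of sample means. -/
theorem abs_ratio_linearization_le {r T T₀ e₀ F f μk θ δ Θ : ℝ} (hf : 0 < f) (hr : 1 ≤ r)
    (he : e₀ = θ * f) (hθ : |θ| ≤ Θ) (hδ : δ ≤ f / 2)
    (hx : |√r * (T₀ - e₀)| < δ) (hy : |√r * (F - f)| < δ) (hW : |r * (T - T₀)| < δ) :
    |r * (T / F - θ - ((T₀ - e₀) / f - θ * (F - μk) / f))|
      ≤ (2 + Θ) * δ * δ * (2 / f ^ 2) + δ / f + Θ * (r * |μk - f|) / f := by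
  have hr0 : 0 < r := by linarith
  have hs1 : 1 ≤ √r := Real.one_le_sqrt.2 hr
  have hsr : √r * √r = r := Real.mul_self_sqrt hr0.le
  have hδ0 : 0 < δ := (abs_nonneg _).trans_lt hx
  have hΘ0 : 0 ≤ Θ := (abs_nonneg _).trans hθ
  have hFf : |F - f| < δ := by
    rw [abs_mul, abs_of_pos (by linarith)] at hy
    nlinarith [abs_nonneg (F - f)]
  have hF : f / 2 ≤ F := by linarith [(abs_lt.1 hFf).1]
  have hF0 : 0 < F := by linarith
  set x := √r * (T₀ - e₀) with hxd
  set y := √r * (F - f) with hyd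
  set W := r * (T - T₀) with hWd
  -- Exact remainder of the quotient: a product of two deviations on the scale $\sqrt r$, the
  -- nuisance error `W`, and the gap between the mean `μk` of the kernel and its limit `f`.
  have key : r * (T / F - θ - ((T₀ - e₀) / f - θ * (F - μk) / f))
      = -((x + W / √r - θ * y) * y / (f * F)) + W / f - θ * (r * (μk - f)) / f := by
    have hs0 : √r ≠ 0 := by linarith
    have e1 : (x + W / √r - θ * y) * y
        = r * ((T₀ - e₀) + (T - T₀) - θ * (F - f)) * (F - f) := by
      have hrw : W / √r = √r * (T - T₀) := by
        rw [hWd]; nth_rewrite 1 [← hsr]; field_simp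
      rw [hrw, hxd, hyd]
      linear_combination ((T₀ - e₀) + (T - T₀) - θ * (F - f)) * (F - f) * hsr
    rw [e1, hWd, he]
    field_simp
    ring
  rw [key]
  have hWs : |W / √r| ≤ δ := by
    rw [abs_div, abs_of_pos (by linarith : 0 < √r)]
    exact (div_le_self (abs_nonneg _) hs1).trans hW.le
  have b1 : |x + W / √r - θ * y| ≤ (2 + Θ) * δ := by
    refine (abs_sub _ _).trans ?_
    have h1 := abs_add_le x (W / √r)
    have h2 : |θ * y| ≤ Θ * δ := by rw [abs_mul]; gcongr
    linarith
  have b2 : |(x + W / √r - θ * y) * y / (f * F)| ≤ (2 + Θ) * δ * δ * (2 / f ^ 2) := by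
    rw [abs_div, abs_mul, abs_of_pos (mul_pos hf hF0)]
    calc |x + W / √r - θ * y| * |y| / (f * F) ≤ (2 + Θ) * δ * δ / (f * (f / 2)) := by gcongr
      _ = _ := by field_simp
  have b3 : |W / f| ≤ δ / f := by
    rw [abs_div, abs_of_pos hf]; gcongr
  have b4 : |θ * (r * (μk - f)) / f| ≤ Θ * (r * |μk - f|) / f := by
    rw [abs_div, abs_mul, abs_mul, abs_of_pos hf, abs_of_pos hr0]; gcongr
  have t1 := abs_sub (-((x + W / √r - θ * y) * y / (f * F)) + W / f) (θ * (r * (μk - f)) / f)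
  have t2 := abs_add_le (-((x + W / √r - θ * y) * y / (f * F))) (W / f)
  rw [abs_neg] at t2
  linarith

end Assembly

/-! ### The influence function and its central limit theorem. -/

section Normality

variable {Ω Ω' 𝒳 S : Type*} [MeasurableSpace Ω] [MeasurableSpace Ω'] [MeasurableSpace 𝒳]
  [MeasurableSpace S] {P : Measure Ω} [IsProbabilityMeasure P] {M : Population Ω 𝒳}
  {Q : Measure Ω'} [IsProbabilityMeasure Q] {Z : ℕ → Ω' → Obs 𝒳} {ξ : Ω' → S} {K : ℕ}

/-- The influence function of the estimator at bandwidth `h`; `f` is the value `f_D(d)`. -/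
noncomputable def influence (P : Measure Ω) [IsFiniteMeasure P] (M : Population Ω 𝒳)
    (Ker : ℝ → ℝ) (h d f : ℝ) (z : Obs 𝒳) : ℝ :=
  residualScore Ker h d (trueNuisance P M Ker h d) z / f - ATTh P M Ker h d f
    - ATTh P M Ker h d f / f *
      (scaledKernel Ker h (z.trt - d) - ∫ ω, scaledKernel Ker h (M.D ω - d) ∂P)

theorem measurable_kernel_trt {Ker : ℝ → ℝ} (hK : KernelAssumption Ker) (h d : ℝ) :
    Measurable fun z : Obs 𝒳 => scaledKernel Ker h (z.trt - d) := by
  have hk := hK.measurable_scaled h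
  unfold Obs.trt
  fun_prop

theorem measurable_influence {Ker : ℝ → ℝ} (hK : KernelAssumption Ker) (h d f : ℝ) :
    Measurable (influence P M Ker h d f) := by
  have h1 := measurable_kernel_trt (𝒳 := 𝒳) hK h d
  have h2 := measurable_true_residualScore (P := P) (M := M) (h := h) (d := d) hK
  unfold influence
  fun_prop

theorem integral_influence_sq {Ker : ℝ → ℝ} (hK : KernelAssumption Ker) (h d f : ℝ) :
    ∫ z, influence P M Ker h d f z ^ 2 ∂(P.map M.obs) = asympVar P M Ker h d f := by
  rw [integral_obs ((measurable_influence hK h d f).pow_const 2), asympVar]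
  simp only [score_eq]
  rfl

theorem RegularAt.integrable_true_residualScore {Ker : ℝ → ℝ} {h d κ C A : ℝ}
    (hr : RegularAt P M Ker h d κ C A) :
    Integrable (fun ω => residualScore Ker h d (trueNuisance P M Ker h d) (M.obs ω)) P := by
  obtain ⟨Bk, -, hk⟩ := hr.kernel.exists_bound
  exact integrable_of_ae_bound ((measurable_true_residualScore hr.kernel).comp M.measurable_obs)
    (hr.ae_true_residualScore_le_const (hk h hr.h_pos))

theorem RegularAt.integral_influence {Ker : ℝ → ℝ} {h d κ C A f : ℝ}
    (hr : RegularAt P M Ker h d κ C A) :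
    ∫ z, influence P M Ker h d f z ∂(P.map M.obs) = 0 := by
  rw [integral_obs (measurable_influence hr.kernel h d f)]
  have i1 : Integrable (fun ω => residualScore Ker h d (trueNuisance P M Ker h d) (M.obs ω) / f) P :=
    hr.integrable_true_residualScore.div_const f
  have i2 : Integrable (fun ω => residualScore Ker h d (trueNuisance P M Ker h d) (M.obs ω) / f
      - ATTh P M Ker h d f) P := i1.sub (integrable_const _)
  have i3 : Integrable (fun ω => scaledKernel Ker h (M.D ω - d)
      - ∫ ω, scaledKernel Ker h (M.D ω - d) ∂P) P := hr.integrable_kernel.sub (integrable_const _)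
  change ∫ ω, (residualScore Ker h d (trueNuisance P M Ker h d) (M.obs ω) / f
      - ATTh P M Ker h d f - ATTh P M Ker h d f / f *
      (scaledKernel Ker h (M.D ω - d) - ∫ ω, scaledKernel Ker h (M.D ω - d) ∂P)) ∂P = 0
  rw [integral_sub i2 (i3.const_mul _), integral_sub i1 (integrable_const _), integral_const_mul,
    integral_sub hr.integrable_kernel (integrable_const _), integral_div, hr.ATTh_eq f]
  simp

theorem RegularAt.ae_influence_le {Ker : ℝ → ℝ} {h d κ C A f Bk Θ : ℝ}
    (hr : RegularAt P M Ker h d κ C A) (hf : 0 < f)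
    (hk : ∀ u, |scaledKernel Ker h u| ≤ Bk / h) (hΘ : |ATTh P M Ker h d f| ≤ Θ) :
    ∀ᵐ z ∂(P.map M.obs), |influence P M Ker h d f z|
      ≤ (3 * C * (Bk + C / κ) / f + Θ + Θ / f * (2 * Bk)) / h := by
  refine ae_obs_le (measurable_influence hr.kernel h d f) ?_
  filter_upwards [hr.ae_true_residualScore_le_const hk] with ω hω
  have hh := hr.h_pos
  have hΘ0 : 0 ≤ Θ := (abs_nonneg _).trans hΘ
  have hμ : |∫ ω, scaledKernel Ker h (M.D ω - d) ∂P| ≤ Bk / h := by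
    have := norm_integral_le_of_norm_le_const (μ := P) (f := fun ω => scaledKernel Ker h (M.D ω - d))
      (C := Bk / h) (Eventually.of_forall fun ω => hk _)
    simpa using this
  have e1 : |residualScore Ker h d (trueNuisance P M Ker h d) (M.obs ω) / f|
      ≤ 3 * C * (Bk + C / κ) / h / f := by
    rw [abs_div, abs_of_pos hf]; gcongr
  have e2 : Θ ≤ Θ / h := le_div_self hΘ0 hh hr.h_le
  have e3 : |ATTh P M Ker h d f / f * (scaledKernel Ker h ((M.obs ω).trt - d)
      - ∫ ω, scaledKernel Ker h (M.D ω - d) ∂P)| ≤ Θ / f * (Bk / h + Bk / h) := by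
    rw [abs_mul, abs_div, abs_of_pos hf]
    have := (abs_sub (scaledKernel Ker h ((M.obs ω).trt - d))
      (∫ ω, scaledKernel Ker h (M.D ω - d) ∂P)).trans (add_le_add (hk _) hμ)
    gcongr
  have e4 : (3 * C * (Bk + C / κ) / f + Θ + Θ / f * (2 * Bk)) / h
      = 3 * C * (Bk + C / κ) / h / f + Θ / h + Θ / f * (Bk / h + Bk / h) := by
    field_simp; ring
  rw [influence, e4]
  have t1 := abs_sub (residualScore Ker h d (trueNuisance P M Ker h d) (M.obs ω) / f
    - ATTh P M Ker h d f) (ATTh P M Ker h d f / f * (scaledKernel Ker h ((M.obs ω).trt - d)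
      - ∫ ω, scaledKernel Ker h (M.D ω - d) ∂P))
  have t2 := abs_sub (residualScore Ker h d (trueNuisance P M Ker h d) (M.obs ω) / f)
    (ATTh P M Ker h d f)
  linarith

/-- The central limit theorem for the standardized influence functions. -/
theorem PanelSample.tendstoInDistribution_influence (hs : PanelSample P M Q Z ξ) (hK : 0 < K)
    {Ker : ℝ → ℝ} (hKer : KernelAssumption Ker) {h : ℕ → ℝ} {d κ C A f v Θ : ℝ} (hf : 0 < f)
    (hh : ∀ n, 0 < h n) (hNh : Tendsto (fun n => ((K * n : ℕ) : ℝ) * h n) atTop atTop)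
    (hreg : ∀ᶠ n in atTop, RegularAt P M Ker (h n) d κ C A) (hv : 0 < v)
    (hV : ∀ᶠ n in atTop, v ≤ h n * asympVar P M Ker (h n) d f)
    (hΘ : ∀ᶠ n in atTop, |ATTh P M Ker (h n) d f| ≤ Θ) :
    TendstoInDistribution (fun (n : ℕ) ω => (√((K * n : ℕ) : ℝ))⁻¹ * ∑ i : Fin (K * n),
        influence P M Ker (h n) d f (Z i ω) / √(asympVar P M Ker (h n) d f))
      atTop (id : ℝ → ℝ) (fun _ => Q) (gaussianReal 0 1) := by
  have := Measure.isProbabilityMeasure_map (μ := P) M.measurable_obs.aemeasurable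
  obtain ⟨Bk, -, hk⟩ := hKer.exists_bound
  set B := 3 * C * (Bk + C / κ) / f + Θ + Θ / f * (2 * Bk) with hB
  have hKr : (0 : ℝ) < K := by exact_mod_cast hK
  have hVpos : ∀ᶠ n in atTop, 0 < asympVar P M Ker (h n) d f := by
    filter_upwards [hV] with n hn
    exact pos_of_mul_pos_right (hv.trans_le hn) (hh n).le
  refine tendstoInDistribution_triangular (μ := P.map M.obs) hs.aemeasurable hs.law hs.indep hK
    (q := fun n z => influence P M Ker (h n) d f z / √(asympVar P M Ker (h n) d f))
    (fun n => (measurable_influence hKer _ d f).div_const _)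
    -- The numerator is at most `B / h` and the standard deviation at least $\sqrt{v/h}$. Divided by
    -- $\sqrt n$, the quotient is a multiple of $(Nh)^{-1/2}$.
    (b := fun n => B / (√v * √(h n))) ?_ ?_ ?_ ?_
  · filter_upwards [hreg, hV, hVpos, hΘ] with n hr hvn hp ht
    filter_upwards [hr.ae_influence_le hf (hk _ (hh n)) ht] with z hz
    have hB0 : 0 ≤ B / h n := (abs_nonneg _).trans hz
    have hs0 : 0 < √(h n) := Real.sqrt_pos.2 (hh n)
    have hv0 : 0 < √v := Real.sqrt_pos.2 hv
    have hV0 : 0 < √(asympVar P M Ker (h n) d f) := Real.sqrt_pos.2 hp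
    have hle : √v ≤ √(h n) * √(asympVar P M Ker (h n) d f) := by
      rw [← Real.sqrt_mul (hh n).le]; exact Real.sqrt_le_sqrt hvn
    rw [abs_div, abs_of_pos hV0, div_le_iff₀ hV0]
    calc |influence P M Ker (h n) d f z| ≤ B / h n := hz
      _ = B / h n * (√v / √v) := by rw [div_self hv0.ne', mul_one]
      _ ≤ B / h n * (√(h n) * √(asympVar P M Ker (h n) d f) / √v) := by gcongr
      _ = B / (√(h n) * √(h n)) * (√(h n) * √(asympVar P M Ker (h n) d f) / √v) := by
        rw [Real.mul_self_sqrt (hh n).le]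
      _ = _ := by field_simp
  · filter_upwards [hreg] with n hr
    rw [integral_div, hr.integral_influence, zero_div]
  · filter_upwards [hVpos] with n hp
    simp only [div_pow]
    rw [integral_div, integral_influence_sq hKer, Real.sq_sqrt hp.le, div_self hp.ne']
  · have h1 : Tendsto (fun n => B * √K / √v * (√(((K * n : ℕ) : ℝ) * h n))⁻¹) atTop (𝓝 0) := by
      simpa using (Real.tendsto_sqrt_atTop.comp hNh).inv_tendsto_atTop.const_mul (B * √K / √v)
    refine h1.congr' ?_
    filter_upwards [eventually_gt_atTop 0] with n hn
    have hnr : (0 : ℝ) < n := by exact_mod_cast hn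
    have e : √(((K * n : ℕ) : ℝ) * h n) = √K * √n * √(h n) := by
      push_cast
      rw [Real.sqrt_mul (by positivity), Real.sqrt_mul hKr.le]
    have a1 : 0 < √(h n) := Real.sqrt_pos.2 (hh n)
    have a2 : 0 < √v := Real.sqrt_pos.2 hv
    rw [e]
    field_simp

omit [MeasurableSpace Ω'] in
-- The density estimates leave out one fold each, yet their average over folds is the full-sample
-- kernel mean, because every observation is used $K-1$ times. Averaging the folds therefore
-- recovers the influence function exactly, with no cross-fold remainder.
theorem sum_influence_eq {I : Folds K} {Ker : ℝ → ℝ} (h d : ℝ) {f : ℝ} (hf : 0 < f) (hK : 2 ≤ K)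
    {n : ℕ} (hn : 0 < n) (ω : Ω') :
    (∑ i : Fin (K * n), influence P M Ker h d f (Z i ω)) / ((K * n : ℕ) : ℝ)
      = (∑ k : Fin K, (((∑ i with I.fold n i = k,
          residualScore Ker h d (trueNuisance P M Ker h d) (Z i ω)) / n
            - ATTh P M Ker h d f * f) / f
        - ATTh P M Ker h d f * (fittedDensity I Ker h d Z n k ω
            - ∫ ω, scaledKernel Ker h (M.D ω - d) ∂P) / f)) / K := by
  have hnr : (0 : ℝ) < n := by exact_mod_cast hn
  have hKr : (2 : ℝ) ≤ K := by exact_mod_cast hK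
  have hK1 : (K : ℝ) * n - n ≠ 0 := by nlinarith
  have hK2 : (K : ℝ) - 1 ≠ 0 := by linarith
  set θ := ATTh P M Ker h d f
  set μk := ∫ ω, scaledKernel Ker h (M.D ω - d) ∂P
  have e1 : ∑ i : Fin (K * n), influence P M Ker h d f (Z i ω)
      = (∑ i : Fin (K * n), residualScore Ker h d (trueNuisance P M Ker h d) (Z i ω)) / f
        - K * n * θ - θ / f * (∑ i : Fin (K * n), scaledKernel Ker h ((Z i ω).trt - d)
          - K * n * μk) := by
    simp only [influence]
    rw [Finset.sum_sub_distrib, Finset.sum_sub_distrib, ← Finset.mul_sum, Finset.sum_sub_distrib,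
      ← Finset.sum_div]
    simp [θ, μk]
  have e2 : ∑ k : Fin K, fittedDensity I Ker h d Z n k ω
      = (∑ i : Fin (K * n), scaledKernel Ker h ((Z i ω).trt - d)) / n := by
    simp only [fittedDensity]
    rw [← Finset.sum_div, sum_fold_compl, div_eq_div_iff hK1 hnr.ne']
    ring
  have e3 : ∑ k : Fin K, (∑ i with I.fold n i = k,
      residualScore Ker h d (trueNuisance P M Ker h d) (Z i ω)) / n
      = (∑ i : Fin (K * n), residualScore Ker h d (trueNuisance P M Ker h d) (Z i ω)) / n := by
    rw [← Finset.sum_div, sum_fold]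
  rw [Finset.sum_sub_distrib, ← Finset.sum_div, ← Finset.sum_div, ← Finset.mul_sum,
    Finset.sum_sub_distrib, Finset.sum_sub_distrib, e1, e2, e3]
  simp only [Finset.sum_const, Finset.card_univ, Fintype.card_fin, nsmul_eq_mul]
  push_cast
  field_simp

end Normality

/-! ### Limit law of the cross-fitted estimator. -/

section Normality

variable {Ω Ω' 𝒳 S : Type*} [MeasurableSpace Ω] [MeasurableSpace Ω'] [MeasurableSpace 𝒳]
  [MeasurableSpace S] {P : Measure Ω} [IsProbabilityMeasure P] {M : Population Ω 𝒳}
  {Q : Measure Ω'} [IsProbabilityMeasure Q] {Z : ℕ → Ω' → Obs 𝒳} {ξ : Ω' → S} {K : ℕ}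

theorem PanelSample.score_mean_toZero (hs : PanelSample P M Q Z ξ) (hK : 0 < K) {Ker : ℝ → ℝ}
    (hKer : KernelAssumption Ker) {h : ℕ → ℝ} {d κ C A f : ℝ} (hf : 0 < f) (hh : ∀ n, 0 < h n)
    (hNh : Tendsto (fun n => ((K * n : ℕ) : ℝ) * h n) atTop atTop)
    (hreg : ∀ᶠ n in atTop, RegularAt P M Ker (h n) d κ C A) (I : Folds K) (k : Fin K) :
    ToZero Q fun n ω => √(√(((K * n : ℕ) : ℝ) * h n)) *
      ((∑ i with I.fold n i = k, residualScore Ker (h n) d (trueNuisance P M Ker (h n) d) (Z i ω)) / n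
        - ATTh P M Ker (h n) d f * f) := by
  obtain ⟨Bk, -, hk⟩ := hKer.exists_bound
  have hcard : ∀ n, ((Finset.univ.filter fun i => I.fold n i = k).card : ℝ) = 1 * n := fun n => by
    rw [I.card_eq, one_mul]
  have H := hs.mean_toZero hK hh hNh (fun n => measurable_true_residualScore hKer)
    (A := 18 * C ^ 2 * (A + (C / κ) ^ 2)) (B := 3 * C * (Bk + C / κ))
    (hreg.mono fun n hr => hr.ae_true_residualScore_le_const (hk _ (hh n)))
    (hreg.mono fun n hr => hr.true_second_moment)
    (fun n => Finset.univ.filter fun i => I.fold n i = k) one_pos hcard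
  refine ToZero.of_forall (J := Unit) (fun _ => H) fun e he => ⟨e, he, ?_⟩
  filter_upwards [hreg] with n hr ω hω
  have := hω ()
  rwa [I.card_eq, ← div_mul_cancel₀ (∫ ω, residualScore Ker (h n) d
    (trueNuisance P M Ker (h n) d) (M.obs ω) ∂P) hf.ne', ← hr.ATTh_eq f] at this

/-- The sampling error is handled by `mean_toZero`. The bias is negligible even on the larger scale
$\sqrt{Nh}$, which dominates $(Nh)^{1/4}$ once $Nh\ge1$. -/
theorem PanelSample.density_toZero (hs : PanelSample P M Q Z ξ) (hK : 2 ≤ K) {Ker : ℝ → ℝ}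
    (hKer : KernelAssumption Ker) {h : ℕ → ℝ} {d κ C A f : ℝ} (hh : ∀ n, 0 < h n)
    (hNh : Tendsto (fun n => ((K * n : ℕ) : ℝ) * h n) atTop atTop)
    (hreg : ∀ᶠ n in atTop, RegularAt P M Ker (h n) d κ C A)
    (hμ : Tendsto (fun n => √(((K * n : ℕ) : ℝ) * h n) *
      |(∫ ω, scaledKernel Ker (h n) (M.D ω - d) ∂P) - f|) atTop (𝓝 0)) (I : Folds K) (k : Fin K) :
    ToZero Q fun n ω => √(√(((K * n : ℕ) : ℝ) * h n)) *
      (fittedDensity I Ker (h n) d Z n k ω - f) := by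
  obtain ⟨Bk, -, hk⟩ := hKer.exists_bound
  have hKr : (2 : ℝ) ≤ K := by exact_mod_cast hK
  have hcard : ∀ n, ((Finset.univ.filter fun i => I.fold n i ≠ k).card : ℝ) = ((K : ℝ) - 1) * n :=
    fun n => by rw [card_fold_compl]; ring
  have H := hs.mean_toZero (by lia) hh hNh (fun n => measurable_kernel_trt hKer (h n) d)
    (A := A) (B := Bk) (Eventually.of_forall fun n => Eventually.of_forall fun ω => hk _ (hh n) _)
    (hreg.mono fun n hr => hr.kernel_sq_le.2)
    (fun n => Finset.univ.filter fun i => I.fold n i ≠ k) (by linarith : (0 : ℝ) < K - 1) hcard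
  refine ToZero.of_forall (J := Unit) (fun _ => H) fun e he => ⟨e / 2, by positivity, ?_⟩
  filter_upwards [hμ.eventually_lt_const (by positivity : 0 < e / 2),
    hNh.eventually_ge_atTop 1] with n h1 h2 ω hω
  have h3 := hω ()
  rw [card_fold_compl] at h3
  have hr1 : 1 ≤ √(((K * n : ℕ) : ℝ) * h n) := Real.one_le_sqrt.2 h2
  have hsr : √(√(((K * n : ℕ) : ℝ) * h n)) ≤ √(((K * n : ℕ) : ℝ) * h n) :=
    Real.sqrt_le_iff.2 ⟨by linarith, by nlinarith⟩
  have h4 : |√(√(((K * n : ℕ) : ℝ) * h n)) *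
      ((∫ ω, scaledKernel Ker (h n) (M.D ω - d) ∂P) - f)| < e / 2 := by
    rw [abs_mul, abs_of_nonneg (Real.sqrt_nonneg _)]
    exact (mul_le_mul_of_nonneg_right hsr (abs_nonneg _)).trans_lt h1
  have e1 : √(√(((K * n : ℕ) : ℝ) * h n)) * (fittedDensity I Ker (h n) d Z n k ω - f)
      = √(√(((K * n : ℕ) : ℝ) * h n)) * ((∑ i with I.fold n i ≠ k,
          scaledKernel Ker (h n) ((Z i ω).trt - d)) / ((K : ℝ) * n - n)
          - ∫ ω, scaledKernel Ker (h n) (M.D ω - d) ∂P)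
        + √(√(((K * n : ℕ) : ℝ) * h n)) *
          ((∫ ω, scaledKernel Ker (h n) (M.D ω - d) ∂P) - f) := by
    rw [fittedDensity]; ring
  rw [e1]
  have h5 : |√(√(((K * n : ℕ) : ℝ) * h n)) * ((∑ i with I.fold n i ≠ k,
          scaledKernel Ker (h n) ((Z i ω).trt - d)) / ((K : ℝ) * n - n)
          - ∫ ω, scaledKernel Ker (h n) (M.D ω - d) ∂P)| < e / 2 := h3
  exact (abs_add_le _ _).trans_lt (by linarith)

theorem exists_small (f Θ v e : ℝ) (hf : 0 < f) (he : 0 < e) :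
    ∃ δ > 0, δ ≤ f / 2 ∧ ((2 + Θ) * δ * δ * (2 / f ^ 2) + δ / f) / √v < e := by
  have hc : Tendsto (fun δ : ℝ => ((2 + Θ) * δ * δ * (2 / f ^ 2) + δ / f) / √v) (𝓝[>] 0) (𝓝 0) := by
    have : Continuous fun δ : ℝ => ((2 + Θ) * δ * δ * (2 / f ^ 2) + δ / f) / √v := by fun_prop
    simpa using (this.tendsto 0).mono_left nhdsWithin_le_nhds
  have h1 : ∀ᶠ δ : ℝ in 𝓝[>] 0, δ ≤ f / 2 :=
    nhdsWithin_le_nhds (Iic_mem_nhds (by positivity))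
  obtain ⟨δ, ⟨h2, h3⟩, h4⟩ :=
    ((h1.and (hc.eventually_lt_const he)).and self_mem_nhdsWithin).exists
  exact ⟨δ, h4, h2, h3⟩

/-- Asymptotic normality of the estimator, given that the bias is negligible. -/
theorem PanelSample.tendstoInDistribution_estimator (hs : PanelSample P M Q Z ξ) (hK : 2 ≤ K)
    {I : Folds K} (L : Learner I 𝒳 S) {Ker : ℝ → ℝ} (hKer : KernelAssumption Ker) {h ε : ℕ → ℝ}
    {d κ c C A f v θ₀ : ℝ} (hc : 0 < c) (hf : 0 < f) (hv : 0 < v) (hh : ∀ n, 0 < h n)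
    (hNh : Tendsto (fun n => ((K * n : ℕ) : ℝ) * h n) atTop atTop)
    (hε0 : Tendsto ε atTop (𝓝 0))
    (hε : Tendsto (fun n => √((K * n : ℕ) : ℝ) * ε n ^ 2) atTop (𝓝 0))
    (hreg : ∀ᶠ n in atTop, RegularAt P M Ker (h n) d κ C A)
    (hnuis : ∀ k : Fin K, Tendsto (fun n => Q {ω |
      GoodNuisance P M Ker (h n) d (ε n) κ c C (fittedNuisance L Z ξ n k ω)}) atTop (𝓝 1))
    (hμ : Tendsto (fun n => √(((K * n : ℕ) : ℝ) * h n) *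
      |(∫ ω, scaledKernel Ker (h n) (M.D ω - d) ∂P) - f|) atTop (𝓝 0))
    (hθ : Tendsto (fun n => √(((K * n : ℕ) : ℝ) * h n) *
      |ATTh P M Ker (h n) d f - θ₀|) atTop (𝓝 0))
    (hV : ∀ᶠ n in atTop, v ≤ h n * asympVar P M Ker (h n) d f) :
    TendstoInDistribution (fun (n : ℕ) ω => (estimator L Ker (h n) d Z ξ n ω - θ₀) /
        (√(asympVar P M Ker (h n) d f) / √((K * n : ℕ) : ℝ)))
      atTop (id : ℝ → ℝ) (fun _ => Q) (gaussianReal 0 1) := by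
  have hKr : (2 : ℝ) ≤ K := by exact_mod_cast hK
  set Θ := |θ₀| + 1 with hΘd
  have hΘ0 : 0 ≤ Θ := by positivity
  have hΘ : ∀ᶠ n in atTop, |ATTh P M Ker (h n) d f| ≤ Θ := by
    filter_upwards [hθ.eventually_lt_const one_pos, hNh.eventually_ge_atTop 1] with n h1 h2
    have hr1 : 1 ≤ √(((K * n : ℕ) : ℝ) * h n) := Real.one_le_sqrt.2 h2
    have h3 : |ATTh P M Ker (h n) d f - θ₀| < 1 := by
      nlinarith [abs_nonneg (ATTh P M Ker (h n) d f - θ₀)]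
    have := abs_sub_abs_le_abs_sub (ATTh P M Ker (h n) d f) θ₀
    linarith
  have hclt := hs.tendstoInDistribution_influence (by lia) hKer hf hh hNh hreg hv hV hΘ
  set R : ℕ → Ω' → ℝ := fun n ω => (estimator L Ker (h n) d Z ξ n ω - θ₀) /
        (√(asympVar P M Ker (h n) d f) / √((K * n : ℕ) : ℝ))
      - (√((K * n : ℕ) : ℝ))⁻¹ * ∑ i : Fin (K * n),
        influence P M Ker (h n) d f (Z i ω) / √(asympVar P M Ker (h n) d f) with hR
  have hRm : ∀ n, AEMeasurable (R n) Q := fun n =>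
    (((hs.aemeasurable_estimator L hKer (h n) d n).sub_const _).div_const _).sub
      (hclt.forall_aemeasurable n)
  have hR0 : ToZero Q R := by
    set T : ℕ → Fin K → Ω' → ℝ := fun n k ω => (∑ i with I.fold n i = k,
      residualScore Ker (h n) d (fittedNuisance L Z ξ n k ω) (Z i ω)) / n with hT
    set T₀ : ℕ → Fin K → Ω' → ℝ := fun n k ω => (∑ i with I.fold n i = k,
      residualScore Ker (h n) d (trueNuisance P M Ker (h n) d) (Z i ω)) / n with hT₀
    set F : ℕ → Fin K → Ω' → ℝ := fun n k ω => fittedDensity I Ker (h n) d Z n k ω with hF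
    -- The three negligible deviations of each fold: numerator and denominator on the scale
    -- $(Nh)^{1/4}$, nuisance error on $(Nh)^{1/2}$.
    set X : Fin K × Fin 3 → ℕ → Ω' → ℝ := fun j n ω =>
      ![√(√(((K * n : ℕ) : ℝ) * h n)) * (T₀ n j.1 ω - ATTh P M Ker (h n) d f * f),
        √(√(((K * n : ℕ) : ℝ) * h n)) * (F n j.1 ω - f),
        √(((K * n : ℕ) : ℝ) * h n) * (T n j.1 ω - T₀ n j.1 ω)] j.2 with hX
    have hX0 : ∀ j, ToZero Q (X j) := by
      rintro ⟨k, j⟩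
      fin_cases j
      · exact hs.score_mean_toZero (by lia) hKer hf hh hNh hreg I k
      · exact hs.density_toZero hK hKer hh hNh hreg hμ I k
      · exact hs.nuisance_toZero (by lia) L hc hreg hnuis hε0 hε k
    refine ToZero.of_forall hX0 fun e he => ?_
    obtain ⟨δ, hδ, hδf, hδe⟩ := exists_small f Θ v (e / 3) hf (by positivity)
    refine ⟨δ, hδ, ?_⟩
    have hμ' : Tendsto (fun n => Θ * (√(((K * n : ℕ) : ℝ) * h n) *
        |(∫ ω, scaledKernel Ker (h n) (M.D ω - d) ∂P) - f|) / f / √v) atTop (𝓝 0) := by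
      simpa using ((hμ.const_mul Θ).div_const f).div_const √v
    have hθ' : Tendsto (fun n => √(((K * n : ℕ) : ℝ) * h n) *
        |ATTh P M Ker (h n) d f - θ₀| / √v) atTop (𝓝 0) := by
      simpa using hθ.div_const √v
    filter_upwards [hΘ, hV, hNh.eventually_ge_atTop 1, eventually_gt_atTop 0,
      hμ'.eventually_lt_const (by positivity : 0 < e / 3),
      hθ'.eventually_lt_const (by positivity : 0 < e / 3)] with n hΘn hVn hrn hn hμn hθn ω hω
    have hnr : (0 : ℝ) < n := by exact_mod_cast hn
    have hN0 : (0 : ℝ) < ((K * n : ℕ) : ℝ) := by push_cast; positivity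
    have hVpos : 0 < asympVar P M Ker (h n) d f := pos_of_mul_pos_right (hv.trans_le hVn) (hh n).le
    have hr1 : 1 ≤ √(((K * n : ℕ) : ℝ) * h n) := Real.one_le_sqrt.2 hrn
    set θ := ATTh P M Ker (h n) d f with hθd
    set V := asympVar P M Ker (h n) d f with hVd
    set μk := ∫ ω, scaledKernel Ker (h n) (M.D ω - d) ∂P with hμd
    set N := ((K * n : ℕ) : ℝ) with hNd
    set r := √(N * h n) with hrd
    have hsv : 0 < √v := Real.sqrt_pos.2 hv
    have hsV : 0 < √V := Real.sqrt_pos.2 hVpos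
    have hsN : 0 < √N := Real.sqrt_pos.2 hN0
    -- Non-degeneracy $v\le hV$ bounds the normalization by a multiple of $\sqrt{Nh}$.
    have hscale : √N / √V ≤ r / √v := by
      rw [div_le_div_iff₀ hsV hsv, hrd, Real.sqrt_mul hN0.le, mul_assoc, ← Real.sqrt_mul (hh n).le]
      gcongr
    set ρ : Fin K → ℝ := fun k => T n k ω / F n k ω - θ
      - ((T₀ n k ω - θ * f) / f - θ * (F n k ω - μk) / f) with hρd
    set b := (2 + Θ) * δ * δ * (2 / f ^ 2) + δ / f + Θ * (r * |μk - f|) / f with hbd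
    have hρ : ∀ k, r * |ρ k| ≤ b := fun k => by
      have hr0 : 0 ≤ r := by linarith
      have e1 : r * |ρ k| = |r * ρ k| := by rw [abs_mul, abs_of_nonneg hr0]
      rw [e1]
      exact abs_ratio_linearization_le hf hr1 rfl hΘn hδf (hω (k, 0)) (hω (k, 1)) (hω (k, 2))
    -- The remainder is the averaged linearization error plus the smoothing bias
    -- $ATT_h(d)-\theta_0$.
    have hRn : R n ω = √N / √V * ((∑ k, ρ k) / K + (θ - θ₀)) := by
      have e1 := sum_influence_eq (I := I) (P := P) (M := M) (Ker := Ker) (Z := Z) (h n) d hf hK hn ω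
      have e2 : estimator L Ker (h n) d Z ξ n ω = (∑ k, T n k ω / F n k ω) / K := by
        simp only [estimator, foldEstimator_eq, hT, hF]
      have e3 : (∑ k, ρ k) / K = (∑ k, T n k ω / F n k ω) / K - θ
          - (∑ i : Fin (K * n), influence P M Ker (h n) d f (Z i ω)) / N := by
        rw [hρd, Finset.sum_sub_distrib, Finset.sum_sub_distrib, sub_div, sub_div, e1]
        simp [hT₀, hF, hθd, hμd, show (K : ℝ) ≠ 0 by linarith]
      rw [e3]
      change (estimator L Ker (h n) d Z ξ n ω - θ₀) / (√V / √N)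
        - (√N)⁻¹ * ∑ i : Fin (K * n), influence P M Ker (h n) d f (Z i ω) / √V = _
      rw [e2, ← Finset.sum_div]
      have hNN : N = √N * √N := (Real.mul_self_sqrt hN0.le).symm
      generalize (∑ i : Fin (K * n), influence P M Ker (h n) d f (Z i ω)) = s
      generalize (∑ k, T n k ω / F n k ω) / K = t
      have : s / N = s / (√N * √N) := by rw [← hNN]
      rw [this]
      field_simp
      ring
    have hbound : |(∑ k, ρ k) / K + (θ - θ₀)| * r ≤ b + r * |θ - θ₀| := by
      have hr0 : 0 ≤ r := by linarith
      have h1 : r * |(∑ k, ρ k) / K| ≤ b := by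
        rw [abs_div, Nat.abs_cast, ← mul_div_assoc, div_le_iff₀ (by linarith)]
        calc r * |∑ k, ρ k| ≤ r * ∑ k, |ρ k| := by
              gcongr; exact Finset.abs_sum_le_sum_abs _ _
          _ = ∑ k, r * |ρ k| := Finset.mul_sum _ _ _
          _ ≤ ∑ _k : Fin K, b := Finset.sum_le_sum fun k _ => hρ k
          _ = b * K := by simp [mul_comm]
      have h2 := mul_le_mul_of_nonneg_left (abs_add_le ((∑ k, ρ k) / K) (θ - θ₀)) hr0
      linarith
    rw [hRn, abs_mul, abs_of_pos (by positivity : 0 < √N / √V)]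
    calc √N / √V * |(∑ k, ρ k) / K + (θ - θ₀)|
        ≤ r / √v * |(∑ k, ρ k) / K + (θ - θ₀)| := by gcongr
      _ = |(∑ k, ρ k) / K + (θ - θ₀)| * r / √v := by ring
      _ ≤ (b + r * |θ - θ₀|) / √v := by gcongr
      _ = ((2 + Θ) * δ * δ * (2 / f ^ 2) + δ / f) / √v + Θ * (r * |μk - f|) / f / √v
          + r * |θ - θ₀| / √v := by rw [hbd]; ring
      _ < e := by linarith
  -- Slutsky's theorem with limiting constant `0`.
  have hsum := hclt.add_of_tendstoInMeasure_const (c := 0) hR0.tendstoInMeasure hRm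
  convert! hsum using 1
  · funext n ω
    simp [hR]
  · funext x
    simp

end Normality

/-! ### Verification of the regularity conditions and of the rates. -/

section Main

variable {Ω 𝒳 : Type*} [MeasurableSpace Ω] [MeasurableSpace 𝒳] {P : Measure Ω}
  [IsProbabilityMeasure P] {M : Population Ω 𝒳}

theorem eventually_regularAt {Ker : ℝ → ℝ} {h : ℕ → ℝ} {fD : ℝ → ℝ} {fDX : 𝒳 → ℝ → ℝ}
    {fYD : ℝ → ℝ → ℝ} {dL dH κ c C d : ℝ} (hfDX : IsTreatedCondDensity P M fDX)
    (hsupp : SupportAssumption P M fDX dL dH κ) (hKer : KernelAssumption Ker)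
    (hb : BoundsSmoothness P M Ker h fD fDX fYD dL dH c C) (hd : d ∈ Ioo dL dH)
    (hh : ∀ n, 0 < h n) (hh0 : Tendsto h atTop (𝓝 0)) :
    ∃ A, ∀ᶠ n in atTop, RegularAt P M Ker (h n) d κ C A := by
  obtain ⟨A, h₀, hh₀, hA, H⟩ := exists_cond_second_moment hKer hfDX hsupp.dL_pos hd hb.fDX_smooth
    hb.fDX_second
  refine ⟨A, ?_⟩
  filter_upwards [hh0.eventually_lt_const hh₀, hh0.eventually_lt_const one_pos, hb.smoothed_bounds]
    with n h1 h2 h3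
  exact
    { kernel := hKer
      h_pos := hh n
      h_le := h2.le
      κ_pos := hsupp.κ_pos
      C_pos := hb.C_pos
      A_pos := hA
      dY_lt := hb.dY_lt
      trend_lt := ae_map_X hb.trend_lt
      smoothed_lt := ae_map_X (p := fun x => |smoothedCondDensity P M Ker (h n) d x| < C)
        (h3.mono fun x hx => by
          have := hx d hd
          rw [abs_of_pos (hb.c_pos.trans this.1)]
          exact this.2)
      overlap := ae_map_X (p := fun x => κ < propensity P M x ∧ propensity P M x ≤ 1)
        (hsupp.overlap.mono fun x hx => ⟨hx.1, measureReal_le_one⟩)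
      second_moment := ae_map_X (H _ (hh n) h1) }

/-- Undersmoothing: $\sqrt{Nh}\,h^2=\sqrt{Nh^5}$. -/
theorem BandwidthRates.tendsto_bias {K : ℕ} {h ε : ℕ → ℝ} (hr : BandwidthRates K h ε) {x : ℕ → ℝ}
    {A : ℝ} (hx : ∀ᶠ n in atTop, |x n| ≤ A * h n ^ 2) :
    Tendsto (fun n => √(((K * n : ℕ) : ℝ) * h n) * |x n|) atTop (𝓝 0) := by
  have h1 : Tendsto (fun n => A * √(((K * n : ℕ) : ℝ) * h n ^ 5)) atTop (𝓝 0) := by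
    simpa using hr.undersmooth.const_mul A
  refine tendsto_of_tendsto_of_tendsto_of_le_of_le' tendsto_const_nhds h1
    (Eventually.of_forall fun n => by positivity) ?_
  filter_upwards [hx] with n hn
  have e : √(((K * n : ℕ) : ℝ) * h n ^ 5) = √(((K * n : ℕ) : ℝ) * h n) * h n ^ 2 := by
    rw [show ((K * n : ℕ) : ℝ) * h n ^ 5 = ((K * n : ℕ) : ℝ) * h n * (h n ^ 2) ^ 2 by ring,
      Real.sqrt_mul (mul_nonneg (Nat.cast_nonneg _) (hr.h_pos n).le), Real.sqrt_sq (by positivity)]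
  rw [e]
  calc √(((K * n : ℕ) : ℝ) * h n) * |x n| ≤ √(((K * n : ℕ) : ℝ) * h n) * (A * h n ^ 2) := by gcongr
    _ = _ := by ring

/-- The expression is the square of $\varepsilon/N^{-1/4}$. -/
theorem tendsto_sqrt_mul_sq {K : ℕ} (hK : 0 < K) {ε : ℕ → ℝ}
    (hε : ε =o[atTop] fun n => ((K * n : ℕ) : ℝ) ^ (-(1 / 4) : ℝ)) :
    Tendsto (fun n => √((K * n : ℕ) : ℝ) * ε n ^ 2) atTop (𝓝 0) := by
  have h1 := (hε.tendsto_div_nhds_zero).pow 2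
  rw [zero_pow two_ne_zero] at h1
  refine h1.congr' ?_
  filter_upwards [eventually_gt_atTop 0] with n hn
  have hN : (0 : ℝ) < ((K * n : ℕ) : ℝ) := by exact_mod_cast Nat.mul_pos hK hn
  have e : (((K * n : ℕ) : ℝ) ^ (-(1 / 4) : ℝ)) ^ 2 = (√((K * n : ℕ) : ℝ))⁻¹ := by
    rw [← Real.rpow_natCast, ← Real.rpow_mul hN.le, Real.sqrt_eq_rpow, ← Real.rpow_neg hN.le]
    norm_num
  rw [div_pow, e, div_inv_eq_mul, mul_comm]

end Main

end ContDID

/-- Asymptotic normality of the cross-fitted DML kernel estimator of `ATT(d)` in a panel. -/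
theorem theorem2
    {Ω Ω' 𝒳 S : Type*} [MeasurableSpace Ω] [MeasurableSpace Ω'] [MeasurableSpace 𝒳]
    [MeasurableSpace S]
    (P : Measure Ω) [IsProbabilityMeasure P] (M : Population Ω 𝒳)
    (Q : Measure Ω') [IsProbabilityMeasure Q] (Z : ℕ → Ω' → Obs 𝒳) (ξ : Ω' → S)
    (K : ℕ) (hK : 2 ≤ K) (I : Folds K) (L : Learner I 𝒳 S)
    (Ker : ℝ → ℝ) (h ε : ℕ → ℝ) (fD : ℝ → ℝ) (fDX : 𝒳 → ℝ → ℝ) (fYD : ℝ → ℝ → ℝ)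
    (dL dH κ c C d : ℝ)
    (hsample : PanelSample P M Q Z ξ)
    (hfD : IsTreatedDensity P M fD)
    (hfDX : IsTreatedCondDensity P M fDX)
    (hfYD : IsTreatedJointDensity P M fYD)
    (hsupp : SupportAssumption P M fDX dL dH κ)
    (hanticip : NoAnticipation P M)
    (htrend : ParallelTrends P M dL dH)
    (hKer : KernelAssumption Ker)
    (hbounds : BoundsSmoothness P M Ker h fD fDX fYD dL dH c C)
    (hd : d ∈ Ioo dL dH)
    (hrates : BandwidthRates K h ε)
    (hnuis : ∀ k : Fin K, Tendsto (fun n => Q {ω |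
      GoodNuisance P M Ker (h n) d (ε n) κ c C (fittedNuisance L Z ξ n k ω)}) atTop (𝓝 1))
    (hε : ε =o[atTop] fun n => ((K * n : ℕ) : ℝ) ^ (-(1 / 4) : ℝ))
    (hnondeg : ∃ v > 0, ∀ᶠ n in atTop, v ≤ h n * asympVar P M Ker (h n) d (fD d)) :
    Tendsto (localEffect P M d) (𝓝[>] 0) (𝓝 (ATT P M d)) ∧
    TendstoInDistribution
      (fun (n : ℕ) ω => (estimator L Ker (h n) d Z ξ n ω - ATT P M d) /
        (√(asympVar P M Ker (h n) d (fD d)) / √((K * n : ℕ) : ℝ)))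
      atTop (id : ℝ → ℝ) (fun _ => Q) (gaussianReal 0 1) := by
  obtain ⟨A, hreg⟩ := eventually_regularAt hfDX hsupp hKer hbounds hd hrates.h_pos hrates.h_tendsto
  obtain ⟨n₀, hr₀⟩ := hreg.exists
  obtain ⟨aY, hY⟩ := exists_smoothMoment_dY hfYD hbounds hd
  obtain ⟨am, hT⟩ := exists_smoothMoment_trend hfDX hbounds hd
  obtain ⟨B, hB⟩ := hbounds.fD_second
  have h1 := smoothMoment_one hfD hbounds.fD_smooth hB hd
  have hf : 0 < fD d := density_pos hfDX hsupp hd h1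
  have hpre : Integrable M.Ypre P := integrable_of_ae_bound M.measurable_Ypre
    (hbounds.Ypre_lt.mono fun ω hω => hω.le)
  have hloc := tendsto_localEffect hfDX hsupp hanticip htrend hr₀.integrable_dY hpre
    hr₀.integrable_trend hd h1 hY hT
  have hATT : ATT P M d = (aY - am) / fD d := hloc.limUnder_eq
  refine ⟨hATT ▸ hloc, ?_⟩
  obtain ⟨v, hv, hV⟩ := hnondeg
  have hd0 : 0 < d := hsupp.dL_pos.trans hd.1
  obtain ⟨B1, b1, hb1, -, H1⟩ := h1.bias hKer
  obtain ⟨B2, b2, hb2, -, H2⟩ := hKer.exists_tail hd0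
  obtain ⟨B3, b3, hb3, -, H3⟩ := (hY.sub M.measurable_D hT hr₀.integrable_dY
    hr₀.integrable_trend).bias hKer
  -- In the kernel mean, `B2` accounts for the atom at `0` and `B1` for smoothing the density. The
  -- bias of `ATTh` involves only `B3`, since the atom drops out of the mean score.
  refine hsample.tendstoInDistribution_estimator hK L hKer hbounds.c_pos hf hv hrates.h_pos
    hrates.Nh_tendsto hrates.ε_tendsto (tendsto_sqrt_mul_sq (by lia) hε) hreg hnuis
    (hrates.tendsto_bias (A := B2 + B1) ?_) (hrates.tendsto_bias (A := B3 / fD d) ?_) hV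
  · filter_upwards [hreg, hrates.h_tendsto.eventually_lt_const hb1,
      hrates.h_tendsto.eventually_lt_const hb2] with n hr e1 e2
    have t1 := hr.kernel_mean
    have t2 := H1 _ hr.h_pos e1
    have t3 := H2 _ hr.h_pos e2 (0 - d) (by rw [zero_sub, abs_neg, abs_of_pos hd0])
    refine (abs_sub_le _ _ _).trans ((add_le_add (t1.trans t3) t2).trans (le_of_eq ?_))
    ring
  · filter_upwards [hreg, hrates.h_tendsto.eventually_lt_const hb3] with n hr e3
    have t := H3 _ hr.h_pos e3
    rw [hATT, hr.ATTh_eq, hr.true_mean, ← sub_div, abs_div, abs_of_pos hf, div_mul_eq_mul_div]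
    gcongr
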